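/- **Soundness of categorical $d$-separation.** *String diagrams.* A hypergraph $G$ consists of a set of wires $W(G)$ and, for all $k,\ell\in\mathbb N$, a set of boxes with $k$ ordered input wires and $\ell$ ordered output wires. Let $\Sigma$ be a hypergraph. A gs-monoidal string diagram $\varphi$ over $\Sigma$ is a finite hypergraph $G$ with a hypergraph morphism $\mathsf{type}: G\to\Sigma$ and maps $p:\{1,\dots,n\}\to W(G)$ (global inputs) and $q:\{1,\dots,m\}\to W(G)$ (global outputs), such that $G$ has no directed cycle and every wire arises in exactly one way as a global input or as an output of a box. It is normalized if it contains no box all of whose outputs are discarded, i.e. are neither global outputs nor inputs of a box; $\mathsf{norm}$ denotes the iterated removal of such boxes together with their output wires. The free Markov category $\mathsf{FreeMarkov}_\Sigma$ has the finite sequences of wires of $\Sigma$ as objects and the isomorphism classes of normalized gs-monoidal string diagrams as morphisms; composition is gluing followed by $\mathsf{norm}$, the tensor product is juxtaposition, and swap, copy and discard morphisms are the diagrams without boxes of the corresponding shape. A generalized causal model is a normalized gs-monoidal string diagram $\varphi$ with $q$ injective; it need not be pure bloom, i.e. $q$ need not be surjective. Put $\mathsf{in}(\varphi)=p(\{1,\dots,n\})$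 and $\mathsf{out}(\varphi)=q(\{1,\dots,m\})$. *Compatibility.* Let $\mathsf C$ be a strict Markov category. A morphism $f:\bigotimes_{i=1}^n W_i'\to\bigotimes_{j=1}^m V_j'$ of $\mathsf C$ is compatible with $\varphi$ if there is a strict Markov functor $F:\mathsf{FreeMarkov}_\Sigma\to\mathsf C$ (a strict symmetric monoidal functor preserving the copy and discard morphisms) with $W'_i=F(\mathsf{type}(p(i)))$ for all $i$, $V_j'=F(\mathsf{type}(q(j)))$ for all $j$, and $f=F(\varphi)$. *$d$-separation.* For $\mathcal W\subseteq\mathsf{out}(\varphi)$, let $\varphi_{\mathcal W}$ be the normalization of the diagram obtained from $\varphi$ by discarding all global outputs outside of $\mathcal W$. For disjoint $\mathcal X,\mathcal Y,\mathcal Z\subseteq\mathsf{out}(\varphi)$, the set $\mathcal Z$ $d$-separates $\mathcal X$ and $\mathcal Y$ if, after deleting the wires in $\mathcal Z$ from $\varphi_{\mathcal X\cup\mathcal Y\cup\mathcal Z}$ (keeping all boxes, with correspondingly lowered arities), there is no undirected path from a wire in $\mathcal X$ to a wire in $\mathcal Y$; an undirected path is a finite sequence of wires in which any two consecutive wires are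 both incident (as input or output) to a common box. *Conditionals and conditional independence.* $\mathsf C$ has conditionals if for every $f:A\to X\otimes Y$ there is $f_{|X}:X\otimes A\to Y$ such that $f$ is obtained by copying $A$, applying the marginal $f_X:A\to X$ of $f$ to one copy, copying the resulting $X$, and applying $f_{|X}$ to one copy of $X$ and the other copy of $A$. A morphism $g:A\to X\otimes Y\otimes Z$ displays $X\perp Y\mid Z$ if there are $h:A\to Y\otimes Z$ and $k:Z\to X$ such that $g$ is, up to reordering the outputs, obtained from $h$ by copying $Z$ and applying $k$ to one of the copies. **Corollary.** Let $\mathsf C$ be a strict Markov category with conditionals, let $\varphi$ be a generalized causal model over a hypergraph $\Sigma$, and let $f$ be a morphism of $\mathsf C$ that is compatible with $\varphi$. Let $\mathcal X,\mathcal Y,\mathcal Z\subseteq\mathsf{out}(\varphi)$ be pairwise disjoint sets such that $\mathsf{in}(\varphi)\subseteq\mathcal Y\cup\mathcal Z$ and $\mathcal Z$ $d$-separates $\mathcal X$ and $\mathcal Y$. Then the marginal of $f$ on the tensor factors $V'_j$ with $q(j)\in\mathcal X$, $q(j)\in\mathcal Y$ and $q(j)\in\mathcal Z$ respectively displays the conditional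 independence $\mathcal X\perp\mathcal Y\mid\mathcal Z$. -/

import Mathlib

open CategoryTheory MonoidalCategory
open scoped ComonObj

universe u v w

noncomputable section

namespace CausalModels

/-! ### Hypergraphs -/

/-- A (directed) hypergraph: a set of wires and, for all `k` and `l`, a set of boxes with `k` input
wires and `l` output wires, listed in order and possibly with repetitions. -/
structure BoxHypergraph : Type (u + 1) where
  Wire : Type u
  Box : ℕ → ℕ → Type u
  inp : {k l : ℕ} → Box k l → Fin k → Wire
  out : {k l : ℕ} → Box k l → Fin l → Wire

/-- Morphisms of hypergraphs (natural transformations). -/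
structure HypHom (G H : BoxHypergraph.{u}) : Type u where
  wire : G.Wire → H.Wire
  box : {k l : ℕ} → G.Box k l → H.Box k l
  inp_box : ∀ {k l : ℕ} (b : G.Box k l) (i : Fin k), H.inp (box b) i = wire (G.inp b i)
  out_box : ∀ {k l : ℕ} (b : G.Box k l) (j : Fin l), H.out (box b) j = wire (G.out b j)

/-- Composition of morphisms of hypergraphs. -/
def HypHom.comp {G H K : BoxHypergraph.{u}} (f : HypHom G H) (g : HypHom H K) : HypHom G K where
  wire a := g.wire (f.wire a)
  box b := g.box (f.box b)
  inp_box b i := by rw [g.inp_box, f.inp_box]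
  out_box b i := by rw [g.out_box, f.out_box]

namespace BoxHypergraph

variable (G : BoxHypergraph.{u})

/-- All boxes of `G`, of any arity. -/
abbrev Edge : Type u := (k : ℕ) × (l : ℕ) × G.Box k l

/-- All output ports of all boxes of `G`. -/
abbrev OutPort : Type u := (k : ℕ) × (l : ℕ) × (_ : G.Box k l) × Fin l

/-- The wire attached to an output port. -/
def portWire (o : G.OutPort) : G.Wire := G.out o.2.2.1 o.2.2.2

/-- Some box has `a` among its inputs and `b` among its outputs. -/
def Step (a b : G.Wire) : Prop :=
  ∃ (k l : ℕ) (e : G.Box k l), (∃ i, G.inp e i = a) ∧ ∃ j, G.out e j = b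

/-- There is no directed cycle of wires and boxes. -/
def Acyclic : Prop := ∀ a : G.Wire, ¬ Relation.TransGen G.Step a a

/-- The wire `a` is an input or an output of the box `e`. -/
def Incident {k l : ℕ} (e : G.Box k l) (a : G.Wire) : Prop :=
  (∃ i, G.inp e i = a) ∨ ∃ j, G.out e j = a

/-- There is an undirected path between the wires `a` and `b`: a finite sequence of wires from `a`
to `b` in which any two consecutive wires are incident to a common box. -/
def UndirectedPath (a b : G.Wire) : Prop :=
  Relation.ReflTransGen
    (fun c d => ∃ (k l : ℕ) (e : G.Box k l), G.Incident e c ∧ G.Incident e d) a b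

open Classical in
/-- Remove the wires in `Z` from a list of wires. -/
def cutList (Z : Set G.Wire) (L : List G.Wire) : List {a : G.Wire // a ∉ Z} :=
  L.filterMap (fun a => if h : a ∉ Z then some ⟨a, h⟩ else none)

/-- The underlying hypergraph of `Cut_Z`: the boxes are those of `G`, the wires are those of `G` that
are not in `Z`, and the occurrences of wires in `Z` are removed from the inputs and outputs of all
boxes, which lowers the arities. -/
def cut (Z : Set G.Wire) : BoxHypergraph.{u} where
  Wire := {a : G.Wire // a ∉ Z}
  Box k l := {e : G.Edge // (G.cutList Z (List.ofFn (G.inp e.2.2))).length = k ∧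
    (G.cutList Z (List.ofFn (G.out e.2.2))).length = l}
  inp e i := (G.cutList Z (List.ofFn (G.inp e.1.2.2))).get (i.cast e.2.1.symm)
  out e j := (G.cutList Z (List.ofFn (G.out e.1.2.2))).get (j.cast e.2.2.symm)

end BoxHypergraph

/-! ### String diagrams -/

/-- The objects of the free gs-monoidal and of the free Markov category on `S`:
finite sequences of wires of `S`. -/
structure FreeMarkov (S : BoxHypergraph.{u}) : Type u where
  len : ℕ
  ty : Fin len → S.Wire

/-- A gs-monoidal string diagram over `S` from `σ` to `τ`: a cospan `n → G ← m` of finite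
hypergraphs over `S`, with discrete hypergraphs `n` and `m` as feet, such that `G` is acyclic and
left monogamous. -/
structure Diagram (S : BoxHypergraph.{u}) (σ τ : FreeMarkov S) : Type (u + 1) where
  G : BoxHypergraph.{u}
  finite_wire : Finite G.Wire
  finite_edge : Finite G.Edge
  type : HypHom G S
  p : Fin σ.len → G.Wire
  type_p : ∀ i, type.wire (p i) = σ.ty i
  q : Fin τ.len → G.Wire
  type_q : ∀ j, type.wire (q j) = τ.ty j
  acyclic : G.Acyclic
  /-- Every wire arises either as a global input or as an output of a box, in exactly one way. -/
  left_monogamous : Function.Bijective (Sum.elim p G.portWire)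

namespace Diagram

variable {S : BoxHypergraph.{u}} {σ τ υ χ : FreeMarkov S}

/-- Morphisms of string diagrams: morphisms of cospans in the slice category over `S`. -/
structure DHom (φ ψ : Diagram S σ τ) extends HypHom φ.G ψ.G where
  type_wire : ∀ a, ψ.type.wire (wire a) = φ.type.wire a
  type_box : ∀ {k l : ℕ} (b : φ.G.Box k l), ψ.type.box (box b) = φ.type.box b
  wire_p : ∀ i, wire (φ.p i) = ψ.p i
  wire_q : ∀ j, wire (φ.q j) = ψ.q j

/-- Isomorphism of string diagrams. -/
def Iso (φ ψ : Diagram S σ τ) : Prop :=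
  ∃ h : DHom φ ψ, Function.Bijective h.wire ∧
    ∀ k l : ℕ, Function.Bijective (h.box : φ.G.Box k l → ψ.G.Box k l)

def DHom.id (φ : Diagram S σ τ) : DHom φ φ where
  wire a := a
  box b := b
  inp_box _ _ := rfl
  out_box _ _ := rfl
  type_wire _ := rfl
  type_box _ := rfl
  wire_p _ := rfl
  wire_q _ := rfl

def DHom.comp {φ ψ θ : Diagram S σ τ} (f : DHom φ ψ) (g : DHom ψ θ) : DHom φ θ where
  wire a := g.wire (f.wire a)
  box b := g.box (f.box b)
  inp_box b i := by rw [g.inp_box, f.inp_box]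
  out_box b i := by rw [g.out_box, f.out_box]
  type_wire a := by rw [g.type_wire, f.type_wire]
  type_box b := by rw [g.type_box, f.type_box]
  wire_p i := by rw [f.wire_p, g.wire_p]
  wire_q i := by rw [f.wire_q, g.wire_q]

theorem Iso.refl (φ : Diagram S σ τ) : Iso φ φ :=
  ⟨DHom.id φ, Function.bijective_id, fun _ _ => Function.bijective_id⟩

theorem Iso.trans {φ ψ θ : Diagram S σ τ} : Iso φ ψ → Iso ψ θ → Iso φ θ := by
  rintro ⟨f, hf, hf'⟩ ⟨g, hg, hg'⟩
  exact ⟨f.comp g, hg.comp hf, fun k l => (hg' k l).comp (hf' k l)⟩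

theorem Iso.symm {φ ψ : Diagram S σ τ} : Iso φ ψ → Iso ψ φ := by
  rintro ⟨f, hf, hf'⟩
  let ew := Equiv.ofBijective _ hf
  let eb := fun k l => Equiv.ofBijective _ (hf' k l)
  have hew : ∀ a, ew.symm (f.wire a) = a := fun a => ew.symm_apply_apply a
  have hew' : ∀ a, f.wire (ew.symm a) = a := fun a => ew.apply_symm_apply a
  have heb' : ∀ {k l} (b : ψ.G.Box k l), f.box ((eb k l).symm b) = b :=
    fun {k l} b => (eb k l).apply_symm_apply b
  refine ⟨⟨⟨ew.symm, fun {k l} => (eb k l).symm, ?_, ?_⟩, ?_, ?_, ?_, ?_⟩, ew.symm.bijective,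
    fun k l => (eb k l).symm.bijective⟩
  · intro k l b i
    rw [← hew (φ.G.inp _ i), ← f.inp_box, heb']
  · intro k l b i
    rw [← hew (φ.G.out _ i), ← f.out_box, heb']
  · intro a
    conv_rhs => rw [← hew' a, f.type_wire]
  · intro k l b
    change φ.type.box ((eb k l).symm b) = _
    rw [← f.type_box, heb']
  · intro i
    change ew.symm (ψ.p i) = _
    rw [← f.wire_p, hew]
  · intro i
    change ew.symm (ψ.q i) = _
    rw [← f.wire_q, hew]

theorem p_injective (φ : Diagram S σ τ) : Function.Injective φ.p := fun i j h => by
  simpa using φ.left_monogamous.1 (a₁ := Sum.inl i) (a₂ := Sum.inl j) h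

theorem portWire_injective (φ : Diagram S σ τ) : Function.Injective φ.G.portWire := fun i j h => by
  simpa using φ.left_monogamous.1 (a₁ := Sum.inr i) (a₂ := Sum.inr j) h

theorem p_ne_out (φ : Diagram S σ τ) (i : Fin σ.len) {k l : ℕ} (b : φ.G.Box k l) (j : Fin l) :
    φ.p i ≠ φ.G.out b j := fun h => by
  simpa using φ.left_monogamous.1 (a₁ := Sum.inl i) (a₂ := Sum.inr ⟨k, l, b, j⟩) h

theorem wire_cases (φ : Diagram S σ τ) (a : φ.G.Wire) :
    (∃ i, φ.p i = a) ∨ ∃ (k l : ℕ) (b : φ.G.Box k l) (j : Fin l), φ.G.out b j = a := by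
  obtain ⟨i | ⟨k, l, b, j⟩, h⟩ := φ.left_monogamous.2 a
  · exact Or.inl ⟨i, h⟩
  · exact Or.inr ⟨k, l, b, j, h⟩

theorem bijective_source {G : BoxHypergraph.{u}} {n : ℕ} {p : Fin n → G.Wire}
    (h1 : Function.Injective p) (h2 : Function.Injective G.portWire)
    (h3 : ∀ i (k l : ℕ) (b : G.Box k l) (j : Fin l), p i ≠ G.out b j)
    (h4 : ∀ a, (∃ i, p i = a) ∨ ∃ (k l : ℕ) (b : G.Box k l) (j : Fin l), G.out b j = a) :
    Function.Bijective (Sum.elim p G.portWire) := by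
  refine ⟨h1.sumElim h2 ?_, fun a => ?_⟩
  · rintro i ⟨k, l, b, j⟩
    exact h3 i k l b j
  · rcases h4 a with ⟨i, h⟩ | ⟨k, l, b, j, h⟩
    · exact ⟨Sum.inl i, h⟩
    · exact ⟨Sum.inr ⟨k, l, b, j⟩, h⟩

/-- A morphism of diagrams that is bijective on boxes is bijective on wires as well. -/
theorem iso_of_box_bijective {φ ψ : Diagram S σ τ} (h : DHom φ ψ)
    (hb : ∀ k l : ℕ, Function.Bijective (h.box : φ.G.Box k l → ψ.G.Box k l)) : Iso φ ψ := by
  refine ⟨h, ⟨fun a a' e => ?_, fun a => ?_⟩, hb⟩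
  · rcases φ.wire_cases a with ⟨i, rfl⟩ | ⟨k, l, b, j, rfl⟩ <;>
      rcases φ.wire_cases a' with ⟨i', rfl⟩ | ⟨k', l', b', j', rfl⟩
    · rw [h.wire_p, h.wire_p] at e
      rw [ψ.p_injective e]
    · rw [h.wire_p, ← h.out_box] at e
      exact absurd e (ψ.p_ne_out _ _ _)
    · rw [h.wire_p, ← h.out_box] at e
      exact absurd e.symm (ψ.p_ne_out _ _ _)
    · rw [← h.out_box, ← h.out_box] at e
      have e2 := ψ.portWire_injective (a₁ := ⟨k, l, h.box b, j⟩) (a₂ := ⟨k', l', h.box b', j'⟩) e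
      obtain rfl : k = k' := congrArg (fun o => o.1) e2
      have e3 := eq_of_heq (Sigma.mk.inj e2).2
      obtain rfl : l = l' := congrArg (fun o => o.1) e3
      have e4 := eq_of_heq (Sigma.mk.inj e3).2
      obtain ⟨e5, e6⟩ := Sigma.mk.inj e4
      rw [(hb k l).1 e5, eq_of_heq e6]
  · rcases ψ.wire_cases a with ⟨i, rfl⟩ | ⟨k, l, b, j, rfl⟩
    · exact ⟨_, h.wire_p i⟩
    · obtain ⟨b, rfl⟩ := (hb k l).2 b
      exact ⟨_, (h.out_box b j).symm⟩

theorem acyclic_of_hom {G H : BoxHypergraph.{u}} (h : HypHom G H) (hH : H.Acyclic) : G.Acyclic := by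
  intro a ha
  refine hH (h.wire a) (ha.lift h.wire ?_)
  rintro b c ⟨k, l, e, ⟨i, rfl⟩, j, rfl⟩
  exact ⟨k, l, h.box e, ⟨i, h.inp_box e i⟩, j, h.out_box e j⟩

/-! ### Normalization -/

/-- A box is eliminable if each of its outputs gets discarded. -/
def Eliminable (φ : Diagram S σ τ) {k l : ℕ} (b : φ.G.Box k l) : Prop :=
  ∀ j : Fin l, (∀ i, φ.q i ≠ φ.G.out b j) ∧
    ∀ (k' l' : ℕ) (b' : φ.G.Box k' l') (i : Fin k'), φ.G.inp b' i ≠ φ.G.out b j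

/-- A diagram is normalized if it contains no eliminable boxes. -/
def Normalized (φ : Diagram S σ τ) : Prop :=
  ∀ (k l : ℕ) (b : φ.G.Box k l), ¬ φ.Eliminable b

/-- The boxes that are removed by the iterated elimination of eliminable boxes: a box gets removed
once no output of it is a global output and all boxes that use an output of it have been removed. -/
inductive Removed (φ : Diagram S σ τ) : {k l : ℕ} → φ.G.Box k l → Prop
  | intro {k l : ℕ} (b : φ.G.Box k l) (hq : ∀ (j : Fin l) i, φ.q i ≠ φ.G.out b j)
      (hb : ∀ (j : Fin l) (k' l' : ℕ) (b' : φ.G.Box k' l') (i : Fin k'),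
        φ.G.inp b' i = φ.G.out b j → Removed φ b') : Removed φ b

theorem Removed.q_ne {φ : Diagram S σ τ} {k l : ℕ} {b : φ.G.Box k l} (h : φ.Removed b) (j : Fin l)
    (i : Fin τ.len) : φ.q i ≠ φ.G.out b j := by
  cases h with
  | intro _ hq hb => exact hq j i

theorem Removed.of_inp {φ : Diagram S σ τ} {k l : ℕ} {b : φ.G.Box k l} (h : φ.Removed b) (j : Fin l)
    {k' l' : ℕ} (b' : φ.G.Box k' l') (i : Fin k') (e : φ.G.inp b' i = φ.G.out b j) :
    φ.Removed b' := by
  cases h with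
  | intro _ hq hb => exact hb j k' l' b' i e

/-- A wire survives normalization if it is not an output of a removed box. -/
def Survives (φ : Diagram S σ τ) (a : φ.G.Wire) : Prop :=
  ∀ (k l : ℕ) (b : φ.G.Box k l) (j : Fin l), φ.G.out b j = a → ¬ φ.Removed b

/-- The hypergraph of surviving wires and boxes. -/
def normGraph (φ : Diagram S σ τ) : BoxHypergraph.{u} where
  Wire := {a : φ.G.Wire // φ.Survives a}
  Box k l := {b : φ.G.Box k l // ¬ φ.Removed b}
  inp b i := ⟨φ.G.inp b.1 i, fun _ _ _ j e h => b.2 (h.of_inp j b.1 i e.symm)⟩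
  out {k l} b j := ⟨φ.G.out b.1 j, fun k' l' b' j' e h => by
    have e2 := φ.portWire_injective (a₁ := ⟨k', l', b', j'⟩) (a₂ := ⟨k, l, b.1, j⟩) e
    obtain rfl : k' = k := congrArg (fun o => o.1) e2
    have e3 := eq_of_heq (Sigma.mk.inj e2).2
    obtain rfl : l' = l := congrArg (fun o => o.1) e3
    have e4 := eq_of_heq (Sigma.mk.inj e3).2
    obtain rfl := (Sigma.mk.inj e4).1
    exact b.2 h⟩

/-- The inclusion of the surviving part of a diagram. -/
def normIncl (φ : Diagram S σ τ) : HypHom φ.normGraph φ.G where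
  wire a := a.1
  box b := b.1
  inp_box _ _ := rfl
  out_box _ _ := rfl

/-- The normalization of a string diagram. -/
def norm (φ : Diagram S σ τ) : Diagram S σ τ where
  G := φ.normGraph
  finite_wire := by
    have := φ.finite_wire
    exact Subtype.finite
  finite_edge := by
    have := φ.finite_edge
    refine Finite.of_injective (fun e : φ.normGraph.Edge => (⟨e.1, e.2.1, e.2.2.1⟩ : φ.G.Edge)) ?_
    rintro ⟨k, l, b, hb⟩ ⟨k', l', b', hb'⟩ e
    obtain rfl : k = k' := congrArg (fun o => o.1) e
    have e3 := eq_of_heq (Sigma.mk.inj e).2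
    obtain rfl : l = l' := congrArg (fun o => o.1) e3
    obtain rfl := eq_of_heq (Sigma.mk.inj e3).2
    rfl
  type :=
    { wire := fun a => φ.type.wire a.1
      box := fun b => φ.type.box b.1
      inp_box := fun b i => φ.type.inp_box b.1 i
      out_box := fun b i => φ.type.out_box b.1 i }
  p i := ⟨φ.p i, fun _ _ b j e _ => φ.p_ne_out i b j e.symm⟩
  type_p := φ.type_p
  q i := ⟨φ.q i, fun _ _ _ j e h => h.q_ne j i e.symm⟩
  type_q := φ.type_q
  acyclic := acyclic_of_hom φ.normIncl φ.acyclic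
  left_monogamous := by
    apply bijective_source
    · intro i j h
      exact φ.p_injective (congrArg Subtype.val h)
    · rintro ⟨k, l, ⟨b, hb⟩, j⟩ ⟨k', l', ⟨b', hb'⟩, j'⟩ e
      have e2 := φ.portWire_injective (a₁ := ⟨k, l, b, j⟩) (a₂ := ⟨k', l', b', j'⟩)
        (congrArg Subtype.val e)
      obtain rfl : k = k' := congrArg (fun o => o.1) e2
      have e3 := eq_of_heq (Sigma.mk.inj e2).2
      obtain rfl : l = l' := congrArg (fun o => o.1) e3
      have e4 := eq_of_heq (Sigma.mk.inj e3).2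
      obtain ⟨rfl, e6⟩ := Sigma.mk.inj e4
      rw [eq_of_heq e6]
    · intro i k l b j h
      exact φ.p_ne_out i b.1 j (congrArg Subtype.val h)
    · rintro ⟨a, ha⟩
      rcases φ.wire_cases a with ⟨i, rfl⟩ | ⟨k, l, b, j, rfl⟩
      · exact Or.inl ⟨i, rfl⟩
      · exact Or.inr ⟨k, l, ⟨b, ha k l b j rfl⟩, j, rfl⟩

theorem norm_normalized (φ : Diagram S σ τ) : φ.norm.Normalized := by
  rintro k l ⟨b, hb⟩ h
  refine hb (Removed.intro b (fun j i e => (h j).1 i (Subtype.ext e)) ?_)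
  intro j k' l' b' i e
  by_contra hb'
  exact (h j).2 k' l' ⟨b', hb'⟩ i (Subtype.ext e)

theorem not_removed_of_normalized {φ : Diagram S σ τ} (hφ : φ.Normalized) {k l : ℕ}
    (b : φ.G.Box k l) : ¬ φ.Removed b := by
  intro h
  induction h with
  | intro b hq hb ih => exact hφ _ _ b fun j => ⟨hq j, fun k' l' b' i e => ih j k' l' b' i e⟩

theorem norm_iso_of_normalized {φ : Diagram S σ τ} (hφ : φ.Normalized) : Iso φ.norm φ :=
  iso_of_box_bijective
    { φ.normIncl with
      type_wire := fun _ => rfl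
      type_box := fun _ => rfl
      wire_p := fun _ => rfl
      wire_q := fun _ => rfl }
    fun _ _ => ⟨Subtype.val_injective, fun b => ⟨⟨b, not_removed_of_normalized hφ b⟩, rfl⟩⟩

/-- In a finite acyclic diagram, a class of boxes is removed if none of its members outputs to a
global output or to a box outside of the class. -/
theorem removed_of_closed (φ : Diagram S σ τ) (P : {k l : ℕ} → φ.G.Box k l → Prop)
    (hq : ∀ {k l : ℕ} (b : φ.G.Box k l), P b → ∀ (j : Fin l) i, φ.q i ≠ φ.G.out b j)
    (hb : ∀ {k l : ℕ} (b : φ.G.Box k l), P b → ∀ (j : Fin l) (k' l' : ℕ) (b' : φ.G.Box k' l')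
      (i : Fin k'), φ.G.inp b' i = φ.G.out b j → P b') {k l : ℕ} (b : φ.G.Box k l) (h : P b) :
    φ.Removed b := by
  have := φ.finite_wire
  have hwf : WellFounded (Function.swap (Relation.TransGen φ.G.Step)) := by
    have : Std.Irrefl (Function.swap (Relation.TransGen φ.G.Step)) := ⟨fun a => φ.acyclic a⟩
    have : IsTrans φ.G.Wire (Function.swap (Relation.TransGen φ.G.Step)) :=
      ⟨fun a b c h h' => h'.trans h⟩
    exact Finite.wellFounded_of_trans_of_irrefl _
  have key : ∀ a : φ.G.Wire, ∀ (k l : ℕ) (b : φ.G.Box k l) (i : Fin k), φ.G.inp b i = a → P b →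
      φ.Removed b := by
    intro a
    induction a using hwf.induction with
    | _ a ih =>
      intro k l b i e hP
      refine Removed.intro b (hq b hP) fun j k' l' b' i' e' => ?_
      exact ih (φ.G.out b j) (Relation.TransGen.single ⟨k, l, b, ⟨i, e⟩, j, rfl⟩) k' l' b' i' e'
        (hb b hP j k' l' b' i' e')
  exact Removed.intro b (hq b h) fun j k' l' b' i e => key _ k' l' b' i e (hb b h j k' l' b' i e)

/-- A morphism of diagrams that is injective on boxes induces an isomorphism of normalizations. -/
theorem norm_iso_of_box_injective {φ ψ : Diagram S σ τ} (h : DHom φ ψ)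
    (hi : ∀ k l : ℕ, Function.Injective (h.box : φ.G.Box k l → ψ.G.Box k l)) :
    Iso φ.norm ψ.norm := by
  -- a box of `ψ` with an output wire in the image of `h` lies in the image of `h`
  have up : ∀ (a : φ.G.Wire) (k l : ℕ) (b : ψ.G.Box k l) (j : Fin l), ψ.G.out b j = h.wire a →
      ∃ b' : φ.G.Box k l, h.box b' = b ∧ φ.G.out b' j = a := by
    intro a k l b j e
    rcases φ.wire_cases a with ⟨i, rfl⟩ | ⟨k', l', b', j', rfl⟩
    · rw [h.wire_p] at e
      exact absurd e.symm (ψ.p_ne_out _ _ _)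
    · rw [← h.out_box] at e
      have e2 := ψ.portWire_injective (a₁ := ⟨k, l, b, j⟩) (a₂ := ⟨k', l', h.box b', j'⟩) e
      obtain rfl : k = k' := congrArg (fun o => o.1) e2
      have e3 := eq_of_heq (Sigma.mk.inj e2).2
      obtain rfl : l = l' := congrArg (fun o => o.1) e3
      have e4 := eq_of_heq (Sigma.mk.inj e3).2
      obtain ⟨rfl, e6⟩ := Sigma.mk.inj e4
      rw [eq_of_heq e6]
      exact ⟨b', rfl, rfl⟩
  have outside : ∀ {k l : ℕ} (b : ψ.G.Box k l), (¬ ∃ b', h.box b' = b) → ψ.Removed b := by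
    intro k l b hb
    refine ψ.removed_of_closed (fun b => ¬ ∃ b', h.box b' = b) ?_ ?_ b hb
    · intro k l b hb j i e
      rw [← h.wire_q] at e
      obtain ⟨b', e', -⟩ := up _ k l b j e.symm
      exact hb ⟨b', e'⟩
    · rintro k l b hb j k' l' b' i e ⟨c, rfl⟩
      rw [h.inp_box] at e
      obtain ⟨b', e', -⟩ := up _ k l b j e.symm
      exact hb ⟨b', e'⟩
  have fwd : ∀ {k l : ℕ} (b : φ.G.Box k l), φ.Removed b → ψ.Removed (h.box b) := by
    intro k l b hb
    induction hb with
    | intro b hq hb ih =>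
      refine Removed.intro _ ?_ ?_
      · intro j i e
        rw [← h.wire_q] at e
        obtain ⟨b', e', e''⟩ := up _ _ _ _ j e.symm
        rw [hi _ _ e'] at e''
        exact hq j i e''.symm
      · intro j k' l' b' i e
        by_cases hb' : ∃ c, h.box c = b'
        · obtain ⟨c, rfl⟩ := hb'
          rw [h.inp_box] at e
          obtain ⟨b', e', e''⟩ := up _ _ _ _ j e.symm
          rw [hi _ _ e'] at e''
          exact ih j k' l' c i e''.symm
        · exact outside b' hb'
  have bwd : ∀ {k l : ℕ} (b' : ψ.G.Box k l), ψ.Removed b' → ∀ b : φ.G.Box k l, h.box b = b' →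
      φ.Removed b := by
    intro k l b' hb'
    induction hb' with
    | intro b' hq hb ih =>
      rintro b rfl
      refine Removed.intro b ?_ ?_
      · intro j i e
        refine hq j i ?_
        rw [← h.wire_q, e, h.out_box]
      · intro j k' l' c i e
        exact ih j k' l' (h.box c) i (by rw [h.inp_box, e, h.out_box]) c rfl
  have surv : ∀ a, φ.Survives a → ψ.Survives (h.wire a) := by
    intro a ha k l b j e hb
    obtain ⟨b', rfl, e'⟩ := up a k l b j e
    exact ha k l b' j e' (bwd _ hb b' rfl)
  refine iso_of_box_bijective
    { wire := fun a => ⟨h.wire a.1, surv a.1 a.2⟩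
      box := fun b => ⟨h.box b.1, fun hb => b.2 (bwd _ hb b.1 rfl)⟩
      inp_box := fun b i => Subtype.ext (h.inp_box b.1 i)
      out_box := fun b i => Subtype.ext (h.out_box b.1 i)
      type_wire := fun a => h.type_wire a.1
      type_box := fun b => h.type_box b.1
      wire_p := fun i => Subtype.ext (h.wire_p i)
      wire_q := fun i => Subtype.ext (h.wire_q i) } fun k l => ⟨?_, ?_⟩
  · rintro ⟨b, hb⟩ ⟨b', hb'⟩ e
    exact Subtype.ext (hi k l (congrArg Subtype.val e))
  · rintro ⟨b, hb⟩
    by_cases hc : ∃ c, h.box c = b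
    · obtain ⟨c, rfl⟩ := hc
      exact ⟨⟨c, fun hc => hb (fwd c hc)⟩, rfl⟩
    · exact absurd (outside b hc) hb

theorem norm_iso_of_iso {φ ψ : Diagram S σ τ} : Iso φ ψ → Iso φ.norm ψ.norm := by
  rintro ⟨h, -, hb⟩
  exact norm_iso_of_box_injective h fun k l => (hb k l).1

/-- The inclusion of the normalization as a morphism of diagrams. -/
def normHom (φ : Diagram S σ τ) : DHom φ.norm φ :=
  { φ.normIncl with
    type_wire := fun _ => rfl
    type_box := fun _ => rfl
    wire_p := fun _ => rfl
    wire_q := fun _ => rfl }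

/-! ### Composition -/

section Comp

variable (φ : Diagram S σ τ) (ψ : Diagram S τ υ)

open Classical in
/-- The map from the wires of `ψ` to the wires of the composite: the `i`th global input of `ψ` is
glued to the `i`th global output of `φ`. -/
def glue (a : ψ.G.Wire) : φ.G.Wire ⊕ {a : ψ.G.Wire // ∀ i, ψ.p i ≠ a} :=
  if h : ∃ i, ψ.p i = a then Sum.inl (φ.q h.choose) else Sum.inr ⟨a, fun i e => h ⟨i, e⟩⟩

theorem glue_p (i : Fin τ.len) : glue φ ψ (ψ.p i) = Sum.inl (φ.q i) := by
  have h : ∃ j, ψ.p j = ψ.p i := ⟨i, rfl⟩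
  rw [glue, dif_pos h, ψ.p_injective h.choose_spec]

theorem glue_ne (a : ψ.G.Wire) (h : ∀ i, ψ.p i ≠ a) : glue φ ψ a = Sum.inr ⟨a, h⟩ := by
  rw [glue, dif_neg]
  rintro ⟨i, e⟩
  exact h i e

/-- The pushout of `φ.G` and `ψ.G` along the outputs of `φ` and the inputs of `ψ`. -/
def compGraph : BoxHypergraph.{u} where
  Wire := φ.G.Wire ⊕ {a : ψ.G.Wire // ∀ i, ψ.p i ≠ a}
  Box k l := φ.G.Box k l ⊕ ψ.G.Box k l
  inp b i := Sum.elim (fun b => Sum.inl (φ.G.inp b i)) (fun b => glue φ ψ (ψ.G.inp b i)) b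
  out b j := Sum.elim (fun b => Sum.inl (φ.G.out b j)) (fun b => glue φ ψ (ψ.G.out b j)) b

/-- The canonical map from the first component to the pushout. -/
def compInl : HypHom φ.G (compGraph φ ψ) where
  wire := Sum.inl
  box := Sum.inl
  inp_box _ _ := rfl
  out_box _ _ := rfl

/-- The canonical map from the second component to the pushout. -/
def compInr : HypHom ψ.G (compGraph φ ψ) where
  wire := glue φ ψ
  box := Sum.inr
  inp_box _ _ := rfl
  out_box _ _ := rfl

variable {φ ψ}

theorem desc_glue {K : BoxHypergraph.{u}} (f : HypHom φ.G K) (g : HypHom ψ.G K)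
    (h : ∀ i, f.wire (φ.q i) = g.wire (ψ.p i)) (a : ψ.G.Wire) :
    Sum.elim f.wire (fun a => g.wire a.1) (glue φ ψ a) = g.wire a := by
  by_cases ha : ∃ i, ψ.p i = a
  · obtain ⟨i, rfl⟩ := ha
    rw [glue_p]
    exact h i
  · rw [glue_ne φ ψ a fun i e => ha ⟨i, e⟩]
    rfl

/-- The universal property of the pushout. -/
def compDesc {K : BoxHypergraph.{u}} (f : HypHom φ.G K) (g : HypHom ψ.G K)
    (h : ∀ i, f.wire (φ.q i) = g.wire (ψ.p i)) : HypHom (compGraph φ ψ) K where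
  wire := Sum.elim f.wire (fun a => g.wire a.1)
  box b := Sum.elim f.box g.box b
  inp_box b i := by
    rcases b with b | b
    · exact f.inp_box b i
    · exact (g.inp_box b i).trans (desc_glue f g h _).symm
  out_box b i := by
    rcases b with b | b
    · exact f.out_box b i
    · exact (g.out_box b i).trans (desc_glue f g h _).symm

theorem compDesc_inr {K : BoxHypergraph.{u}} (f : HypHom φ.G K) (g : HypHom ψ.G K)
    (h : ∀ i, f.wire (φ.q i) = g.wire (ψ.p i)) (a : ψ.G.Wire) :
    (compDesc f g h).wire (glue φ ψ a) = g.wire a := desc_glue f g h a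

variable (φ ψ)

theorem compGraph_out_inr {k l : ℕ} (b : ψ.G.Box k l) (j : Fin l) :
    (compGraph φ ψ).out (Sum.inr b : φ.G.Box k l ⊕ ψ.G.Box k l) j =
      (Sum.inr ⟨ψ.G.out b j, fun i => ψ.p_ne_out i b j⟩ :
        φ.G.Wire ⊕ {a : ψ.G.Wire // ∀ i, ψ.p i ≠ a}) :=
  glue_ne φ ψ _ _

theorem compGraph_acyclic : (compGraph φ ψ).Acyclic := by
  have h1 : ∀ x y : (compGraph φ ψ).Wire, Relation.TransGen (compGraph φ ψ).Step x y →
      ∀ b : φ.G.Wire, y = Sum.inl b →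
        ∃ a : φ.G.Wire, x = Sum.inl a ∧ Relation.TransGen φ.G.Step a b := by
    have step : ∀ (x : (compGraph φ ψ).Wire) (b : φ.G.Wire),
        (compGraph φ ψ).Step x (Sum.inl b : φ.G.Wire ⊕ {a : ψ.G.Wire // ∀ i, ψ.p i ≠ a}) →
        ∃ a : φ.G.Wire, x = Sum.inl a ∧ φ.G.Step a b := by
      rintro x b ⟨k, l, e | e, ⟨i, hi⟩, j, hj⟩
      · exact ⟨φ.G.inp e i, hi.symm, k, l, e, ⟨i, rfl⟩, j, Sum.inl_injective hj⟩
      · rw [compGraph_out_inr] at hj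
        exact absurd hj (by simp)
    intro x y h
    induction h with
    | single h =>
      rintro b rfl
      obtain ⟨a, ha, hs⟩ := step _ _ h
      exact ⟨a, ha, .single hs⟩
    | tail _ h ih =>
      rintro b rfl
      obtain ⟨c, hc, hs⟩ := step _ _ h
      obtain ⟨a, ha, h'⟩ := ih c hc
      exact ⟨a, ha, h'.tail hs⟩
  have h2 : ∀ x y : (compGraph φ ψ).Wire, Relation.TransGen (compGraph φ ψ).Step x y →
      ∀ a b, x = Sum.inr a → y = Sum.inr b → Relation.TransGen ψ.G.Step a.1 b.1 := by
    have step : ∀ a b : {a : ψ.G.Wire // ∀ i, ψ.p i ≠ a}, (compGraph φ ψ).Step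
        (Sum.inr a : φ.G.Wire ⊕ {a : ψ.G.Wire // ∀ i, ψ.p i ≠ a})
        (Sum.inr b : φ.G.Wire ⊕ {a : ψ.G.Wire // ∀ i, ψ.p i ≠ a}) → ψ.G.Step a.1 b.1 := by
      rintro ⟨a, ha⟩ ⟨b, hb⟩ ⟨k, l, e | e, ⟨i, hi⟩, j, hj⟩
      · exact absurd hj (by simp [compGraph])
      · rw [compGraph_out_inr] at hj
        refine ⟨k, l, e, ⟨i, ?_⟩, j, congrArg Subtype.val (Sum.inr_injective hj)⟩
        change glue φ ψ _ = _ at hi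
        by_cases hc : ∃ i', ψ.p i' = ψ.G.inp e i
        · obtain ⟨i', hc⟩ := hc
          rw [← hc, glue_p] at hi
          exact absurd hi (by simp)
        · rw [glue_ne φ ψ _ fun i e => hc ⟨i, e⟩] at hi
          exact congrArg Subtype.val (Sum.inr_injective hi)
    intro x y h
    induction h with
    | single h =>
      rintro a b rfl rfl
      exact .single (step _ _ h)
    | @tail y z hy h ih =>
      rintro a b rfl rfl
      rcases y with c | c
      · obtain ⟨_, h', _⟩ := h1 _ _ hy c rfl
        exact absurd h' (by simp)
      · exact (ih a c rfl rfl).tail (step _ _ h)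
  rintro (a | a) h
  · obtain ⟨b, h', hb⟩ := h1 _ _ h a rfl
    obtain rfl := Sum.inl_injective h'
    exact φ.acyclic _ hb
  · exact ψ.acyclic _ (h2 _ _ h a a rfl rfl)

/-- Sequential composition of string diagrams (first `φ`, then `ψ`), by pushout. -/
def comp : Diagram S σ υ where
  G := compGraph φ ψ
  finite_wire := by
    have := φ.finite_wire
    have := ψ.finite_wire
    exact inferInstanceAs (Finite (φ.G.Wire ⊕ {a : ψ.G.Wire // ∀ i, ψ.p i ≠ a}))
  finite_edge := by
    have := φ.finite_edge
    have := ψ.finite_edge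
    refine Finite.of_surjective (fun e : φ.G.Edge ⊕ ψ.G.Edge =>
      (Sum.elim (fun e => ⟨e.1, e.2.1, Sum.inl e.2.2⟩) (fun e => ⟨e.1, e.2.1, Sum.inr e.2.2⟩) e :
        (compGraph φ ψ).Edge)) ?_
    rintro ⟨k, l, b | b⟩
    · exact ⟨Sum.inl ⟨k, l, b⟩, rfl⟩
    · exact ⟨Sum.inr ⟨k, l, b⟩, rfl⟩
  type := compDesc φ.type ψ.type fun i => (φ.type_q i).trans (ψ.type_p i).symm
  p i := Sum.inl (φ.p i)
  type_p := φ.type_p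
  q i := glue φ ψ (ψ.q i)
  type_q i := (compDesc_inr _ _ _ _).trans (ψ.type_q i)
  acyclic := compGraph_acyclic φ ψ
  left_monogamous := by
    apply bijective_source
    · intro i j h
      exact φ.p_injective (Sum.inl_injective h)
    · rintro ⟨k, l, b | b, j⟩ ⟨k', l', b' | b', j'⟩ e
      · have e2 := φ.portWire_injective (a₁ := ⟨k, l, b, j⟩) (a₂ := ⟨k', l', b', j'⟩)
          (Sum.inl_injective e)
        exact congrArg
          (fun o : φ.G.OutPort => (⟨o.1, o.2.1, Sum.inl o.2.2.1, o.2.2.2⟩ :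
            (compGraph φ ψ).OutPort)) e2
      · exact absurd (e.trans (compGraph_out_inr φ ψ b' j')) (by simp [BoxHypergraph.portWire, compGraph])
      · exact absurd (e.symm.trans (compGraph_out_inr φ ψ b j)) (by simp [BoxHypergraph.portWire, compGraph])
      · have e1 := (compGraph_out_inr φ ψ b j).symm.trans (e.trans (compGraph_out_inr φ ψ b' j'))
        have e2 := ψ.portWire_injective (a₁ := ⟨k, l, b, j⟩) (a₂ := ⟨k', l', b', j'⟩)
          (congrArg Subtype.val (Sum.inr_injective e1))
        exact congrArg
          (fun o : ψ.G.OutPort => (⟨o.1, o.2.1, Sum.inr o.2.2.1, o.2.2.2⟩ :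
            (compGraph φ ψ).OutPort)) e2
    · rintro i k l (b | b) j e
      · exact φ.p_ne_out i b j (Sum.inl_injective e)
      · exact absurd (e.trans (compGraph_out_inr φ ψ b j)) (by simp)
    · rintro (a | ⟨a, ha⟩)
      · rcases φ.wire_cases a with ⟨i, rfl⟩ | ⟨k, l, b, j, rfl⟩
        · exact Or.inl ⟨i, rfl⟩
        · exact Or.inr ⟨k, l, Sum.inl b, j, rfl⟩
      · rcases ψ.wire_cases a with ⟨i, rfl⟩ | ⟨k, l, b, j, rfl⟩
        · exact absurd rfl (ha i)
        · exact Or.inr ⟨k, l, Sum.inr b, j, compGraph_out_inr φ ψ b j⟩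

theorem comp_type_glue (a : ψ.G.Wire) :
    (comp φ ψ).type.wire (glue φ ψ a) = ψ.type.wire a :=
  compDesc_inr φ.type ψ.type (fun i => (φ.type_q i).trans (ψ.type_p i).symm) a

variable {φ ψ}

/-- Composition of string diagrams is functorial for morphisms of string diagrams. -/
def compHom {φ' : Diagram S σ τ} {ψ' : Diagram S τ υ} (f : DHom φ φ') (g : DHom ψ ψ') :
    DHom (comp φ ψ) (comp φ' ψ') where
  toHypHom := compDesc (f.toHypHom.comp (compInl φ' ψ')) (g.toHypHom.comp (compInr φ' ψ'))
    (fun i => by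
      change Sum.inl (f.wire (φ.q i)) = glue φ' ψ' (g.wire (ψ.p i))
      rw [f.wire_q, g.wire_p, glue_p])
  type_wire := by
    rintro (a | a)
    · exact f.type_wire a
    · exact (comp_type_glue φ' ψ' _).trans (g.type_wire a.1)
  type_box := by
    rintro k l (b | b)
    · exact f.type_box b
    · exact g.type_box b
  wire_p i := congrArg Sum.inl (f.wire_p i)
  wire_q i := (compDesc_inr _ _ _ _).trans (congrArg (glue φ' ψ') (g.wire_q i))

theorem compHom_box_injective {φ' : Diagram S σ τ} {ψ' : Diagram S τ υ} (f : DHom φ φ')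
    (g : DHom ψ ψ') (hf : ∀ k l : ℕ, Function.Injective (f.box : φ.G.Box k l → φ'.G.Box k l))
    (hg : ∀ k l : ℕ, Function.Injective (g.box : ψ.G.Box k l → ψ'.G.Box k l)) (k l : ℕ) :
    Function.Injective
      ((compHom f g).box : (comp φ ψ).G.Box k l → (comp φ' ψ').G.Box k l) := by
  rintro (b | b) (b' | b') e
  · exact congrArg Sum.inl (hf k l (Sum.inl_injective e))
  · exact absurd (show (Sum.inl _ : φ'.G.Box k l ⊕ ψ'.G.Box k l) = Sum.inr _ from e) (by simp)
  · exact absurd (show (Sum.inr _ : φ'.G.Box k l ⊕ ψ'.G.Box k l) = Sum.inl _ from e) (by simp)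
  · exact congrArg Sum.inr (hg k l (Sum.inr_injective e))

theorem norm_comp_iso {φ' : Diagram S σ τ} {ψ' : Diagram S τ υ} (f : DHom φ φ')
    (g : DHom ψ ψ') (hf : ∀ k l : ℕ, Function.Injective (f.box : φ.G.Box k l → φ'.G.Box k l))
    (hg : ∀ k l : ℕ, Function.Injective (g.box : ψ.G.Box k l → ψ'.G.Box k l)) :
    Iso (comp φ ψ).norm (comp φ' ψ').norm :=
  norm_iso_of_box_injective (compHom f g) (compHom_box_injective f g hf hg)

theorem comp_assoc_iso (φ : Diagram S σ τ) (ψ : Diagram S τ υ) (θ : Diagram S υ χ) :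
    Iso (comp (comp φ ψ) θ) (comp φ (comp ψ θ)) := by
  let i2 : HypHom ψ.G (compGraph φ (comp ψ θ)) :=
    { wire := fun a => glue φ (comp ψ θ) (Sum.inl a)
      box := fun b => Sum.inr (Sum.inl b)
      inp_box := fun _ _ => rfl
      out_box := fun _ _ => rfl }
  let i3 : HypHom θ.G (compGraph φ (comp ψ θ)) :=
    { wire := fun a => glue φ (comp ψ θ) (glue ψ θ a)
      box := fun b => Sum.inr (Sum.inr b)
      inp_box := fun _ _ => rfl
      out_box := fun _ _ => rfl }
  have h12 : ∀ i, (compInl φ (comp ψ θ)).wire (φ.q i) = i2.wire (ψ.p i) := fun i =>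
    (glue_p φ (comp ψ θ) i).symm
  let f : HypHom (compGraph φ ψ) (compGraph φ (comp ψ θ)) :=
    compDesc (compInl φ (comp ψ θ)) i2 h12
  have h23 : ∀ i, f.wire ((comp φ ψ).q i) = i3.wire (θ.p i) := by
    intro i
    refine (compDesc_inr (compInl φ (comp ψ θ)) i2 h12 (ψ.q i)).trans ?_
    exact (congrArg (glue φ (comp ψ θ)) (glue_p ψ θ i)).symm
  let F : HypHom (compGraph (comp φ ψ) θ) (compGraph φ (comp ψ θ)) :=
    compDesc (φ := comp φ ψ) f i3 h23
  have hty : ∀ a, (comp φ (comp ψ θ)).type.wire (glue φ (comp ψ θ) a) =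
      (comp ψ θ).type.wire a := comp_type_glue φ (comp ψ θ)
  refine iso_of_box_bijective (φ := comp (comp φ ψ) θ) (ψ := comp φ (comp ψ θ))
    { F with
      type_wire := ?_
      type_box := ?_
      wire_p := fun _ => rfl
      wire_q := fun i => compDesc_inr (φ := comp φ ψ) f i3 h23 (θ.q i) } ?_
  · rintro ((a | a) | a)
    · rfl
    · exact hty _
    · exact (hty _).trans (comp_type_glue ψ θ _)
  · rintro k l ((b | b) | b) <;> rfl
  · intro k l
    exact (Equiv.sumAssoc (φ.G.Box k l) (ψ.G.Box k l) (θ.G.Box k l)).bijective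

end Comp

/-! ### Parallel composition -/

section Tensor

/-- The disjoint union of hypergraphs. -/
def sumGraph (G H : BoxHypergraph.{u}) : BoxHypergraph.{u} where
  Wire := G.Wire ⊕ H.Wire
  Box k l := G.Box k l ⊕ H.Box k l
  inp b i := Sum.map (fun b => G.inp b i) (fun b => H.inp b i) b
  out b j := Sum.map (fun b => G.out b j) (fun b => H.out b j) b

theorem sumGraph_acyclic {G H : BoxHypergraph.{u}} (hG : G.Acyclic) (hH : H.Acyclic) :
    (sumGraph G H).Acyclic := by
  have step : ∀ x y : (sumGraph G H).Wire, (sumGraph G H).Step x y →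
      Sum.LiftRel G.Step H.Step x y := by
    rintro x y ⟨k, l, e | e, ⟨i, rfl⟩, j, rfl⟩
    · exact .inl ⟨k, l, e, ⟨i, rfl⟩, j, rfl⟩
    · exact .inr ⟨k, l, e, ⟨i, rfl⟩, j, rfl⟩
  have path : ∀ x y : (sumGraph G H).Wire, Relation.TransGen (sumGraph G H).Step x y →
      Sum.LiftRel (Relation.TransGen G.Step) (Relation.TransGen H.Step) x y := by
    intro x y h
    induction h with
    | single h => exact (step _ _ h).mono (fun _ _ => .single) (fun _ _ => .single)
    | tail _ h ih =>
      have := step _ _ h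
      cases ih with
      | inl h' =>
        cases this with
        | inl h'' => exact .inl (h'.tail h'')
      | inr h' =>
        cases this with
        | inr h'' => exact .inr (h'.tail h'')
  rintro (a | a) h
  · cases path _ _ h with
    | inl h => exact hG a h
  · cases path _ _ h with
    | inr h => exact hH a h

end Tensor

end Diagram

/-- The empty sequence, the monoidal unit of the free categories. -/
def FreeMarkov.unit (S : BoxHypergraph.{u}) : FreeMarkov S := ⟨0, Fin.elim0⟩

/-- Concatenation, the tensor product of objects of the free categories. -/
def FreeMarkov.tensor {S : BoxHypergraph.{u}} (σ τ : FreeMarkov S) : FreeMarkov S :=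
  ⟨σ.len + τ.len, Fin.append σ.ty τ.ty⟩

namespace Diagram

variable {S : BoxHypergraph.{u}} {σ τ υ χ : FreeMarkov S}

/-- Concatenation of two families as a family in the disjoint union. -/
def appendSum {n m : ℕ} {A B : Type u} (f : Fin n → A) (g : Fin m → B) : Fin (n + m) → A ⊕ B :=
  Fin.append (fun i => Sum.inl (f i)) (fun i => Sum.inr (g i))

theorem appendSum_left {n m : ℕ} {A B : Type u} (f : Fin n → A) (g : Fin m → B) (i : Fin n) :
    appendSum f g (Fin.castAdd m i) = Sum.inl (f i) := Fin.append_left _ _ i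

theorem appendSum_right {n m : ℕ} {A B : Type u} (f : Fin n → A) (g : Fin m → B) (i : Fin m) :
    appendSum f g (Fin.natAdd n i) = Sum.inr (g i) := Fin.append_right _ _ i

theorem elim_appendSum {n m : ℕ} {A B : Type u} {K : Type*} (f : Fin n → A) (g : Fin m → B)
    (f' : A → K) (g' : B → K) (x : Fin n → K) (y : Fin m → K) (hx : ∀ i, f' (f i) = x i)
    (hy : ∀ i, g' (g i) = y i) (i : Fin (n + m)) :
    Sum.elim f' g' (appendSum f g i) = Fin.append x y i := by
  refine Fin.addCases (fun i => ?_) (fun i => ?_) i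
  · rw [appendSum_left, Fin.append_left, Sum.elim_inl, hx]
  · rw [appendSum_right, Fin.append_right, Sum.elim_inr, hy]

theorem map_appendSum {n m : ℕ} {A B A' B' : Type u} (f : Fin n → A) (g : Fin m → B)
    (f' : A → A') (g' : B → B') (x : Fin n → A') (y : Fin m → B') (hx : ∀ i, f' (f i) = x i)
    (hy : ∀ i, g' (g i) = y i) (i : Fin (n + m)) :
    Sum.map f' g' (appendSum f g i) = appendSum x y i := by
  refine Fin.addCases (fun i => ?_) (fun i => ?_) i
  · rw [appendSum_left, appendSum_left, Sum.map_inl, hx]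
  · rw [appendSum_right, appendSum_right, Sum.map_inr, hy]

theorem appendSum_injective {n m : ℕ} {A B : Type u} {f : Fin n → A} {g : Fin m → B}
    (hf : Function.Injective f) (hg : Function.Injective g) :
    Function.Injective (appendSum f g) := by
  intro i j
  refine Fin.addCases (fun i => ?_) (fun i => ?_) i <;>
    refine Fin.addCases (fun j => ?_) (fun j => ?_) j <;>
    simp only [appendSum_left, appendSum_right] <;> intro e
  · rw [hf (Sum.inl_injective e)]
  · exact absurd e (by simp)
  · exact absurd e (by simp)
  · rw [hg (Sum.inr_injective e)]

/-- Parallel composition of string diagrams: the disjoint union. -/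
def tensor (φ : Diagram S σ τ) (ψ : Diagram S υ χ) :
    Diagram S (σ.tensor υ) (τ.tensor χ) where
  G := sumGraph φ.G ψ.G
  finite_wire := by
    have := φ.finite_wire
    have := ψ.finite_wire
    exact inferInstanceAs (Finite (φ.G.Wire ⊕ ψ.G.Wire))
  finite_edge := by
    have := φ.finite_edge
    have := ψ.finite_edge
    refine Finite.of_surjective (fun e : φ.G.Edge ⊕ ψ.G.Edge =>
      (Sum.elim (fun e => ⟨e.1, e.2.1, Sum.inl e.2.2⟩) (fun e => ⟨e.1, e.2.1, Sum.inr e.2.2⟩) e :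
        (sumGraph φ.G ψ.G).Edge)) ?_
    rintro ⟨k, l, b | b⟩
    · exact ⟨Sum.inl ⟨k, l, b⟩, rfl⟩
    · exact ⟨Sum.inr ⟨k, l, b⟩, rfl⟩
  type :=
    { wire := Sum.elim φ.type.wire ψ.type.wire
      box := fun b => Sum.elim φ.type.box ψ.type.box b
      inp_box := by
        rintro k l (b | b) i
        · exact φ.type.inp_box b i
        · exact ψ.type.inp_box b i
      out_box := by
        rintro k l (b | b) i
        · exact φ.type.out_box b i
        · exact ψ.type.out_box b i }
  p := appendSum φ.p ψ.p
  type_p := elim_appendSum φ.p ψ.p _ _ _ _ φ.type_p ψ.type_p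
  q := appendSum φ.q ψ.q
  type_q := elim_appendSum φ.q ψ.q _ _ _ _ φ.type_q ψ.type_q
  acyclic := sumGraph_acyclic φ.acyclic ψ.acyclic
  left_monogamous := by
    apply bijective_source
    · exact appendSum_injective φ.p_injective ψ.p_injective
    · rintro ⟨k, l, b | b, j⟩ ⟨k', l', b' | b', j'⟩ e
      · have e2 := φ.portWire_injective (a₁ := ⟨k, l, b, j⟩) (a₂ := ⟨k', l', b', j'⟩)
          (Sum.inl_injective e)
        exact congrArg
          (fun o : φ.G.OutPort => (⟨o.1, o.2.1, Sum.inl o.2.2.1, o.2.2.2⟩ :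
            (sumGraph φ.G ψ.G).OutPort)) e2
      · exact absurd e (by simp [BoxHypergraph.portWire, sumGraph])
      · exact absurd e (by simp [BoxHypergraph.portWire, sumGraph])
      · have e2 := ψ.portWire_injective (a₁ := ⟨k, l, b, j⟩) (a₂ := ⟨k', l', b', j'⟩)
          (Sum.inr_injective e)
        exact congrArg
          (fun o : ψ.G.OutPort => (⟨o.1, o.2.1, Sum.inr o.2.2.1, o.2.2.2⟩ :
            (sumGraph φ.G ψ.G).OutPort)) e2
    · rintro i k l (b | b) j
      · refine Fin.addCases (fun i e => ?_) (fun i e => ?_) i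
        · exact φ.p_ne_out i b j (Sum.inl_injective ((appendSum_left _ _ i).symm.trans e))
        · exact absurd ((appendSum_right φ.p ψ.p i).symm.trans e) Sum.inr_ne_inl
      · refine Fin.addCases (fun i e => ?_) (fun i e => ?_) i
        · exact absurd ((appendSum_left φ.p ψ.p i).symm.trans e) Sum.inl_ne_inr
        · exact ψ.p_ne_out i b j (Sum.inr_injective ((appendSum_right _ _ i).symm.trans e))
    · rintro (a | a)
      · rcases φ.wire_cases a with ⟨i, rfl⟩ | ⟨k, l, b, j, rfl⟩
        · exact Or.inl ⟨Fin.castAdd _ i, appendSum_left _ _ i⟩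
        · exact Or.inr ⟨k, l, Sum.inl b, j, rfl⟩
      · rcases ψ.wire_cases a with ⟨i, rfl⟩ | ⟨k, l, b, j, rfl⟩
        · exact Or.inl ⟨Fin.natAdd _ i, appendSum_right _ _ i⟩
        · exact Or.inr ⟨k, l, Sum.inr b, j, rfl⟩

theorem tensor_normalized {φ : Diagram S σ τ} {ψ : Diagram S υ χ} (hφ : φ.Normalized)
    (hψ : ψ.Normalized) : (tensor φ ψ).Normalized := by
  rintro k l (b | b) h
  · refine hφ k l b fun j => ⟨fun i e => (h j).1 (Fin.castAdd _ i) ?_, fun k' l' b' i e =>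
      (h j).2 k' l' (Sum.inl b') i (congrArg Sum.inl e)⟩
    exact (appendSum_left _ _ i).trans (congrArg Sum.inl e)
  · refine hψ k l b fun j => ⟨fun i e => (h j).1 (Fin.natAdd _ i) ?_, fun k' l' b' i e =>
      (h j).2 k' l' (Sum.inr b') i (congrArg Sum.inr e)⟩
    exact (appendSum_right _ _ i).trans (congrArg Sum.inr e)

theorem tensor_iso {φ φ' : Diagram S σ τ} {ψ ψ' : Diagram S υ χ} :
    Iso φ φ' → Iso ψ ψ' → Iso (tensor φ ψ) (tensor φ' ψ') := by
  rintro ⟨f, -, hf⟩ ⟨g, -, hg⟩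
  refine iso_of_box_bijective
    { wire := Sum.map f.wire g.wire
      box := fun b => Sum.map f.box g.box b
      inp_box := ?_
      out_box := ?_
      type_wire := ?_
      type_box := ?_
      wire_p := ?_
      wire_q := ?_ } fun k l => Function.Bijective.sumMap (hf k l) (hg k l)
  · rintro k l (b | b) i
    · exact congrArg Sum.inl (f.inp_box b i)
    · exact congrArg Sum.inr (g.inp_box b i)
  · rintro k l (b | b) i
    · exact congrArg Sum.inl (f.out_box b i)
    · exact congrArg Sum.inr (g.out_box b i)
  · rintro (a | a)
    · exact f.type_wire a
    · exact g.type_wire a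
  · rintro k l (b | b)
    · exact f.type_box b
    · exact g.type_box b
  · exact map_appendSum φ.p ψ.p _ _ _ _ f.wire_p g.wire_p
  · exact map_appendSum φ.q ψ.q _ _ _ _ f.wire_q g.wire_q

/-! ### Diagrams without boxes -/

/-- The string diagram without boxes whose `j`th output is connected to the `r j`th input. -/
def wiring (σ τ : FreeMarkov S) (r : Fin τ.len → Fin σ.len) (hr : ∀ j, σ.ty (r j) = τ.ty j) :
    Diagram S σ τ where
  G :=
    { Wire := ULift (Fin σ.len)
      Box := fun _ _ => PEmpty
      inp := fun b => b.elim
      out := fun b => b.elim }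
  finite_wire := inferInstanceAs (Finite (ULift (Fin σ.len)))
  finite_edge := Finite.of_injective (β := Fin 0) (fun e => PEmpty.elim e.2.2) fun e => e.2.2.elim
  type :=
    { wire := fun a => σ.ty a.down
      box := fun b => b.elim
      inp_box := fun b => b.elim
      out_box := fun b => b.elim }
  p := ULift.up
  type_p _ := rfl
  q j := ⟨r j⟩
  type_q := hr
  acyclic a h := by
    cases h with
    | single h =>
      obtain ⟨_, _, e, _⟩ := h
      exact e.elim
    | tail _ h =>
      obtain ⟨_, _, e, _⟩ := h
      exact e.elim
  left_monogamous := by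
    apply bijective_source
    · exact ULift.up_injective
    · rintro ⟨_, _, b, _⟩
      exact b.elim
    · rintro _ _ _ b
      exact b.elim
    · exact fun a => Or.inl ⟨a.down, rfl⟩

theorem wiring_normalized (σ τ : FreeMarkov S) (r : Fin τ.len → Fin σ.len)
    (hr : ∀ j, σ.ty (r j) = τ.ty j) : (wiring σ τ r hr).Normalized :=
  fun _ _ b => b.elim

/-- The identity diagram. -/
def idDiagram (σ : FreeMarkov S) : Diagram S σ σ := wiring σ σ (fun j => j) fun _ => rfl

theorem id_comp_iso (φ : Diagram S σ τ) : Iso (comp (idDiagram σ) φ) φ := by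
  let i1 : HypHom (idDiagram σ).G φ.G :=
    { wire := fun a => φ.p a.down
      box := fun b => b.elim
      inp_box := fun b => b.elim
      out_box := fun b => b.elim }
  let i2 : HypHom φ.G φ.G := (DHom.id φ).toHypHom
  have h : ∀ i, i1.wire ((idDiagram σ).q i) = i2.wire (φ.p i) := fun _ => rfl
  refine iso_of_box_bijective
    { compDesc i1 i2 h with
      type_wire := ?_
      type_box := ?_
      wire_p := fun _ => rfl
      wire_q := fun i => compDesc_inr i1 i2 h (φ.q i) } fun k l => ⟨?_, ?_⟩
  · rintro (a | a)
    · exact φ.type_p a.down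
    · rfl
  · rintro k l (b | b)
    · exact b.elim
    · rfl
  · rintro (b | b) (b' | b') e
    · exact b.elim
    · exact b.elim
    · exact b'.elim
    · exact congrArg Sum.inr e
  · exact fun b => ⟨Sum.inr b, rfl⟩

theorem comp_id_iso (φ : Diagram S σ τ) : Iso φ (comp φ (idDiagram τ)) := by
  refine iso_of_box_bijective
    { compInl φ (idDiagram τ) with
      type_wire := fun _ => rfl
      type_box := fun _ => rfl
      wire_p := fun _ => rfl
      wire_q := fun i => (glue_p φ (idDiagram τ) i).symm } fun k l => ⟨?_, ?_⟩
  · exact Sum.inl_injective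
  · rintro (b | b)
    · exact ⟨b, rfl⟩
    · exact b.elim

end Diagram

/-! ### The free Markov category -/

/-- Normalized string diagrams. -/
abbrev NormDiagram (S : BoxHypergraph.{u}) (σ τ : FreeMarkov S) : Type (u + 1) :=
  {φ : Diagram S σ τ // φ.Normalized}

instance normDiagramSetoid (S : BoxHypergraph.{u}) (σ τ : FreeMarkov S) :
    Setoid (NormDiagram S σ τ) where
  r φ ψ := Diagram.Iso φ.1 ψ.1
  iseqv := ⟨fun φ => Diagram.Iso.refl φ.1, Diagram.Iso.symm, Diagram.Iso.trans⟩

namespace FreeMarkov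

variable {S : BoxHypergraph.{u}}

/-- The morphisms of the free Markov category on `S`: isomorphism classes of normalized gs-monoidal
string diagrams. -/
def Hom (σ τ : FreeMarkov S) : Type (u + 1) := Quotient (normDiagramSetoid S σ τ)

end FreeMarkov

/-- The morphism of the free Markov category given by a normalized string diagram. -/
def Diagram.toHom {S : BoxHypergraph.{u}} {σ τ : FreeMarkov S} (φ : Diagram S σ τ)
    (hφ : φ.Normalized) : FreeMarkov.Hom σ τ := Quotient.mk _ ⟨φ, hφ⟩

namespace FreeMarkov

variable {S : BoxHypergraph.{u}}

/-- Composition: composition of string diagrams followed by normalization. -/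
def Hom.comp {σ τ υ : FreeMarkov S} : Hom σ τ → Hom τ υ → Hom σ υ :=
  Quotient.map₂ (fun φ ψ => ⟨(Diagram.comp φ.1 ψ.1).norm, Diagram.norm_normalized _⟩) (by
    rintro φ φ' ⟨f, -, hf⟩ ψ ψ' ⟨g, -, hg⟩
    exact Diagram.norm_comp_iso f g (fun k l => (hf k l).1) (fun k l => (hg k l).1))

/-- The category structure of the free Markov category on `S`. -/
instance : Category.{u + 1} (FreeMarkov S) where
  Hom := Hom
  id σ := (Diagram.idDiagram σ).toHom (Diagram.wiring_normalized _ _ _ _)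
  comp := Hom.comp
  id_comp := by
    rintro σ τ ⟨φ⟩
    exact Quotient.sound ((Diagram.norm_iso_of_iso (Diagram.id_comp_iso φ.1)).trans
      (Diagram.norm_iso_of_normalized φ.2))
  comp_id := by
    rintro σ τ ⟨φ⟩
    exact Quotient.sound ((Diagram.norm_iso_of_iso (Diagram.comp_id_iso φ.1).symm).trans
      (Diagram.norm_iso_of_normalized φ.2))
  assoc := by
    rintro σ τ υ χ ⟨φ⟩ ⟨ψ⟩ ⟨θ⟩
    have h1 : Diagram.Iso ((Diagram.comp (Diagram.comp φ.1 ψ.1).norm θ.1).norm)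
        ((Diagram.comp (Diagram.comp φ.1 ψ.1) θ.1).norm) :=
      Diagram.norm_comp_iso (Diagram.normHom _) (Diagram.DHom.id _)
        (fun _ _ => Subtype.val_injective) (fun _ _ => Function.injective_id)
    have h2 : Diagram.Iso ((Diagram.comp φ.1 (Diagram.comp ψ.1 θ.1).norm).norm)
        ((Diagram.comp φ.1 (Diagram.comp ψ.1 θ.1)).norm) :=
      Diagram.norm_comp_iso (Diagram.DHom.id _) (Diagram.normHom _)
        (fun _ _ => Function.injective_id) (fun _ _ => Subtype.val_injective)
    exact Quotient.sound ((h1.trans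
      (Diagram.norm_iso_of_iso (Diagram.comp_assoc_iso φ.1 ψ.1 θ.1))).trans h2.symm)

/-- The tensor product of morphisms of the free Markov category. -/
def tensorHom {σ τ υ χ : FreeMarkov S} : (σ ⟶ τ) → (υ ⟶ χ) → (σ.tensor υ ⟶ τ.tensor χ) :=
  Quotient.map₂
    (fun φ ψ => ⟨Diagram.tensor φ.1 ψ.1, Diagram.tensor_normalized φ.2 ψ.2⟩)
    (fun _ _ h _ _ h' => Diagram.tensor_iso h h')

/-- The morphism of the free Markov category that connects its `j`th output to its `r j`th input. -/
def wire (σ τ : FreeMarkov S) (r : Fin τ.len → Fin σ.len) (hr : ∀ j, σ.ty (r j) = τ.ty j) :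
    σ ⟶ τ :=
  (Diagram.wiring σ τ r hr).toHom (Diagram.wiring_normalized σ τ r hr)

/-- The symmetry of the free Markov category. -/
def swap (σ τ : FreeMarkov S) : σ.tensor τ ⟶ τ.tensor σ :=
  wire (σ.tensor τ) (τ.tensor σ)
    (Fin.append (fun j => Fin.natAdd σ.len j) (fun j => Fin.castAdd τ.len j))
    (Fin.addCases (by simp [tensor]) (by simp [tensor]))

/-- The copy morphisms of the free Markov category. -/
def copy (σ : FreeMarkov S) : σ ⟶ σ.tensor σ :=
  wire σ (σ.tensor σ) (Fin.append (fun j => j) (fun j => j))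
    (Fin.addCases (fun j => by simp only [tensor, Fin.append_left])
      (fun j => by simp only [tensor, Fin.append_right]))

/-- The discard morphisms of the free Markov category. -/
def del (σ : FreeMarkov S) : σ ⟶ unit S :=
  wire σ (unit S) Fin.elim0 (fun j => j.elim0)

end FreeMarkov

/-! ### Strict Markov categories and strict Markov functors -/

/-- Strictness of a monoidal category: the tensor product is strictly associative and unital, and the
structure isomorphisms are identities. -/
class StrictMonoidal (C : Type w) [Category.{v} C] [MonoidalCategory C] : Prop where
  tensor_assoc : ∀ X Y Z : C, (X ⊗ Y) ⊗ Z = X ⊗ (Y ⊗ Z)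
  unit_tensor : ∀ X : C, 𝟙_ C ⊗ X = X
  tensor_unit : ∀ X : C, X ⊗ 𝟙_ C = X
  associator_eq : ∀ X Y Z : C, (α_ X Y Z).hom = eqToHom (tensor_assoc X Y Z)
  leftUnitor_eq : ∀ X : C, (λ_ X).hom = eqToHom (unit_tensor X)
  rightUnitor_eq : ∀ X : C, (ρ_ X).hom = eqToHom (tensor_unit X)

section Markov

variable {S : BoxHypergraph.{u}} {C : Type w} [Category.{v} C] [MonoidalCategory C]

/-- Strict Markov functors out of the free Markov category: strict symmetric monoidal functors that
preserve the comonoid structures. -/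
structure IsStrictMarkov [MarkovCategory C] (F : FreeMarkov S ⥤ C) : Prop where
  obj_unit : F.obj (FreeMarkov.unit S) = 𝟙_ C
  obj_tensor : ∀ σ τ : FreeMarkov S, F.obj (σ.tensor τ) = F.obj σ ⊗ F.obj τ
  map_tensor : ∀ {σ τ υ χ : FreeMarkov S} (f : σ ⟶ τ) (g : υ ⟶ χ),
    F.map (FreeMarkov.tensorHom f g) =
      eqToHom (obj_tensor σ υ) ≫ (F.map f ⊗ₘ F.map g) ≫ eqToHom (obj_tensor τ χ).symm
  map_swap : ∀ σ τ : FreeMarkov S,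
    F.map (FreeMarkov.swap σ τ) =
      eqToHom (obj_tensor σ τ) ≫ (β_ (F.obj σ) (F.obj τ)).hom ≫ eqToHom (obj_tensor τ σ).symm
  map_copy : ∀ σ : FreeMarkov S,
    F.map (FreeMarkov.copy σ) = Δ[F.obj σ] ≫ eqToHom (obj_tensor σ σ).symm
  map_del : ∀ σ : FreeMarkov S,
    F.map (FreeMarkov.del σ) = ε[F.obj σ] ≫ eqToHom obj_unit.symm

/-- The tensor product of the objects `V i` over a list of indices `i`. -/
def tensorOver {ι : Type*} (V : ι → C) : List ι → C
  | [] => 𝟙_ C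
  | i :: L => V i ⊗ tensorOver V L

/-- The tensor product `V 0 ⊗ ... ⊗ V (n - 1)`. -/
abbrev tensorFin {n : ℕ} (V : Fin n → C) : C := tensorOver V (List.finRange n)

/-- A wire type as an object of the free Markov category. -/
def FreeMarkov.single (a : S.Wire) : FreeMarkov S := ⟨1, fun _ => a⟩

theorem tensorOver_map {ι κ : Type*} (V : ι → C) (g : κ → ι) (L : List κ) :
    tensorOver V (L.map g) = tensorOver (fun i => V (g i)) L := by
  induction L with
  | nil => rfl
  | cons a L ih => simp only [List.map_cons, tensorOver, ih]

theorem IsStrictMarkov.obj_eq [MarkovCategory C] {F : FreeMarkov S ⥤ C} (hF : IsStrictMarkov F)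
    (σ : FreeMarkov S) :
    F.obj σ = tensorFin (fun i => F.obj (FreeMarkov.single (σ.ty i))) := by
  obtain ⟨n, t⟩ := σ
  induction n with
  | zero =>
    have : (⟨0, t⟩ : FreeMarkov S) = FreeMarkov.unit S := by
      rw [FreeMarkov.unit, Subsingleton.elim t Fin.elim0]
    rw [this]
    exact hF.obj_unit
  | succ n ih =>
    have : (⟨n + 1, t⟩ : FreeMarkov S) =
        (FreeMarkov.single (t 0)).tensor ⟨n, fun i => t i.succ⟩ := by
      rw [FreeMarkov.tensor, FreeMarkov.mk.injEq]
      refine ⟨Nat.add_comm n 1, ?_⟩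
      refine (Fin.heq_fun_iff (Nat.add_comm n 1)).2 fun i => ?_
      have e := congrFun (Fin.append_left_eq_cons (fun _ : Fin 1 => t 0) (fun i => t i.succ))
        (i.cast (Nat.add_comm n 1))
      refine Eq.trans ?_ e.symm
      refine Fin.cases ?_ (fun i => ?_) i
      · rfl
      · rfl
    refine (congrArg F.obj this).trans ((hF.obj_tensor _ _).trans ?_)
    rw [ih]
    change _ = tensorOver (fun i => F.obj (FreeMarkov.single (t i))) (List.finRange (n + 1))
    rw [List.finRange_succ, tensorOver, tensorOver_map]

/-- Compatibility of a morphism `f : W' 0 ⊗ ... ⊗ W' (n - 1) ⟶ V' 0 ⊗ ... ⊗ V' (m - 1)` of a strict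
Markov category with a normalized string diagram `φ`: there is a strict Markov functor `F` that maps
the types of the global inputs and outputs of `φ` to the given tensor factors and that maps `φ`
to `f`. -/
def Compatible [MarkovCategory C] {σ τ : FreeMarkov S} (φ : Diagram S σ τ) (hφ : φ.Normalized)
    (W' : Fin σ.len → C) (V' : Fin τ.len → C) (f : tensorFin W' ⟶ tensorFin V') : Prop :=
  ∃ (F : FreeMarkov S ⥤ C) (hF : IsStrictMarkov F)
    (hW : ∀ i, W' i = F.obj (FreeMarkov.single (φ.type.wire (φ.p i))))
    (hV : ∀ j, V' j = F.obj (FreeMarkov.single (φ.type.wire (φ.q j)))),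
    f = eqToHom ((congrArg tensorFin (funext fun i => by rw [hW i, φ.type_p i])).trans
          (hF.obj_eq σ).symm) ≫
        F.map (φ.toHom hφ) ≫
        eqToHom ((hF.obj_eq τ).trans
          (congrArg tensorFin (funext fun j => by rw [hV j, φ.type_q j])))

/-! ### Conditionals and conditional independence -/

/-- A Markov category has conditionals if every `f : A ⟶ X ⊗ Y` can be generated by first generating
`X` with the marginal of `f` and then generating `Y` from `X` and `A`. -/
def HasConditionals (C : Type w) [Category.{v} C] [MonoidalCategory C] [MarkovCategory C] : Prop :=
  ∀ (A X Y : C) (f : A ⟶ X ⊗ Y), ∃ c : X ⊗ A ⟶ Y,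
    f = Δ[A] ≫ ((f ≫ X ◁ ε[Y] ≫ (ρ_ X).hom ≫ Δ[X]) ▷ A) ≫ (α_ X X A).hom ≫ X ◁ c

/-- The conditional independence `X ⊥ Y | Z` for `f : A ⟶ X ⊗ (Y ⊗ Z)`: first `Y` and `Z` are
generated from `A` by some `h`, then `X` is generated from a copy of `Z` alone by some `k`. -/
def CondIndep [MarkovCategory C] {A X Y Z : C} (f : A ⟶ X ⊗ (Y ⊗ Z)) : Prop :=
  ∃ (h : A ⟶ Y ⊗ Z) (k : Z ⟶ X),
    f = h ≫ Y ◁ (Δ[Z] ≫ k ▷ Z) ≫ (α_ Y X Z).inv ≫ (β_ Y X).hom ▷ Z ≫ (α_ X Y Z).hom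

open Classical in
/-- The morphism that discards all tensor factors with index outside of `J`. -/
def discardCompl [MarkovCategory C] {ι : Type*} (V : ι → C) (J : Set ι) :
    (L : List ι) → (tensorOver V L ⟶ tensorOver V (L.filter (fun i => decide (i ∈ J))))
  | [] => 𝟙 (𝟙_ C)
  | i :: L =>
    if h : i ∈ J then
      V i ◁ discardCompl V J L ≫ eqToHom (by simp [h, tensorOver])
    else
      ε[V i] ▷ tensorOver V L ≫ (λ_ (tensorOver V L)).hom ≫ discardCompl V J L ≫
        eqToHom (by simp [h])

open Classical in
/-- The tensor product of the `V j` over the `j` in `J`, in increasing order. -/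
abbrev tensorOn {m : ℕ} (V : Fin m → C) (J : Set (Fin m)) : C :=
  tensorOver V ((List.finRange m).filter (fun i => decide (i ∈ J)))

/-- The marginal of `f` on three disjoint sets of outputs: the joint morphism of the three marginals.
As the sets are disjoint, at most one copy of each output is not discarded, so that this is the
composite of `f` with discard morphisms and swaps. -/
def marginal₃ [MarkovCategory C] {A : C} {m : ℕ} {V : Fin m → C} (f : A ⟶ tensorFin V)
    (I J K : Set (Fin m)) : A ⟶ tensorOn V I ⊗ (tensorOn V J ⊗ tensorOn V K) :=
  f ≫ Δ[tensorFin V] ≫ (discardCompl V I (List.finRange m) ⊗ₘ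
    (Δ[tensorFin V] ≫ (discardCompl V J (List.finRange m) ⊗ₘ discardCompl V K (List.finRange m))))

end Markov

/-! ### Generalized causal models and categorical d-separation -/

namespace Diagram

variable {S : BoxHypergraph.{u}} {σ τ : FreeMarkov S}

/-- A generalized causal model: a normalized string diagram in which every wire is connected to at
most one global output. -/
structure IsCausalModel (φ : Diagram S σ τ) : Prop where
  normalized : φ.Normalized
  q_injective : Function.Injective φ.q

/-- The set of global input wires. -/
def inWires (φ : Diagram S σ τ) : Set φ.G.Wire := Set.range φ.p

/-- The set of global output wires. -/
def outWires (φ : Diagram S σ τ) : Set φ.G.Wire := Set.range φ.q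

open Classical in
/-- The indices of the global outputs that are attached to wires in `W`. -/
def keptOutputs (φ : Diagram S σ τ) (W : Set φ.G.Wire) : List (Fin τ.len) :=
  (List.finRange τ.len).filter (fun j => decide (φ.q j ∈ W))

/-- The codomain of the marginal on `W`. -/
def keptType (φ : Diagram S σ τ) (W : Set φ.G.Wire) : FreeMarkov S :=
  ⟨(φ.keptOutputs W).length, fun i => τ.ty ((φ.keptOutputs W).get i)⟩

/-- The string diagram `φ` with the global outputs outside of `W` discarded. -/
def discardOutside (φ : Diagram S σ τ) (W : Set φ.G.Wire) : Diagram S σ (φ.keptType W) :=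
  { φ with
    q := fun i => φ.q ((φ.keptOutputs W).get i)
    type_q := fun i => φ.type_q ((φ.keptOutputs W).get i) }

/-- `φ.discardOutside W` is the composite of `φ` with the diagram that discards the outputs
outside of `W`. -/
theorem discardOutside_iso (φ : Diagram S σ τ) (W : Set φ.G.Wire) :
    Iso (φ.discardOutside W)
      (comp φ (wiring τ (φ.keptType W) (φ.keptOutputs W).get fun _ => rfl)) := by
  let ω : Diagram S τ (φ.keptType W) :=
    wiring τ (φ.keptType W) (φ.keptOutputs W).get fun _ => rfl
  refine iso_of_box_bijective
    { wire := (compInl φ ω).wire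
      box := (compInl φ ω).box
      inp_box := fun _ _ => rfl
      out_box := fun _ _ => rfl
      type_wire := fun _ => rfl
      type_box := fun _ => rfl
      wire_p := fun _ => rfl
      wire_q := fun i => (glue_p φ ω ((φ.keptOutputs W).get i)).symm } fun k l => ⟨?_, ?_⟩
  · exact Sum.inl_injective
  · rintro (b | b)
    · exact ⟨b, rfl⟩
    · exact b.elim

/-- The marginal of `φ` on `W` in the free Markov category. -/
def marginal (φ : Diagram S σ τ) (W : Set φ.G.Wire) : Diagram S σ (φ.keptType W) :=
  (φ.discardOutside W).norm

/-- The wires of the marginal are wires of `φ`. -/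
def marginalWire (φ : Diagram S σ τ) (W : Set φ.G.Wire) (a : (φ.marginal W).G.Wire) : φ.G.Wire :=
  (φ.discardOutside W).normIncl.wire a

/-- Categorical d-separation: after cutting the wires in `Z` from the marginal of `φ` on
`X ∪ Y ∪ Z`, there is no undirected path between a wire in `X` and a wire in `Y`. -/
def DSeparates (φ : Diagram S σ τ) (Z X Y : Set φ.G.Wire) : Prop :=
  ∀ a b : ((φ.marginal (X ∪ Y ∪ Z)).G.cut {c | φ.marginalWire _ c ∈ Z}).Wire,
    φ.marginalWire _ a.1 ∈ X → φ.marginalWire _ b.1 ∈ Y →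
      ¬ ((φ.marginal (X ∪ Y ∪ Z)).G.cut {c | φ.marginalWire _ c ∈ Z}).UndirectedPath a b

end Diagram

end CausalModels

end

open CausalModels

/-! Let `ψ` be the marginal of the model on 𝒳 ∪ 𝒴 ∪ 𝒵. Call a wire of `ψ` left if it lies outside 𝒵
and is joined to 𝒳 by an undirected path that avoids 𝒵. Two wires outside 𝒵 at a common box are
joined to each other, so a box that touches a left wire touches only left wires and wires in 𝒵
(`connectedTo_box`). By d-separation no wire in 𝒴 is left, and since the inputs lie in 𝒴 ∪ 𝒵, no
global input is left either.

Now run `ψ` in `C` one box at a time, respecting the direction of the boxes and remembering every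
value produced. The invariant, `Splits`, says that the left wires are deterministic functions of
some `u`, that the other wires outside 𝒵 are deterministic functions of some `v`, that the wires in
𝒵 together form `z`, and that `u` and `v` are independent given `z`. At the start `u` is trivial. A
box without left wires reads `v` and `z` and enlarges both; the morphism that produces `u` from `z`
just ignores the new part of `z` (`CondIndep.extend_right`). A box of the other kind reads `u` and
`z` and enlarges both; as the new part of `z` may now depend on `u`, the joint morphism from the old
`z` to the new part of `z` and the new `u` has to be disintegrated along the former
(`CondIndep.extend_left`). This is the only use of conditionals. When all wires have been produced,
the outputs in 𝒳, 𝒴 and 𝒵 are deterministic functions of `u`, `v` and `z`, the last one with a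
retraction, and the independence passes to them (`CondIndep.map`, `Splits.condIndep_pair`).

Two devices keep coherence isomorphisms and reindexings out of this argument. Deterministic
morphisms treat tensor products as cartesian products, so `IsDetProd` replaces explicit permutations
of tensor factors by a universal property; a strict Markov functor sends box-free diagrams to
deterministic morphisms and sequences of wires to such products (`det_map_wire`, `isDetProd_obj`).
On the side of diagrams, a morphism that is injective on boxes does not change the class after
normalization (`cls_eq_of_box_injective`). This yields `cls_add_box`, by which producing the outputs
of one more box is postcomposition with that box. -/

noncomputable section

namespace CausalModels

/-! ### Calculus of pairings in a Markov category -/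

section Pairing

variable {C : Type w} [Category.{v} C] [MonoidalCategory C] [MarkovCategory C]
variable {A B Q T U V X Y Z O : C}

/-- The pairing of two morphisms, which copies the input. -/
def pair (f : A ⟶ X) (g : A ⟶ Y) : A ⟶ X ⊗ Y := Δ[A] ≫ (f ⊗ₘ g)

/-- The first marginalization. -/
def fstM (X Y : C) : X ⊗ Y ⟶ X := X ◁ ε[Y] ≫ (ρ_ X).hom

/-- The second marginalization. -/
def sndM (X Y : C) : X ⊗ Y ⟶ Y := ε[X] ▷ Y ≫ (λ_ Y).hom

/-- Morphisms that commute with copying. -/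
class Det (f : A ⟶ X) : Prop where
  comp_copy : f ≫ Δ[X] = Δ[A] ≫ (f ⊗ₘ f)

theorem pair_tensorHom (f : A ⟶ X) (g : A ⟶ Y) (a : X ⟶ U) (b : Y ⟶ V) :
    pair f g ≫ (a ⊗ₘ b) = pair (f ≫ a) (g ≫ b) := by
  simp [pair]

/-- Determinism is essential: running `d` once and copying its result differs in general from
running it twice. Most steps below that move a morphism through a copy come down to this. -/
theorem comp_pair (d : B ⟶ A) [hd : Det d] (f : A ⟶ X) (g : A ⟶ Y) :
    d ≫ pair f g = pair (d ≫ f) (d ≫ g) := by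
  simp [pair, reassoc_of% hd.comp_copy]

theorem comp_pair_assoc (d : B ⟶ A) [Det d] (f : A ⟶ X) (g : A ⟶ Y) (h : X ⊗ Y ⟶ Z) :
    d ≫ pair f g ≫ h = pair (d ≫ f) (d ≫ g) ≫ h := by
  rw [← Category.assoc, comp_pair]

@[simp]
theorem pair_fst (f : A ⟶ X) (g : A ⟶ Y) : pair f g ≫ fstM X Y = f := by
  have h : (f ⊗ₘ g) ≫ X ◁ ε[Y] = f ⊗ₘ ε[A] := by simp [← id_tensorHom]
  rw [pair, fstM, Category.assoc, reassoc_of% h]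
  simp

@[simp]
theorem pair_snd (f : A ⟶ X) (g : A ⟶ Y) : pair f g ≫ sndM X Y = g := by
  have h : (f ⊗ₘ g) ≫ ε[X] ▷ Y = ε[A] ⊗ₘ g := by simp [← tensorHom_id]
  rw [pair, sndM, Category.assoc, reassoc_of% h]
  simp

@[simp]
theorem pair_fst_assoc (f : A ⟶ X) (g : A ⟶ Y) (h : X ⟶ Z) : pair f g ≫ fstM X Y ≫ h = f ≫ h := by
  rw [← Category.assoc, pair_fst]

@[simp]
theorem pair_snd_assoc (f : A ⟶ X) (g : A ⟶ Y) (h : Y ⟶ Z) : pair f g ≫ sndM X Y ≫ h = g ≫ h := by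
  rw [← Category.assoc, pair_snd]

/-- Copying a tensor product copies both factors and interchanges the middle ones. Discarding those
two middle factors reduces the interchange to one of units, and the counit laws finish. -/
theorem pair_fst_snd : pair (fstM X Y) (sndM X Y) = 𝟙 (X ⊗ Y) := by
  have h1 : (fstM X Y ⊗ₘ sndM X Y) = ((𝟙 X ⊗ₘ ε[Y]) ⊗ₘ (ε[X] ⊗ₘ 𝟙 Y)) ≫
      ((ρ_ X).hom ⊗ₘ (λ_ Y).hom) := by
    simp [fstM, sndM]
  rw [pair, CopyDiscardCategory.copy_tensor, h1, Category.assoc, ← tensorμ_natural_assoc]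
  have h2 : tensorμ X (𝟙_ C) (𝟙_ C) Y = 𝟙 _ := by
    have h : (β_ (𝟙_ C) (𝟙_ C)).hom = 𝟙 _ := by
      rw [braiding_tensorUnit_left, unitors_equal, Iso.hom_inv_id]
    simp [tensorμ, h]
  have h3 : Δ[X] ≫ (𝟙 X ⊗ₘ ε[X]) = (ρ_ X).inv := by rw [ComonObj.comul_counit_hom, Category.id_comp]
  have h4 : Δ[Y] ≫ (ε[Y] ⊗ₘ 𝟙 Y) = (λ_ Y).inv := by rw [ComonObj.counit_comul_hom, Category.id_comp]
  rw [h2, Category.id_comp, tensorHom_comp_tensorHom_assoc, tensorHom_comp_tensorHom, h3, h4,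
    Iso.inv_hom_id, Iso.inv_hom_id, id_tensorHom_id]

theorem pair_id : pair (𝟙 A) (𝟙 A) = Δ[A] := by simp [pair]

theorem pair_assoc (f : A ⟶ X) (g : A ⟶ Y) (h : A ⟶ Z) :
    pair (pair f g) h ≫ (α_ X Y Z).hom = pair f (pair g h) := by
  have h1 : (pair f g ⊗ₘ h) = (Δ[A] ▷ A) ≫ ((f ⊗ₘ g) ⊗ₘ h) := by
    rw [pair, ← tensorHom_id, tensorHom_comp_tensorHom, Category.id_comp]
  have h2 : (f ⊗ₘ pair g h) = (A ◁ Δ[A]) ≫ (f ⊗ₘ (g ⊗ₘ h)) := by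
    rw [pair, ← id_tensorHom, tensorHom_comp_tensorHom, Category.id_comp]
  rw [pair, h1, pair, h2, Category.assoc, Category.assoc, associator_naturality,
    ComonObj.comul_assoc_assoc]

theorem pair_braiding (f : A ⟶ X) (g : A ⟶ Y) : pair f g ≫ (β_ X Y).hom = pair g f := by
  simp [pair]

/-! ### Closure properties of deterministic morphisms. -/

instance : Det (𝟙 A) := ⟨by simp⟩

instance (f : A ⟶ X) (g : X ⟶ Y) [hf : Det f] [hg : Det g] : Det (f ≫ g) :=
  ⟨by rw [Category.assoc, hg.comp_copy, reassoc_of% hf.comp_copy]; simp⟩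

instance : Det ε[A] := ⟨by
  have : Δ[𝟙_ C] = (λ_ (𝟙_ C)).inv := CopyDiscardCategory.copy_unit
  rw [this, ComonObj.counit_comul_hom]⟩

theorem det_eqToHom (h : A = B) : Det (eqToHom h) := by
  subst h; rw [eqToHom_refl]; infer_instance

instance (h : A = B) : Det (eqToHom h) := det_eqToHom h

theorem pair_assoc_inv (f : A ⟶ X) (g : A ⟶ Y) (h : A ⟶ Z) :
    pair f (pair g h) ≫ (α_ X Y Z).inv = pair (pair f g) h := by
  rw [Iso.comp_inv_eq, pair_assoc]

theorem pair_whiskerLeft (f : A ⟶ X) (g : A ⟶ Y) (a : Y ⟶ Z) :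
    pair f g ≫ X ◁ a = pair f (g ≫ a) := by
  rw [← id_tensorHom, pair_tensorHom, Category.comp_id]

theorem pair_whiskerRight (f : A ⟶ X) (g : A ⟶ Y) (a : X ⟶ Z) :
    pair f g ≫ a ▷ Y = pair (f ≫ a) g := by
  rw [← tensorHom_id, pair_tensorHom, Category.comp_id]

theorem pair_tensorμ (f : A ⟶ X) (g : A ⟶ Y) (h : A ⟶ Z) (k : A ⟶ O) :
    pair (pair f g) (pair h k) ≫ tensorμ X Y Z O = pair (pair f h) (pair g k) := by
  rw [tensorμ, ← Category.assoc, pair_assoc, ← Category.assoc, pair_whiskerLeft, pair_assoc_inv,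
    ← Category.assoc, pair_whiskerLeft, pair_whiskerRight, pair_braiding, ← Category.assoc,
    pair_whiskerLeft, pair_assoc, pair_assoc_inv]

theorem Det.comp_copy_eq_pair (f : A ⟶ X) [hf : Det f] : f ≫ Δ[X] = pair f f := hf.comp_copy

instance (f : A ⟶ X) (g : A ⟶ Y) [hf : Det f] [hg : Det g] : Det (pair f g) := ⟨by
  rw [CopyDiscardCategory.copy_tensor, ← Category.assoc, pair_tensorHom, hf.comp_copy_eq_pair,
    hg.comp_copy_eq_pair, pair_tensorμ]
  rfl⟩

theorem det_tensorHom (f : A ⟶ X) (g : B ⟶ Y) [hf : Det f] [hg : Det g] : Det (f ⊗ₘ g) := ⟨by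
  rw [CopyDiscardCategory.copy_tensor, CopyDiscardCategory.copy_tensor, ← Category.assoc,
    tensorHom_comp_tensorHom, hf.comp_copy, hg.comp_copy, ← tensorHom_comp_tensorHom,
    Category.assoc, Category.assoc, tensorμ_natural]⟩

instance (f : A ⟶ X) (g : B ⟶ Y) [Det f] [Det g] : Det (f ⊗ₘ g) := det_tensorHom f g

instance : Det (ρ_ X).hom := ⟨by
  rw [CopyDiscardCategory.copy_tensor, Category.assoc, CopyDiscardCategory.copy_unit]
  have h : (Δ[X] ⊗ₘ (λ_ (𝟙_ C)).inv) = Δ[X] ▷ 𝟙_ C ≫ (X ⊗ X) ◁ (λ_ (𝟙_ C)).inv := by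
    rw [MonoidalCategory.tensorHom_def]
  rw [h, Category.assoc, ← tensor_right_unitality, rightUnitor_naturality]⟩

instance : Det (λ_ X).hom := ⟨by
  rw [CopyDiscardCategory.copy_tensor, Category.assoc, CopyDiscardCategory.copy_unit]
  have h : ((λ_ (𝟙_ C)).inv ⊗ₘ Δ[X]) = 𝟙_ C ◁ Δ[X] ≫ (λ_ (𝟙_ C)).inv ▷ (X ⊗ X) := by
    rw [MonoidalCategory.tensorHom_def']
  rw [h, Category.assoc, ← tensor_left_unitality, leftUnitor_naturality]⟩

instance : Det (fstM X Y) := by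
  rw [fstM, ← id_tensorHom]
  infer_instance

instance : Det (sndM X Y) := by
  rw [sndM, ← tensorHom_id]
  infer_instance

theorem pair_eta (d : A ⟶ X ⊗ Y) [Det d] : pair (d ≫ fstM X Y) (d ≫ sndM X Y) = d := by
  rw [← comp_pair, pair_fst_snd, Category.comp_id]

/-- Fails for general morphisms, whose two marginals forget the correlation between the outputs.
This is the uniqueness half of the product property of `X ⊗ Y`. -/
theorem det_ext {d d' : A ⟶ X ⊗ Y} [hd : Det d] [hd' : Det d'] (h₁ : d ≫ fstM X Y = d' ≫ fstM X Y)
    (h₂ : d ≫ sndM X Y = d' ≫ sndM X Y) : d = d' := by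
  rw [← pair_eta d, ← pair_eta d', h₁, h₂]

theorem tensorHom_eq_pair (f : A ⟶ X) (g : B ⟶ Y) :
    (f ⊗ₘ g) = pair (fstM A B ≫ f) (sndM A B ≫ g) := by
  rw [← pair_tensorHom, pair_fst_snd, Category.id_comp]

theorem pair_swap (f : A ⟶ X) (g : A ⟶ Y) : pair f g ≫ pair (sndM X Y) (fstM X Y) = pair g f := by
  have : pair (sndM X Y) (fstM X Y) = (β_ X Y).hom := by
    rw [← pair_braiding, pair_fst_snd, Category.id_comp]
  rw [this, pair_braiding]

/-- Copying the output of a morphism before or after computing it. -/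
theorem pair_graph (d : A ⟶ B) (a : A ⟶ X) (e : A ⊗ X ⟶ Y) :
    pair d (pair (𝟙 A) a ≫ e) = pair (𝟙 A) a ≫ pair (fstM A X ≫ d) e := by
  -- Both sides use three copies of `A`, for `d`, for `a` and for the first argument of `e`; only
  -- their bracketing differs, so coassociativity is the content.
  have h1 : pair (fstM A X ≫ d) e = pair (fstM A X ≫ pair d (𝟙 A)) (sndM A X) ≫ (α_ B A X).hom ≫
      (𝟙 B ⊗ₘ e) := by
    rw [comp_pair, ← Category.assoc, pair_assoc, Category.comp_id, pair_fst_snd, pair_tensorHom,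
      Category.comp_id, Category.id_comp]
  have h2 : pair (𝟙 A) a ≫ pair (fstM A X ≫ pair d (𝟙 A)) (sndM A X) = pair (pair d (𝟙 A)) a := by
    have h3 : pair (fstM A X ≫ pair d (𝟙 A)) (sndM A X) = pair d (𝟙 A) ▷ X := by
      rw [← tensorHom_id, tensorHom_eq_pair, Category.comp_id]
    rw [h3, pair_whiskerRight, Category.id_comp]
  rw [h1, ← Category.assoc, h2, ← Category.assoc, pair_assoc, pair_tensorHom, Category.comp_id]

theorem associator_eq_pair :
    (α_ X Y Z).hom = pair (fstM _ _ ≫ fstM _ _) (pair (fstM _ _ ≫ sndM _ _) (sndM _ _)) := by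
  rw [← pair_assoc, ← comp_pair, pair_fst_snd, Category.comp_id, pair_fst_snd, Category.id_comp]

theorem whiskerLeft_eq_pair (f : Y ⟶ Z) : X ◁ f = pair (fstM X Y) (sndM X Y ≫ f) := by
  rw [← pair_whiskerLeft, pair_fst_snd, Category.id_comp]

theorem whiskerRight_eq_pair (f : Y ⟶ Z) : f ▷ X = pair (fstM Y X ≫ f) (sndM Y X) := by
  rw [← pair_whiskerRight, pair_fst_snd, Category.id_comp]

/-- In pairing form the associators and braidings disappear, and the new output is just adjoined to
what `h` produces. -/
theorem condIndep_iff (f : A ⟶ X ⊗ (Y ⊗ Z)) :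
    CondIndep f ↔ ∃ (h : A ⟶ Y ⊗ Z) (k : Z ⟶ X), f = h ≫ pair (sndM Y Z ≫ k) (𝟙 _) := by
  have key : ∀ k : Z ⟶ X, Y ◁ (Δ[Z] ≫ k ▷ Z) ≫ (α_ Y X Z).inv ≫ (β_ Y X).hom ▷ Z ≫ (α_ X Y Z).hom =
      pair (sndM Y Z ≫ k) (𝟙 _) := by
    intro k
    rw [whiskerLeft_eq_pair, ← pair_id, pair_whiskerRight, Category.id_comp, comp_pair,
      Category.comp_id, ← Category.assoc, pair_assoc_inv, ← Category.assoc, pair_whiskerRight,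
      pair_braiding, pair_assoc, pair_fst_snd]
  simp only [CondIndep, key]

theorem hasConditionals_iff : HasConditionals C ↔ ∀ (A X Y : C) (f : A ⟶ X ⊗ Y),
    ∃ c : X ⊗ A ⟶ Y, f = pair (f ≫ fstM X Y) (𝟙 A) ≫ pair (fstM X A) c := by
  have key : ∀ (A X Y : C) (f : A ⟶ X ⊗ Y) (c : X ⊗ A ⟶ Y),
      Δ[A] ≫ ((f ≫ X ◁ ε[Y] ≫ (ρ_ X).hom ≫ Δ[X]) ▷ A) ≫ (α_ X X A).hom ≫ X ◁ c =
      pair (f ≫ fstM X Y) (𝟙 A) ≫ pair (fstM X A) c := by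
    intro A X Y f c
    have h1 : (f ≫ X ◁ ε[Y] ≫ (ρ_ X).hom ≫ Δ[X]) = (f ≫ fstM X Y) ≫ Δ[X] := by
      simp [fstM]
    have h2 : Δ[X] ▷ A ≫ (α_ X X A).hom ≫ X ◁ c = pair (fstM X A) c := by
      rw [whiskerRight_eq_pair, ← pair_id, comp_pair, Category.comp_id, ← Category.assoc,
        pair_assoc, pair_fst_snd, pair_whiskerLeft, Category.id_comp]
    rw [h1, comp_whiskerRight, Category.assoc, h2, ← pair_id, ← Category.assoc, pair_whiskerRight,
      Category.id_comp]
  simp only [HasConditionals, key]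

theorem pair_right_comm (f : A ⟶ X) (g : A ⟶ Y) (h : A ⟶ Z) :
    pair (pair f g) h ≫ pair (pair (fstM _ _ ≫ fstM _ _) (sndM _ _)) (fstM _ _ ≫ sndM _ _) =
      pair (pair f h) g := by
  have : pair (pair (fstM _ _ ≫ fstM _ _) (sndM _ _)) (fstM _ _ ≫ sndM _ _) =
      (α_ X Y Z).hom ≫ X ◁ (β_ Y Z).hom ≫ (α_ X Z Y).inv := by
    rw [associator_eq_pair, ← Category.assoc, pair_whiskerLeft, pair_braiding,
      pair_assoc_inv]
  rw [this, ← Category.assoc, pair_assoc, ← Category.assoc, pair_whiskerLeft, pair_braiding,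
    pair_assoc_inv]

theorem pair_graph_fst (a : A ⟶ X) (b : A ⟶ Y) :
    pair (𝟙 A) a ≫ pair (𝟙 _) (fstM A X ≫ b) = pair (pair (𝟙 A) a) b := by
  have h := pair_graph b a (𝟙 _)
  rw [Category.comp_id] at h
  rw [← pair_swap b, h, Category.assoc, pair_swap]

/-- Two values that depend on `A` alone can be generated in either order, up to permuting the
results; this is cocommutativity of copying. -/
theorem pair_graph_comm (a : A ⟶ X) (b : A ⟶ Y) :
    pair (𝟙 A) a ≫ pair (𝟙 _) (fstM A X ≫ b) =
      pair (𝟙 A) b ≫ pair (𝟙 _) (fstM A Y ≫ a) ≫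
        pair (pair (fstM _ _ ≫ fstM _ _) (sndM _ _)) (fstM _ _ ≫ sndM _ _) := by
  rw [pair_graph_fst, ← Category.assoc, pair_graph_fst, pair_right_comm]

/-- A normal form: generate `f` while keeping the input, then rearrange. With both sides of an
identity in this form, the common generating steps cancel and only identities between projections
remain. -/
theorem pair_eq_graph (d : A ⟶ B) (f : A ⟶ X) :
    pair d f = pair (𝟙 A) f ≫ pair (fstM A X ≫ d) (sndM A X) := by
  rw [← whiskerRight_eq_pair, pair_whiskerRight, Category.id_comp]

theorem pair_eq_graph' (d : A ⟶ B) (f : A ⟶ X) :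
    pair f d = pair (𝟙 A) f ≫ pair (sndM A X) (fstM A X ≫ d) := by
  rw [← pair_swap d, pair_eq_graph, Category.assoc, pair_swap]

theorem det_comp_graph (d : A ⟶ B) [Det d] (f : B ⟶ X) :
    d ≫ pair (𝟙 B) f = pair (𝟙 A) (d ≫ f) ≫ pair (fstM A X ≫ d) (sndM A X) := by
  rw [comp_pair, Category.comp_id, ← pair_eq_graph]

theorem det_comp_graph_assoc (d : A ⟶ B) [Det d] (f : B ⟶ X) (h : B ⊗ X ⟶ Y) :
    d ≫ pair (𝟙 B) f ≫ h = pair (𝟙 A) (d ≫ f) ≫ pair (fstM A X ≫ d) (sndM A X) ≫ h := by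
  rw [← Category.assoc, det_comp_graph, Category.assoc]

/-! ### Stability of conditional independence. -/

/-- Conditional independence is preserved when new outputs are generated from `V` and `Z`. -/
theorem CondIndep.extend_right {g : A ⟶ U ⊗ (V ⊗ Z)} (hg : CondIndep g)
    (c : V ⊗ Z ⟶ O) (r : O ⟶ X) [Det r] :
    CondIndep (g ≫ pair (𝟙 _) (sndM _ _ ≫ c) ≫
      pair (fstM _ _ ≫ fstM _ _)
        (pair (pair (fstM _ _ ≫ sndM _ _ ≫ fstM _ _) (sndM _ _))
          (pair (fstM _ _ ≫ sndM _ _ ≫ sndM _ _) (sndM _ _ ≫ r)))) := by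
  rw [condIndep_iff] at hg ⊢
  obtain ⟨h, k, rfl⟩ := hg
  -- The new output is generated together with `V` and `Z`, while `U` is still produced by `k` from
  -- the old `Z`, the first factor of the new one.
  refine ⟨h ≫ pair (𝟙 _) c ≫ pair (pair (fstM _ _ ≫ fstM _ _) (sndM _ _))
    (pair (fstM _ _ ≫ sndM _ _) (sndM _ _ ≫ r)), fstM _ _ ≫ k, ?_⟩
  simp only [Category.assoc]
  congr 1
  rw [pair_eq_graph' (𝟙 _) (sndM V Z ≫ k)]
  simp only [Category.assoc, Category.comp_id, det_comp_graph_assoc, pair_snd_assoc]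
  -- Given `V ⊗ Z`, the morphisms `k` and `c` do not see each other's results and can be exchanged.
  rw [← Category.assoc, pair_graph_comm]
  simp only [Category.assoc, comp_pair, pair_snd, pair_fst, pair_fst_assoc, pair_snd_assoc,
    Category.comp_id]
  congr 1
  rw [pair_eq_graph' _ (fstM (V ⊗ Z) O ≫ _)]
  simp only [comp_pair]

/-- Conditional independence is preserved when new outputs are generated from `U` and `Z`. -/
theorem CondIndep.extend_left (hC : HasConditionals C) {g : A ⟶ U ⊗ (V ⊗ Z)} (hg : CondIndep g)
    (c : U ⊗ Z ⟶ O) (r : O ⟶ X) [Det r] :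
    CondIndep (g ≫ pair (𝟙 _) (pair (fstM _ _) (sndM _ _ ≫ sndM _ _) ≫ c) ≫
      pair (pair (fstM _ _ ≫ fstM _ _) (sndM _ _))
        (pair (fstM _ _ ≫ sndM _ _ ≫ fstM _ _)
          (pair (fstM _ _ ≫ sndM _ _ ≫ sndM _ _) (sndM _ _ ≫ r)))) := by
  rw [condIndep_iff] at hg ⊢
  obtain ⟨h, k, rfl⟩ := hg
  -- Everything new depends on the old `Z` alone: `m` runs `k`, then `c`, and puts first the part
  -- `r` of the result that is going to join `Z`.
  let m : Z ⟶ X ⊗ (U ⊗ O) := pair (𝟙 Z) k ≫ pair (𝟙 _) (pair (sndM _ _) (fstM _ _) ≫ c) ≫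
    pair (sndM _ _ ≫ r) (pair (fstM _ _ ≫ sndM _ _) (sndM _ _))
  have hm : pair (sndM V Z ≫ k) (𝟙 _) ≫
      pair (𝟙 _) (pair (fstM _ _) (sndM _ _ ≫ sndM _ _) ≫ c) ≫
      pair (pair (fstM _ _ ≫ fstM _ _) (sndM _ _))
        (pair (fstM _ _ ≫ sndM _ _ ≫ fstM _ _)
          (pair (fstM _ _ ≫ sndM _ _ ≫ sndM _ _) (sndM _ _ ≫ r))) =
      pair (𝟙 _) (sndM V Z ≫ m) ≫ pair (sndM _ _ ≫ sndM _ _) (pair (fstM _ _ ≫ fstM _ _)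
        (pair (fstM _ _ ≫ sndM _ _) (sndM _ _ ≫ fstM _ _))) := by
    simp only [m, det_comp_graph_assoc, pair_graph, Category.assoc]
    rw [pair_eq_graph' (𝟙 _) (sndM V Z ≫ k)]
    simp only [Category.assoc, Category.comp_id, det_comp_graph_assoc]
    simp only [Category.assoc, comp_pair, pair_snd, pair_fst, pair_fst_assoc, pair_snd_assoc]
    simp only [comp_pair_assoc, pair_snd, pair_fst, pair_snd_assoc]
  -- The part joining `Z` must now precede the rest, so `m` is disintegrated along it. The first
  -- stage emits the marginal of `m`, and the second recovers `U ⊗ O` by `e` from the enlarged `Z`.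
  obtain ⟨e, he⟩ := hasConditionals_iff.1 hC _ _ _ m
  refine ⟨h ≫ pair (𝟙 _) (sndM _ _ ≫ m ≫ fstM _ _) ≫ pair (fstM _ _ ≫ fstM _ _)
    (pair (fstM _ _ ≫ sndM _ _) (sndM _ _)), pair (sndM _ _) (fstM _ _) ≫ e, ?_⟩
  generalize m ≫ fstM _ _ = m₁ at he ⊢
  simp only [Category.assoc]
  congr 1
  rw [hm, he, pair_eq_graph' (𝟙 _) m₁]
  simp only [Category.assoc, Category.comp_id, det_comp_graph_assoc, pair_graph]
  congr 1
  simp only [comp_pair, comp_pair_assoc, pair_snd, pair_fst, pair_snd_assoc, Category.comp_id]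
  generalize pair (sndM (V ⊗ Z) X) (fstM (V ⊗ Z) X ≫ sndM V Z) ≫ e = e'
  rw [pair_eq_graph (sndM (V ⊗ Z) X) e', pair_graph, pair_eq_graph' _ e']
  simp only [Category.assoc, comp_pair, pair_snd, pair_fst, pair_fst_assoc, pair_snd_assoc]

theorem CondIndep.precomp {g : A ⟶ U ⊗ (V ⊗ Z)} (hg : CondIndep g) (d : B ⟶ A) :
    CondIndep (d ≫ g) := by
  rw [condIndep_iff] at hg ⊢
  obtain ⟨h, k, rfl⟩ := hg
  exact ⟨d ≫ h, k, (Category.assoc _ _ _).symm⟩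

theorem sndM_naturality (f : A ⟶ X) (g : B ⟶ Y) : (f ⊗ₘ g) ≫ sndM X Y = sndM A B ≫ g := by
  rw [tensorHom_eq_pair, pair_snd]

/-- The second stage sees only the image of `Z` under `c`, so it needs `c'` to recover `Z`.
Determinism of `b` and `c` lets them pass the copy taken before that stage; `a` is simply absorbed
into it. -/
theorem CondIndep.map {g : A ⟶ U ⊗ (V ⊗ Z)} (hg : CondIndep g) (a : U ⟶ X) (b : V ⟶ Y)
    (c : Z ⟶ Q) (c' : Q ⟶ Z) (hc : c ≫ c' = 𝟙 Z) [Det b] [Det c] :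
    CondIndep (g ≫ (a ⊗ₘ (b ⊗ₘ c))) := by
  rw [condIndep_iff] at hg ⊢
  obtain ⟨h, k, rfl⟩ := hg
  refine ⟨h ≫ (b ⊗ₘ c), c' ≫ k ≫ a, ?_⟩
  rw [Category.assoc, Category.assoc, pair_tensorHom, comp_pair (b ⊗ₘ c), ← Category.assoc (b ⊗ₘ c),
    sndM_naturality, Category.assoc, Category.assoc, ← Category.assoc c, hc]
  simp

end Pairing

end CausalModels

end

noncomputable section

namespace CausalModels

/-! ### Products with respect to deterministic morphisms -/

section DetProd

variable {C : Type w} [Category.{v} C] [MonoidalCategory C] [MarkovCategory C] {ι : Type*}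

/-- The object `P` with projections `π` is the product of the objects `V i` for `i ∈ s` with respect
to deterministic morphisms. -/
structure IsDetProd (V : ι → C) (s : Set ι) (P : C) (π : ∀ i, i ∈ s → (P ⟶ V i)) : Prop where
  det : ∀ i h, Det (π i h)
  exists_lift : ∀ (Q : C) (e : ∀ i, i ∈ s → (Q ⟶ V i)), (∀ i h, Det (e i h)) →
    ∃ c : Q ⟶ P, Det c ∧ ∀ i h, c ≫ π i h = e i h
  hom_ext : ∀ (Q : C) (c c' : Q ⟶ P), Det c → Det c' →
    (∀ i h, c ≫ π i h = c' ≫ π i h) → c = c'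

variable {V : ι → C} {s t : Set ι} {P P' : C} {π : ∀ i, i ∈ s → (P ⟶ V i)}
  {π' : ∀ i, i ∈ t → (P' ⟶ V i)}

theorem isDetProd_empty (π : ∀ i, i ∈ (∅ : Set ι) → (𝟙_ C ⟶ V i)) : IsDetProd V ∅ (𝟙_ C) π where
  det _ h := h.elim
  exists_lift Q _ _ := ⟨ε[Q], inferInstance, fun _ h => h.elim⟩
  hom_ext _ _ _ _ _ _ := Subsingleton.elim _ _

theorem isDetProd_singleton (i : ι) :
    IsDetProd V {i} (V i) (fun _ h => eqToHom (congrArg V (Set.mem_singleton_iff.1 h).symm)) where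
  det _ _ := inferInstance
  exists_lift Q e he := ⟨e i rfl, he i rfl, by rintro _ rfl; simp⟩
  hom_ext Q c c' _ _ h := by simpa using h i rfl

open Classical in
/-- The projections from a tensor product of two products. -/
def unionProj (π : ∀ i, i ∈ s → (P ⟶ V i)) (π' : ∀ i, i ∈ t → (P' ⟶ V i)) (i : ι)
    (h : i ∈ s ∪ t) : P ⊗ P' ⟶ V i :=
  if hs : i ∈ s then fstM P P' ≫ π i hs else sndM P P' ≫ π' i (h.resolve_left hs)

theorem unionProj_left (i : ι) (h : i ∈ s) (h' : i ∈ s ∪ t) :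
    unionProj π π' i h' = fstM P P' ≫ π i h := dif_pos h

theorem unionProj_right (i : ι) (hs : i ∉ s) (h : i ∈ t) (h' : i ∈ s ∪ t) :
    unionProj π π' i h' = sndM P P' ≫ π' i h := dif_neg hs

/-- Disjointness serves uniqueness: `unionProj` reads a common index from the left factor, and the
right copy would be unconstrained. -/
theorem IsDetProd.union (hst : Disjoint s t) (hP : IsDetProd V s P π) (hP' : IsDetProd V t P' π') :
    IsDetProd V (s ∪ t) (P ⊗ P') (unionProj π π') where
  det i h := by
    have := hP.det
    have := hP'.det
    by_cases hs : i ∈ s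
    · rw [unionProj_left i hs]
      infer_instance
    · rw [unionProj_right i hs (h.resolve_left hs)]
      infer_instance
  exists_lift Q e he := by
    obtain ⟨c, hc, hc'⟩ := hP.exists_lift Q (fun i h => e i (Or.inl h)) fun i h => he i _
    obtain ⟨d, hd, hd'⟩ := hP'.exists_lift Q (fun i h => e i (Or.inr h)) fun i h => he i _
    refine ⟨pair c d, inferInstance, fun i h => ?_⟩
    by_cases hs : i ∈ s
    · rw [unionProj_left i hs, pair_fst_assoc, hc']
    · rw [unionProj_right i hs (h.resolve_left hs), pair_snd_assoc, hd']
  hom_ext Q c c' hc hc' h := by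
    refine det_ext (hP.hom_ext _ _ _ inferInstance inferInstance fun i hi => ?_)
      (hP'.hom_ext _ _ _ inferInstance inferInstance fun i hi => ?_)
    · have := h i (Set.mem_union_left t hi)
      rwa [unionProj_left i hi, ← Category.assoc, ← Category.assoc] at this
    · have := h i (Set.mem_union_right s hi)
      rwa [unionProj_right i (fun hs => Set.disjoint_left.1 hst hs hi) hi, ← Category.assoc,
        ← Category.assoc] at this

theorem exists_isDetProd (V : ι → C) (hs : s.Finite) :
    ∃ (P : C) (π : ∀ i, i ∈ s → (P ⟶ V i)), IsDetProd V s P π := by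
  induction s, hs using Set.Finite.induction_on with
  | empty => exact ⟨_, fun _ h => h.elim, isDetProd_empty _⟩
  | @insert a s ha _ ih =>
    obtain ⟨P, π, h⟩ := ih
    rw [Set.insert_eq]
    exact ⟨_, _, (isDetProd_singleton a).union (Set.disjoint_singleton_left.2 ha) h⟩

/-! ### Tensor products over lists as products. -/

/-- The first factor of a tensor product over a list. -/
def headM (V : ι → C) (a : ι) (L : List ι) : tensorOver V (a :: L) ⟶ V a :=
  fstM (V a) (tensorOver V L)

/-- The remaining factors of a tensor product over a list. -/
def tailM (V : ι → C) (a : ι) (L : List ι) : tensorOver V (a :: L) ⟶ tensorOver V L :=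
  sndM (V a) (tensorOver V L)

/-- Pairing into a tensor product over a list. -/
def consM {Q : C} {a : ι} {L : List ι} (f : Q ⟶ V a) (g : Q ⟶ tensorOver V L) :
    Q ⟶ tensorOver V (a :: L) := pair f g

instance (a : ι) (L : List ι) : Det (headM V a L) := inferInstanceAs (Det (fstM _ _))

instance (a : ι) (L : List ι) : Det (tailM V a L) := inferInstanceAs (Det (sndM _ _))

instance {Q : C} {a : ι} {L : List ι} (f : Q ⟶ V a) (g : Q ⟶ tensorOver V L) [Det f] [Det g] :
    Det (consM f g) := inferInstanceAs (Det (pair f g))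

theorem consM_head {Q : C} {a : ι} {L : List ι} (f : Q ⟶ V a) (g : Q ⟶ tensorOver V L) :
    consM f g ≫ headM V a L = f := pair_fst f g

theorem consM_tail {Q : C} {a : ι} {L : List ι} (f : Q ⟶ V a) (g : Q ⟶ tensorOver V L) :
    consM f g ≫ tailM V a L = g := pair_snd f g

theorem consM_ext {Q : C} {a : ι} {L : List ι} {d d' : Q ⟶ tensorOver V (a :: L)} (hd : Det d)
    (hd' : Det d') (h₁ : d ≫ headM V a L = d' ≫ headM V a L)
    (h₂ : d ≫ tailM V a L = d' ≫ tailM V a L) : d = d' :=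
  det_ext (X := V a) (Y := tensorOver V L) (hd := hd) (hd' := hd') h₁ h₂

open Classical in
/-- The projections from a tensor product over a list. -/
def tproj (V : ι → C) : (L : List ι) → (i : ι) → i ∈ L → (tensorOver V L ⟶ V i)
  | [], _, h => absurd h List.not_mem_nil
  | a :: L, i, h =>
    if e : i = a then headM V a L ≫ eqToHom (congrArg V e.symm)
    else tailM V a L ≫ tproj V L i ((List.mem_cons.1 h).resolve_left e)

theorem tproj_head (a : ι) (L : List ι) (h : a ∈ a :: L) : tproj V (a :: L) a h = headM V a L := by
  rw [tproj, dif_pos rfl, eqToHom_refl, Category.comp_id]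

theorem tproj_tail {a : ι} {L : List ι} {i : ι} (e : i ≠ a) (h : i ∈ a :: L) (h' : i ∈ L) :
    tproj V (a :: L) i h = tailM V a L ≫ tproj V L i h' := dif_neg e

theorem det_tproj (L : List ι) (i : ι) (h : i ∈ L) : Det (tproj V L i h) := by
  induction L with
  | nil => exact absurd h List.not_mem_nil
  | cons a L ih =>
    by_cases e : i = a
    · subst e
      rw [tproj_head]
      infer_instance
    · have := ih ((List.mem_cons.1 h).resolve_left e)
      rw [tproj_tail e h ((List.mem_cons.1 h).resolve_left e)]
      infer_instance

/-- The list must not repeat an index, since `tproj` sees only the first occurrence and later copies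
would not be determined. -/
theorem isDetProd_tensorOver (V : ι → C) {L : List ι} (hL : L.Nodup) :
    IsDetProd V {i | i ∈ L} (tensorOver V L) (tproj V L) where
  det := det_tproj L
  exists_lift Q e he := by
    induction L with
    | nil => exact ⟨ε[Q], inferInstanceAs (Det ε[Q]), fun _ h => absurd h List.not_mem_nil⟩
    | cons a L ih =>
      obtain ⟨c, hc, hc'⟩ := ih (List.nodup_cons.1 hL).2
        (fun i h => e i (List.mem_cons_of_mem a h)) fun i h => he i _
      have := he a List.mem_cons_self
      refine ⟨consM (e a List.mem_cons_self) c, inferInstance, fun i h => ?_⟩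
      by_cases hi : i = a
      · subst hi
        rw [tproj_head, consM_head]
      · rw [tproj_tail hi h ((List.mem_cons.1 h).resolve_left hi), ← Category.assoc, consM_tail,
          hc']
  hom_ext Q c c' hc hc' h := by
    induction L with
    | nil => exact Subsingleton.elim (α := Q ⟶ 𝟙_ C) _ _
    | cons a L ih =>
      refine consM_ext hc hc' ?_ ?_
      · simpa only [tproj_head] using h a List.mem_cons_self
      · refine ih (List.nodup_cons.1 hL).2 _ _ inferInstance inferInstance fun i hi => ?_
        have hi' : i ≠ a := fun e => (List.nodup_cons.1 hL).1 (e ▸ hi)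
        simpa only [tproj_tail hi' (List.mem_cons_of_mem a hi) hi, Category.assoc] using
          h i (List.mem_cons_of_mem a hi)

theorem eqToHom_tproj {L L' : List ι} (e : L = L') (e' : tensorOver V L = tensorOver V L') (i : ι)
    (h : i ∈ L') : eqToHom e' ≫ tproj V L' i h = tproj V L i (e ▸ h) := by
  subst e
  rw [eqToHom_refl, Category.id_comp]

open Classical in
theorem discardCompl_cons_of_mem {J : Set ι} {a : ι} (ha : a ∈ J) (L : List ι)
    (e : tensorOver V (a :: L.filter (fun i => decide (i ∈ J))) =
      tensorOver V ((a :: L).filter (fun i => decide (i ∈ J)))) :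
    discardCompl V J (a :: L) = consM (headM V a L) (tailM V a L ≫ discardCompl V J L) ≫
      eqToHom e := by
  rw [discardCompl, dif_pos ha, whiskerLeft_eq_pair]
  rfl

open Classical in
theorem discardCompl_cons_of_notMem {J : Set ι} {a : ι} (ha : a ∉ J) (L : List ι)
    (e : tensorOver V (L.filter (fun i => decide (i ∈ J))) =
      tensorOver V ((a :: L).filter (fun i => decide (i ∈ J)))) :
    discardCompl V J (a :: L) = tailM V a L ≫ discardCompl V J L ≫ eqToHom e := by
  rw [discardCompl, dif_neg ha]
  exact (Category.assoc (ε[V a] ▷ tensorOver V L) _ _).symm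

open Classical in
theorem filter_cons_mem {J : Set ι} {a : ι} (ha : a ∈ J) (L : List ι) :
    a :: L.filter (fun i => decide (i ∈ J)) = (a :: L).filter (fun i => decide (i ∈ J)) := by
  simp [ha]

open Classical in
theorem filter_cons_notMem {J : Set ι} {a : ι} (ha : a ∉ J) (L : List ι) :
    L.filter (fun i => decide (i ∈ J)) = (a :: L).filter (fun i => decide (i ∈ J)) := by
  simp [ha]

theorem det_discardCompl (J : Set ι) (L : List ι) : Det (discardCompl V J L) := by
  induction L with
  | nil => exact inferInstanceAs (Det (𝟙 (𝟙_ C)))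
  | cons a L ih =>
    by_cases h : a ∈ J
    · rw [discardCompl_cons_of_mem h L (congrArg _ (filter_cons_mem h L))]
      infer_instance
    · rw [discardCompl_cons_of_notMem h L (congrArg _ (filter_cons_notMem h L))]
      infer_instance

open Classical in
-- With `det_discardCompl` and the product property of the target, this characterizes `discardCompl`
-- by its components, so its recursion is not needed any more.
theorem discardCompl_tproj (J : Set ι) (L : List ι) (i : ι)
    (h : i ∈ L.filter (fun i => decide (i ∈ J))) :
    discardCompl V J L ≫ tproj V _ i h = tproj V L i (List.mem_of_mem_filter h) := by
  induction L with
  | nil => exact absurd h List.not_mem_nil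
  | cons a L ih =>
    by_cases ha : a ∈ J
    · have e := filter_cons_mem ha L
      have h' := e ▸ h
      rw [discardCompl_cons_of_mem ha L (congrArg _ e), Category.assoc, eqToHom_tproj e]
      by_cases hi : i = a
      · subst hi
        rw [tproj_head, tproj_head, consM_head]
      · have hi' := (List.mem_cons.1 h').resolve_left hi
        rw [tproj_tail hi _ hi', tproj_tail hi _ (List.mem_of_mem_filter hi'), ← ih hi',
          ← Category.assoc, consM_tail, Category.assoc]
    · have e := filter_cons_notMem ha L
      have h' := e ▸ h
      have hi : i ≠ a := by
        rintro rfl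
        exact ha (by simpa using (List.mem_filter.1 h).2)
      rw [discardCompl_cons_of_notMem ha L (congrArg _ e), Category.assoc, Category.assoc,
        eqToHom_tproj e, tproj_tail hi _ (List.mem_of_mem_filter h'), ih h']

end DetProd

end CausalModels

end

noncomputable section

namespace CausalModels

/-! ### String diagrams as morphisms of the free Markov category -/

namespace Diagram

variable {S : BoxHypergraph.{u}} {σ τ υ χ : FreeMarkov S}

/-- The morphism of the free Markov category given by a string diagram. -/
def cls (φ : Diagram S σ τ) : σ ⟶ τ := φ.norm.toHom φ.norm_normalized

/-- The source of the equations between diagrams below: boxes outside the image of `h` reach no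
global output, so normalization removes them. -/
theorem cls_eq_of_box_injective {φ ψ : Diagram S σ τ} (h : DHom φ ψ)
    (hi : ∀ k l : ℕ, Function.Injective (h.box : φ.G.Box k l → ψ.G.Box k l)) : φ.cls = ψ.cls :=
  Quotient.sound (norm_iso_of_box_injective h hi)

theorem toHom_eq_cls (φ : Diagram S σ τ) (hφ : φ.Normalized) : φ.toHom hφ = φ.cls :=
  Quotient.sound (norm_iso_of_normalized hφ).symm

theorem cls_norm (φ : Diagram S σ τ) : φ.norm.cls = φ.cls :=
  (toHom_eq_cls _ φ.norm_normalized).symm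

/-- Normalizing the factors first makes no difference, because the inclusions of the normalizations
are injective on boxes. -/
theorem cls_comp (φ : Diagram S σ τ) (ψ : Diagram S τ υ) : (comp φ ψ).cls = φ.cls ≫ ψ.cls :=
  (Quotient.sound (norm_comp_iso (normHom φ) (normHom ψ)
    (fun _ _ => Subtype.val_injective) (fun _ _ => Subtype.val_injective))).symm

/-- Parallel composition is functorial for morphisms of string diagrams. -/
def tensorDHom {φ φ' : Diagram S σ τ} {ψ ψ' : Diagram S υ χ} (f : DHom φ φ') (g : DHom ψ ψ') :
    DHom (tensor φ ψ) (tensor φ' ψ') where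
  wire := Sum.map f.wire g.wire
  box b := Sum.map f.box g.box b
  inp_box := by
    rintro k l (b | b) i
    · exact congrArg Sum.inl (f.inp_box b i)
    · exact congrArg Sum.inr (g.inp_box b i)
  out_box := by
    rintro k l (b | b) i
    · exact congrArg Sum.inl (f.out_box b i)
    · exact congrArg Sum.inr (g.out_box b i)
  type_wire := by
    rintro (a | a)
    · exact f.type_wire a
    · exact g.type_wire a
  type_box := by
    rintro k l (b | b)
    · exact f.type_box b
    · exact g.type_box b
  wire_p := map_appendSum φ.p ψ.p _ _ _ _ f.wire_p g.wire_p
  wire_q := map_appendSum φ.q ψ.q _ _ _ _ f.wire_q g.wire_q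

theorem cls_tensor (φ : Diagram S σ τ) (ψ : Diagram S υ χ) :
    (tensor φ ψ).cls = FreeMarkov.tensorHom φ.cls ψ.cls := by
  have h : FreeMarkov.tensorHom φ.cls ψ.cls = (tensor φ.norm ψ.norm).toHom
    (tensor_normalized φ.norm_normalized ψ.norm_normalized) := rfl
  rw [h, toHom_eq_cls]
  exact (cls_eq_of_box_injective (tensorDHom (normHom φ) (normHom ψ)) fun k l =>
    Function.Injective.sumMap Subtype.val_injective Subtype.val_injective).symm

/-- The string diagram with the same hypergraph and different global outputs. -/
def withOutputs (φ : Diagram S σ τ) (υ : FreeMarkov S) (q : Fin υ.len → φ.G.Wire)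
    (hq : ∀ j, φ.type.wire (q j) = υ.ty j) : Diagram S σ υ :=
  { φ with
    q := q
    type_q := hq }

/-- A box-free diagram contributes no boxes, so the hypergraph stays the same and only the outputs
are reindexed along `r`. -/
theorem cls_comp_wire (φ : Diagram S σ τ) (r : Fin υ.len → Fin τ.len)
    (hr : ∀ j, τ.ty (r j) = υ.ty j) :
    φ.cls ≫ FreeMarkov.wire τ υ r hr =
      (φ.withOutputs υ (fun j => φ.q (r j)) fun j => (φ.type_q (r j)).trans (hr j)).cls := by
  rw [FreeMarkov.wire, toHom_eq_cls, ← cls_comp]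
  let ω : Diagram S τ υ := wiring τ υ r hr
  refine (cls_eq_of_box_injective (φ := φ.withOutputs υ (fun j => φ.q (r j)) _) (ψ := comp φ ω)
    { wire := (compInl φ ω).wire
      box := (compInl φ ω).box
      inp_box := fun _ _ => rfl
      out_box := fun _ _ => rfl
      type_wire := fun _ => rfl
      type_box := fun _ => rfl
      wire_p := fun _ => rfl
      wire_q := fun i => (glue_p φ ω (r i)).symm } fun k l => ?_).symm
  exact Sum.inl_injective

end Diagram

/-! ### Box-free diagrams as maps of indices. -/

namespace FreeMarkov

variable {S : BoxHypergraph.{u}} {σ τ υ χ : FreeMarkov S}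

theorem wire_congr {r r' : Fin τ.len → Fin σ.len} (e : r = r') (hr : ∀ j, σ.ty (r j) = τ.ty j)
    (hr' : ∀ j, σ.ty (r' j) = τ.ty j) : wire σ τ r hr = wire σ τ r' hr' := by
  subst e
  rfl

theorem wire_id (hr : ∀ j, σ.ty j = σ.ty j) : wire σ σ (fun j => j) hr = 𝟙 σ := rfl

theorem wire_comp (r : Fin τ.len → Fin σ.len) (hr : ∀ j, σ.ty (r j) = τ.ty j)
    (s : Fin υ.len → Fin τ.len) (hs : ∀ j, τ.ty (s j) = υ.ty j) :
    wire σ τ r hr ≫ wire τ υ s hs =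
      wire σ υ (fun j => r (s j)) (fun j => (hr (s j)).trans (hs j)) := by
  rw [wire, Diagram.toHom_eq_cls, Diagram.cls_comp_wire, wire, Diagram.toHom_eq_cls]
  rfl

theorem ty_cast (e : σ = τ) (j : Fin τ.len) : σ.ty (j.cast (e ▸ rfl)) = τ.ty j := by
  subst e
  rfl

/-- Turns transports along equal objects into reindexings, so that the strict unit laws reduce to
computations with indices. -/
theorem eqToHom_eq_wire (e : σ = τ) :
    eqToHom e = wire σ τ (fun j => j.cast (e ▸ rfl)) (ty_cast e) := by
  subst e
  rfl

/-- The indices of the first tensor factor. -/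
def idxL (σ τ : FreeMarkov S) (i : Fin σ.len) : Fin (σ.tensor τ).len := Fin.castAdd τ.len i

/-- The indices of the second tensor factor. -/
def idxR (σ τ : FreeMarkov S) (i : Fin τ.len) : Fin (σ.tensor τ).len := Fin.natAdd σ.len i

/-- Families indexed by a tensor product. -/
def idxElim {α : Sort*} (f : Fin σ.len → α) (g : Fin τ.len → α) : Fin (σ.tensor τ).len → α :=
  Fin.append f g

theorem idxElim_idxL {α : Sort*} (f : Fin σ.len → α) (g : Fin τ.len → α) (i : Fin σ.len) :
    idxElim f g (idxL σ τ i) = f i := Fin.append_left f g i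

theorem idxElim_idxR {α : Sort*} (f : Fin σ.len → α) (g : Fin τ.len → α) (i : Fin τ.len) :
    idxElim f g (idxR σ τ i) = g i := Fin.append_right f g i

theorem idx_cases {motive : Fin (σ.tensor τ).len → Prop} (hl : ∀ i, motive (idxL σ τ i))
    (hr : ∀ i, motive (idxR σ τ i)) (i : Fin (σ.tensor τ).len) : motive i :=
  Fin.addCases hl hr i

theorem tensor_ty_idxL (i : Fin σ.len) : (σ.tensor τ).ty (idxL σ τ i) = σ.ty i :=
  Fin.append_left _ _ i

theorem tensor_ty_idxR (i : Fin τ.len) : (σ.tensor τ).ty (idxR σ τ i) = τ.ty i :=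
  Fin.append_right _ _ i

/-- Two choices of inputs in parallel. -/
def parallel (r : Fin τ.len → Fin σ.len) (s : Fin χ.len → Fin υ.len) :
    Fin (τ.tensor χ).len → Fin (σ.tensor υ).len :=
  idxElim (fun j => idxL σ υ (r j)) (fun j => idxR σ υ (s j))

theorem parallel_ty {r : Fin τ.len → Fin σ.len} (hr : ∀ j, σ.ty (r j) = τ.ty j)
    {s : Fin χ.len → Fin υ.len} (hs : ∀ j, υ.ty (s j) = χ.ty j) (j : Fin (τ.tensor χ).len) :
    (σ.tensor υ).ty (parallel r s j) = (τ.tensor χ).ty j := by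
  revert j
  refine idx_cases (fun j => ?_) (fun j => ?_)
  · rw [parallel, idxElim_idxL, tensor_ty_idxL, tensor_ty_idxL, hr]
  · rw [parallel, idxElim_idxR, tensor_ty_idxR, tensor_ty_idxR, hs]

theorem tensorHom_wire (r : Fin τ.len → Fin σ.len) (hr : ∀ j, σ.ty (r j) = τ.ty j)
    (s : Fin χ.len → Fin υ.len) (hs : ∀ j, υ.ty (s j) = χ.ty j) :
    tensorHom (wire σ τ r hr) (wire υ χ s hs) =
      wire (σ.tensor υ) (τ.tensor χ) (parallel r s) (parallel_ty hr hs) := by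
  simp only [wire, Diagram.toHom_eq_cls]
  rw [← Diagram.cls_tensor]
  let h : Diagram.DHom
      (Diagram.wiring (σ.tensor υ) (τ.tensor χ) (parallel r s) (parallel_ty hr hs))
      (Diagram.tensor (Diagram.wiring σ τ r hr) (Diagram.wiring υ χ s hs)) :=
    { wire := fun a => Diagram.appendSum ULift.up ULift.up a.down
      box := fun b => b.elim
      inp_box := fun b => b.elim
      out_box := fun b => b.elim
      type_wire := fun a => Diagram.elim_appendSum _ _ _ _ _ _ (fun _ => rfl) (fun _ => rfl) a.down
      type_box := fun b => b.elim
      wire_p := fun i => rfl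
      wire_q := idx_cases
        (fun j => (congrArg (Diagram.appendSum ULift.up ULift.up) (idxElim_idxL _ _ j)).trans
          ((Diagram.appendSum_left _ _ _).trans
            (Diagram.appendSum_left (Diagram.wiring σ τ r hr).q (Diagram.wiring υ χ s hs).q
              j).symm))
        (fun j => (congrArg (Diagram.appendSum ULift.up ULift.up) (idxElim_idxR _ _ j)).trans
          ((Diagram.appendSum_right _ _ _).trans
            (Diagram.appendSum_right (Diagram.wiring σ τ r hr).q (Diagram.wiring υ χ s hs).q
              j).symm)) }
  exact (Diagram.cls_eq_of_box_injective h fun k l b => b.elim).symm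

theorem copy_eq_wire (σ : FreeMarkov S) : copy σ = wire σ (σ.tensor σ)
    (idxElim (fun j => j) (fun j => j))
    (idx_cases (fun j => by rw [idxElim_idxL, tensor_ty_idxL])
      (fun j => by rw [idxElim_idxR, tensor_ty_idxR])) := rfl

/-- Families indexed by the empty tensor product. -/
def idxUnit {α : Sort*} : Fin (unit S).len → α := Fin.elim0

theorem idxUnit_ty (j : Fin (unit S).len) : σ.ty (idxUnit j) = (unit S).ty j := Fin.elim0 j

theorem del_eq_wire (σ : FreeMarkov S) : del σ = wire σ (unit S) idxUnit idxUnit_ty := rfl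

theorem wire_comp_copy (r : Fin τ.len → Fin σ.len) (hr : ∀ j, σ.ty (r j) = τ.ty j) :
    wire σ τ r hr ≫ copy τ = copy σ ≫ tensorHom (wire σ τ r hr) (wire σ τ r hr) := by
  rw [copy_eq_wire, copy_eq_wire, tensorHom_wire, wire_comp, wire_comp]
  refine wire_congr (funext (idx_cases (fun j => ?_) (fun j => ?_))) _ _
  · rw [parallel, idxElim_idxL, idxElim_idxL, idxElim_idxL]
  · rw [parallel, idxElim_idxR, idxElim_idxR, idxElim_idxR]

theorem tensor_unit_eq (σ : FreeMarkov S) : σ.tensor (unit S) = σ := by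
  obtain ⟨n, t⟩ := σ
  exact congrArg (FreeMarkov.mk n) (Fin.append_elim0 t)

theorem unit_tensor_eq (σ : FreeMarkov S) : (unit S).tensor σ = σ := by
  obtain ⟨n, t⟩ := σ
  rw [tensor, FreeMarkov.mk.injEq]
  refine ⟨Nat.zero_add n, (Fin.heq_fun_iff (Nat.zero_add n)).2 fun i => ?_⟩
  exact congrFun (Fin.elim0_append t) i

/-- The left side is the marginalization in the free category; its image under a strict Markov
functor is therefore the marginalization in `C`, which gives `μ_fstM`. -/
theorem tensorHom_id_del (σ τ : FreeMarkov S) :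
    tensorHom (𝟙 σ) (del τ) ≫ eqToHom (tensor_unit_eq σ) =
      wire (σ.tensor τ) σ (idxL σ τ) tensor_ty_idxL := by
  rw [eqToHom_eq_wire, del_eq_wire,
    ← wire_id (fun _ => rfl), tensorHom_wire, wire_comp]
  exact wire_congr (funext fun j => idxElim_idxL _ _ j) _ _

theorem tensorHom_del_id (σ τ : FreeMarkov S) :
    tensorHom (del σ) (𝟙 τ) ≫ eqToHom (unit_tensor_eq τ) =
      wire (σ.tensor τ) τ (idxR σ τ) tensor_ty_idxR := by
  -- The shift by the length of the unit has value `0 + j`, which is not definitionally `j`.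
  have h : ∀ (e : τ.len = ((unit S).tensor τ).len) (j : Fin τ.len),
      Fin.cast e j = idxR (unit S) τ j := fun e j => Fin.ext (Nat.zero_add _).symm
  rw [eqToHom_eq_wire, del_eq_wire,
    ← wire_id (fun _ => rfl), tensorHom_wire, wire_comp]
  refine wire_congr (funext fun j => ?_) _ _
  rw [h]
  exact idxElim_idxR _ _ j

theorem cons_eq_tensor {n : ℕ} (t : Fin (n + 1) → S.Wire) :
    (⟨n + 1, t⟩ : FreeMarkov S) = (single (t 0)).tensor ⟨n, fun i => t i.succ⟩ := by
  rw [tensor, FreeMarkov.mk.injEq]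
  refine ⟨Nat.add_comm n 1, (Fin.heq_fun_iff (Nat.add_comm n 1)).2 fun i => ?_⟩
  have e := congrFun (Fin.append_left_eq_cons (fun _ : Fin 1 => t 0) (fun i => t i.succ))
    (i.cast (Nat.add_comm n 1))
  refine Eq.trans ?_ e.symm
  refine Fin.cases ?_ (fun i => ?_) i
  · rfl
  · rfl

end FreeMarkov

end CausalModels

end

noncomputable section

namespace CausalModels

/-! ### Strict Markov functors out of the free Markov category -/

/-! ### Transport along equalities of objects. -/

section EqToHom

variable {C : Type w} [Category.{v} C] [MonoidalCategory C]

theorem whiskerLeft_eqToHom' {X Y : C} (A : C) (h : X = Y) :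
    A ◁ eqToHom h = eqToHom (congrArg (A ⊗ ·) h) := by
  subst h
  simp

theorem eqToHom_whiskerRight' {X Y : C} (A : C) (h : X = Y) :
    eqToHom h ▷ A = eqToHom (congrArg (· ⊗ A) h) := by
  subst h
  simp

variable [MarkovCategory C]

theorem eqToHom_fstM {X X' Y Y' : C} (hX : X = X') (hY : Y = Y') (e : X ⊗ Y = X' ⊗ Y') :
    eqToHom e ≫ fstM X' Y' = fstM X Y ≫ eqToHom hX := by
  subst hX hY
  simp

theorem eqToHom_sndM {X X' Y Y' : C} (hX : X = X') (hY : Y = Y') (e : X ⊗ Y = X' ⊗ Y') :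
    eqToHom e ≫ sndM X' Y' = sndM X Y ≫ eqToHom hY := by
  subst hX hY
  simp

/-- Since `tproj` stops at the first matching entry, `g` has to keep distinct indices distinct. -/
theorem tproj_map {ι κ : Type*} (V : ι → C) {g : κ → ι} (hg : Function.Injective g) (L : List κ)
    (e : tensorOver (fun i => V (g i)) L = tensorOver V (L.map g)) (i : κ) (h : i ∈ L) :
    eqToHom e ≫ tproj V (L.map g) (g i) (List.mem_map_of_mem h) =
      tproj (fun i => V (g i)) L i h := by
  induction L with
  | nil => exact absurd h List.not_mem_nil
  | cons a L ih =>
    have e' := (tensorOver_map V g L).symm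
    by_cases hi : i = a
    · subst hi
      rw [tproj_head]
      refine (congrArg _ (tproj_head (V := V) (g i) (L.map g) _)).trans ?_
      exact (eqToHom_fstM rfl e' e).trans (Category.comp_id _)
    · have h' := (List.mem_cons.1 h).resolve_left hi
      rw [tproj_tail hi h h', ← ih e' h']
      refine (congrArg _ (tproj_tail (V := V) (hg.ne hi) _ (List.mem_map_of_mem h'))).trans ?_
      refine (Category.assoc _ _ _).symm.trans ?_
      exact (congrArg (· ≫ tproj V (L.map g) (g i) _) (eqToHom_sndM rfl e' e)).trans
        (Category.assoc _ _ _)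

end EqToHom

/-! ### Projections and products in the image of a strict Markov functor. -/

namespace IsStrictMarkov

open FreeMarkov

theorem single_ty {S : BoxHypergraph.{u}} {s : S.Wire} (j : Fin (single s).len) :
    (single s).ty j = s := rfl

/-- The index of the only entry. -/
def idxSingle {S : BoxHypergraph.{u}} {s : S.Wire} : Fin (single s).len := (0 : Fin 1)

theorem eq_idxSingle {S : BoxHypergraph.{u}} {s : S.Wire} (i : Fin (single s).len) :
    i = idxSingle := Subsingleton.elim (α := Fin 1) i 0

section Proj

variable {S : BoxHypergraph.{u}} {C : Type w} [Category.{v} C] (F : FreeMarkov S ⥤ C)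
  {σ τ : FreeMarkov S}

/-- The projections of the image of an object to the images of its entries. -/
def proj (σ : FreeMarkov S) (i : Fin σ.len) {s : S.Wire} (h : σ.ty i = s) :
    F.obj σ ⟶ F.obj (single s) :=
  F.map (wire σ (single s) (fun _ => i) (fun j => h.trans (single_ty j).symm))

theorem proj_congr {i j : Fin σ.len} (e : i = j) {s : S.Wire} (h : σ.ty i = s)
    (h' : σ.ty j = s) : proj F σ i h = proj F σ j h' := by
  subst e
  rfl

theorem map_wire_proj (r : Fin τ.len → Fin σ.len) (hr : ∀ j, σ.ty (r j) = τ.ty j) (j : Fin τ.len)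
    {s : S.Wire} (h : τ.ty j = s) :
    F.map (wire σ τ r hr) ≫ proj F τ j h = proj F σ (r j) ((hr j).trans h) := by
  rw [proj, ← F.map_comp, wire_comp (hr := hr)]
  rfl

theorem proj_eqToHom (i : Fin σ.len) {s s' : S.Wire} (h : σ.ty i = s) (e : s = s')
    (e' : F.obj (single s) = F.obj (single s')) :
    proj F σ i h ≫ eqToHom e' = proj F σ i (h.trans e) := by
  subst e
  rw [eqToHom_refl, Category.comp_id]

theorem eqToHom_proj (e : σ = τ) (e' : F.obj σ = F.obj τ) (i : Fin τ.len) {s : S.Wire}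
    (h : τ.ty i = s) : eqToHom e' ≫ proj F τ i h =
      proj F σ (i.cast (e ▸ rfl)) ((ty_cast e i).trans h) := by
  subst e
  rw [eqToHom_refl, Category.id_comp]
  rfl

theorem proj_single {s s' : S.Wire} (i : Fin (single s).len) (h : (single s).ty i = s')
    (e : F.obj (single s) = F.obj (single s')) : proj F (single s) i h = eqToHom e := by
  obtain rfl : s = s' := (single_ty i).symm.trans h
  have e : wire (single s) (single s) (fun _ => i) (fun j => single_ty j) =
      wire (single s) (single s) (fun j => j) (fun _ => rfl) :=
    wire_congr (funext fun j => (eq_idxSingle i).trans (eq_idxSingle j).symm) _ _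
  exact (congrArg F.map e).trans (F.map_id _)

end Proj

variable {S : BoxHypergraph.{u}} {C : Type w} [Category.{v} C] [MonoidalCategory C]
  [MarkovCategory C] {F : FreeMarkov S ⥤ C} {σ τ υ χ : FreeMarkov S}

/-- Box-free diagrams commute with copying already in the free category, and `F` preserves copying
up to transports that cancel. -/
theorem det_map_wire (hF : IsStrictMarkov F) (r : Fin τ.len → Fin σ.len)
    (hr : ∀ j, σ.ty (r j) = τ.ty j) : Det (F.map (wire σ τ r hr)) := ⟨by
  have h := congrArg F.map (wire_comp_copy r hr)
  rw [F.map_comp, F.map_comp, hF.map_copy, hF.map_copy, hF.map_tensor] at h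
  simp only [Category.assoc, eqToHom_trans_assoc, eqToHom_refl, Category.id_comp] at h
  simpa only [← Category.assoc, cancel_mono] using h⟩

/-- The comparison of tensor products. -/
def μ (hF : IsStrictMarkov F) (σ τ : FreeMarkov S) : F.obj (σ.tensor τ) ⟶ F.obj σ ⊗ F.obj τ :=
  eqToHom (hF.obj_tensor σ τ)

/-- The comparison of tensor products in the other direction. -/
def δ (hF : IsStrictMarkov F) (σ τ : FreeMarkov S) : F.obj σ ⊗ F.obj τ ⟶ F.obj (σ.tensor τ) :=
  eqToHom (hF.obj_tensor σ τ).symm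

instance (hF : IsStrictMarkov F) (σ τ : FreeMarkov S) : Det (hF.μ σ τ) := det_eqToHom _

instance (hF : IsStrictMarkov F) (σ τ : FreeMarkov S) : Det (hF.δ σ τ) := det_eqToHom _

instance (hF : IsStrictMarkov F) (σ τ : FreeMarkov S) : Mono (hF.μ σ τ) :=
  inferInstanceAs (Mono (eqToHom _))

theorem δ_μ (hF : IsStrictMarkov F) (σ τ : FreeMarkov S) : hF.δ σ τ ≫ hF.μ σ τ = 𝟙 _ := by
  simp [μ, δ]

theorem map_tensor' (hF : IsStrictMarkov F) (f : σ ⟶ τ) (g : υ ⟶ χ) :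
    F.map (tensorHom f g) = hF.μ σ υ ≫ (F.map f ⊗ₘ F.map g) ≫ hF.δ τ χ := hF.map_tensor f g

/-- Strictness of `C` enters here: the right unitor in `fstM` is a transport and can be matched with
the image of the strict unit law of the free category. -/
theorem μ_fstM [StrictMonoidal C] (hF : IsStrictMarkov F) (σ τ : FreeMarkov S) :
    hF.μ σ τ ≫ fstM _ _ = F.map (wire _ _ (idxL σ τ) tensor_ty_idxL) := by
  rw [← tensorHom_id_del, F.map_comp, hF.map_tensor', F.map_id, hF.map_del, eqToHom_map, fstM,
    StrictMonoidal.rightUnitor_eq, id_tensorHom, MonoidalCategory.whiskerLeft_comp,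
    whiskerLeft_eqToHom', δ]
  simp only [Category.assoc, eqToHom_trans]

theorem μ_sndM [StrictMonoidal C] (hF : IsStrictMarkov F) (σ τ : FreeMarkov S) :
    hF.μ σ τ ≫ sndM _ _ = F.map (wire _ _ (idxR σ τ) tensor_ty_idxR) := by
  rw [← tensorHom_del_id, F.map_comp, hF.map_tensor', F.map_id, hF.map_del, eqToHom_map, sndM,
    StrictMonoidal.leftUnitor_eq, tensorHom_id, MonoidalCategory.comp_whiskerRight,
    eqToHom_whiskerRight', δ]
  simp only [Category.assoc, eqToHom_trans]

theorem det_proj (hF : IsStrictMarkov F) (i : Fin σ.len) {s : S.Wire} (h : σ.ty i = s) :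
    Det (proj F σ i h) := hF.det_map_wire _ _

theorem μ_fstM_proj [StrictMonoidal C] (hF : IsStrictMarkov F) (i : Fin σ.len) {s : S.Wire}
    (h : σ.ty i = s) (h' : (σ.tensor τ).ty (idxL σ τ i) = s) :
    hF.μ σ τ ≫ fstM _ _ ≫ proj F σ i h = proj F (σ.tensor τ) (idxL σ τ i) h' := by
  rw [← Category.assoc, μ_fstM, map_wire_proj]

theorem μ_sndM_proj [StrictMonoidal C] (hF : IsStrictMarkov F) (i : Fin τ.len) {s : S.Wire}
    (h : τ.ty i = s) (h' : (σ.tensor τ).ty (idxR σ τ i) = s) :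
    hF.μ σ τ ≫ sndM _ _ ≫ proj F τ i h = proj F (σ.tensor τ) (idxR σ τ i) h' := by
  rw [← Category.assoc, μ_sndM, map_wire_proj]

theorem δ_proj_idxL [StrictMonoidal C] (hF : IsStrictMarkov F) (i : Fin σ.len) {s : S.Wire}
    (h : (σ.tensor τ).ty (idxL σ τ i) = s) :
    hF.δ σ τ ≫ proj F (σ.tensor τ) (idxL σ τ i) h =
      fstM _ _ ≫ proj F σ i ((tensor_ty_idxL i).symm.trans h) := by
  rw [← hF.μ_fstM_proj, ← Category.assoc, δ_μ, Category.id_comp]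

theorem δ_proj_idxR [StrictMonoidal C] (hF : IsStrictMarkov F) (i : Fin τ.len) {s : S.Wire}
    (h : (σ.tensor τ).ty (idxR σ τ i) = s) :
    hF.δ σ τ ≫ proj F (σ.tensor τ) (idxR σ τ i) h =
      sndM _ _ ≫ proj F τ i ((tensor_ty_idxR i).symm.trans h) := by
  rw [← hF.μ_sndM_proj, ← Category.assoc, δ_μ, Category.id_comp]

/-- The image of an object is the product of the images of its entries. -/
theorem isDetProd_obj [StrictMonoidal C] (hF : IsStrictMarkov F) (σ : FreeMarkov S) :
    IsDetProd (fun i : Fin σ.len => F.obj (single (σ.ty i))) Set.univ (F.obj σ)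
      (fun i _ => proj F σ i rfl) := by
  obtain ⟨n, t⟩ := σ
  induction n with
  | zero =>
    have e : (⟨0, t⟩ : FreeMarkov S) = FreeMarkov.unit S := by
      rw [FreeMarkov.unit, Subsingleton.elim t Fin.elim0]
    have e' : F.obj ⟨0, t⟩ = 𝟙_ C := (congrArg F.obj e).trans hF.obj_unit
    refine ⟨fun i => i.elim0, fun Q _ _ => ⟨ε[Q] ≫ eqToHom e'.symm, inferInstance,
      fun i => i.elim0⟩, fun Q c c' _ _ _ => ?_⟩
    rw [← cancel_mono (eqToHom e')]
    exact Subsingleton.elim _ _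
  | succ n ih =>
    have := fun σ i s h => hF.det_proj (σ := σ) i (s := s) h
    rw [cons_eq_tensor t]
    specialize ih (fun i => t i.succ)
    -- From here on the argument is that of `IsDetProd.union` for a one-element sequence and `τ`,
    -- with `idx_cases` splitting the indices.
    generalize (⟨n, fun i => t i.succ⟩ : FreeMarkov S) = τ at *
    refine ⟨fun i _ => hF.det_proj _ _, fun Q e he => ?_, fun Q c c' hc hc' h => ?_⟩
    · obtain ⟨d, hd, hd'⟩ := ih.exists_lift Q
        (fun i _ => e (idxR _ _ i) trivial ≫ eqToHom (by rw [tensor_ty_idxR]))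
        fun i _ => by
          have := he (idxR _ _ i) trivial
          infer_instance
      have h0 := he (idxL (single (t 0)) τ idxSingle) trivial
      let a : Q ⟶ F.obj (single (t 0)) :=
        e (idxL (single (t 0)) τ idxSingle) trivial ≫ eqToHom (by rw [tensor_ty_idxL, single_ty])
      refine ⟨pair a d ≫ hF.δ _ _, inferInstance, fun i => ?_⟩
      revert i
      refine idx_cases (fun i => ?_) (fun i => ?_)
      · obtain rfl := eq_idxSingle i
        intro _
        rw [Category.assoc, δ_proj_idxL, pair_fst_assoc]
        have ht : t 0 = ((single (t 0)).tensor τ).ty (idxL _ _ idxSingle) := by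
          rw [tensor_ty_idxL, single_ty]
        rw [proj_single _ _ _ (congrArg (fun s => F.obj (single s)) ht)]
        simp [a]
      · intro _
        rw [Category.assoc, δ_proj_idxR, pair_snd_assoc]
        have h : τ.ty i = ((single (t 0)).tensor τ).ty (idxR _ _ i) := (tensor_ty_idxR i).symm
        rw [← proj_eqToHom F i rfl h (by rw [h]), ← Category.assoc, hd' i trivial]
        simp
    · have h' : ∀ i s (e : ((single (t 0)).tensor τ).ty i = s),
          c ≫ proj F _ i e = c' ≫ proj F _ i e := by
        rintro i _ rfl
        exact h i trivial
      rw [← cancel_mono (hF.μ _ _)]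
      refine det_ext ?_ (ih.hom_ext _ _ _ inferInstance inferInstance fun i _ => ?_)
      · have h0 := h' (idxL (single (t 0)) τ idxSingle) (t 0) ((tensor_ty_idxL _).trans (single_ty _))
        rw [← hF.μ_fstM_proj (σ := single (t 0)) idxSingle (single_ty _), proj_single _ _ _ rfl,
          eqToHom_refl, Category.comp_id] at h0
        simpa only [Category.assoc] using h0
      · have h0 := h' (idxR (single (t 0)) τ i) _ (tensor_ty_idxR _)
        rw [← hF.μ_sndM_proj i rfl] at h0
        simpa only [Category.assoc] using h0

/-- The image of a sequence is a product in two ways, through images of wirings and through the list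
of its factors. Their agreement links the marginals taken in `C` with those taken in the free
category. -/
theorem eqToHom_tproj_finRange [StrictMonoidal C] (hF : IsStrictMarkov F) {n : ℕ}
    (t : Fin n → S.Wire)
    (e : F.obj ⟨n, t⟩ = tensorFin (fun i => F.obj (single (t i)))) (i : Fin n) :
    eqToHom e ≫ tproj (fun i => F.obj (single (t i))) (List.finRange n) i (List.mem_finRange i) =
      proj F ⟨n, t⟩ i rfl := by
  induction n with
  | zero => exact i.elim0
  | succ n ih =>
    let V : Fin (n + 1) → C := fun i => F.obj (single (t i))
    let τ : FreeMarkov S := ⟨n, fun i => t i.succ⟩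
    have e0 : F.obj τ = tensorFin (fun i => V i.succ) := hF.obj_eq τ
    have hc : (⟨n + 1, t⟩ : FreeMarkov S) = (single (t 0)).tensor τ := cons_eq_tensor t
    have e1 : F.obj ⟨n + 1, t⟩ = F.obj (single (t 0)) ⊗ F.obj τ :=
      (congrArg F.obj hc).trans (hF.obj_tensor _ _)
    have eL : 0 :: (List.finRange n).map Fin.succ = List.finRange (n + 1) :=
      List.finRange_succ.symm
    have e2 : F.obj (single (t 0)) ⊗ F.obj τ =
        tensorOver V (0 :: (List.finRange n).map Fin.succ) := by
      rw [tensorOver, tensorOver_map, e0]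
    have e3 := congrArg (tensorOver V) eL
    -- Parallel transports coincide, so `e` may be routed through head and tail, where the induction
    -- hypothesis applies.
    have he : eqToHom e = eqToHom (congrArg F.obj hc) ≫ hF.μ (single (t 0)) τ ≫ eqToHom e2 ≫
        eqToHom e3 := by
      simp [μ]
    rw [he, Category.assoc, Category.assoc, Category.assoc, eqToHom_tproj eL e3]
    refine Fin.cases ?_ (fun i => ?_) i
    · have h1 : eqToHom e2 ≫ tproj V (0 :: (List.finRange n).map Fin.succ) 0 List.mem_cons_self =
          fstM _ _ := by
        rw [tproj_head]
        exact (eqToHom_fstM rfl (e0.trans (tensorOver_map V Fin.succ _).symm) e2).trans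
          (Category.comp_id _)
      have h2 : hF.μ (single (t 0)) τ ≫ fstM _ _ =
          proj F _ (idxL (single (t 0)) τ idxSingle) ((tensor_ty_idxL _).trans (single_ty _)) := by
        rw [μ_fstM]
        exact congrArg F.map (wire_congr (funext fun j => congrArg _ (eq_idxSingle j)) _ _)
      rw [h1, h2]
      exact (eqToHom_proj F hc _ _ _).trans (proj_congr F rfl _ _)
    · have h1 : eqToHom e2 ≫ tproj V (0 :: (List.finRange n).map Fin.succ) i.succ
          (List.mem_cons_of_mem _ (List.mem_map_of_mem (List.mem_finRange i))) =
          sndM _ _ ≫ proj F τ i rfl := by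
        rw [tproj_tail (Fin.succ_ne_zero i) _ (List.mem_map_of_mem (List.mem_finRange i)),
          ← ih _ e0 i, ← tproj_map V (Fin.succ_injective n) _ (tensorOver_map V _ _).symm i
            (List.mem_finRange i), ← Category.assoc]
        refine (congrArg (· ≫ tproj V _ i.succ _) (eqToHom_sndM rfl
          (e0.trans (tensorOver_map V Fin.succ _).symm) e2)).trans ?_
        simp only [Category.assoc, eqToHom_trans_assoc]
      have h2 := tensor_ty_idxR (σ := single (t 0)) (τ := τ) i
      rw [h1, hF.μ_sndM_proj (σ := single (t 0)) (τ := τ) i rfl h2]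
      refine (eqToHom_proj F hc _ _ _).trans ?_
      -- A tail entry has index `1 + i` in the concatenation and `i + 1` in the given sequence.
      exact proj_congr F (Fin.ext (Nat.add_comm 1 i)) _ _

end IsStrictMarkov

end CausalModels

end

noncomputable section

namespace CausalModels

/-! ### Adding a box to an initial part of a string diagram -/

namespace Diagram

open FreeMarkov

variable {S : BoxHypergraph.{u}} {σ τ υ : FreeMarkov S} (φ : Diagram S σ τ)

/-- The wires that are global inputs or outputs of a box in `B`. -/
def generated (B : Set φ.G.Edge) : Set φ.G.Wire :=
  {a | (∃ i, φ.p i = a) ∨ ∃ e ∈ B, ∃ j, φ.G.out e.2.2 j = a}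

/-- The inputs of the boxes in `B` are global inputs or outputs of a box in `B`. -/
def IsInitial (B : Set φ.G.Edge) : Prop := ∀ e ∈ B, ∀ i, φ.G.inp e.2.2 i ∈ φ.generated B

/-- The hypergraph of an initial part of a string diagram. -/
def initialGraph {B : Set φ.G.Edge} (hB : φ.IsInitial B) : BoxHypergraph.{u} where
  Wire := {a : φ.G.Wire // a ∈ φ.generated B}
  Box k l := {b : φ.G.Box k l // (⟨k, l, b⟩ : φ.G.Edge) ∈ B}
  inp b i := ⟨φ.G.inp b.1 i, hB _ b.2 i⟩
  out b j := ⟨φ.G.out b.1 j, Or.inr ⟨_, b.2, j, rfl⟩⟩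

/-- The inclusion of an initial part. -/
def initialIncl {B : Set φ.G.Edge} (hB : φ.IsInitial B) : HypHom (φ.initialGraph hB) φ.G where
  wire a := a.1
  box b := b.1
  inp_box _ _ := rfl
  out_box _ _ := rfl

/-- An initial part of a string diagram with new outputs. -/
def initialPart {B : Set φ.G.Edge} (hB : φ.IsInitial B) (υ : FreeMarkov S)
    (q : Fin υ.len → φ.G.Wire) (hq : ∀ j, φ.type.wire (q j) = υ.ty j)
    (hqB : ∀ j, q j ∈ φ.generated B) : Diagram S σ υ where
  G := φ.initialGraph hB
  finite_wire := by
    have := φ.finite_wire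
    exact Subtype.finite
  finite_edge := by
    have := φ.finite_edge
    refine Finite.of_injective
      (fun e : (φ.initialGraph hB).Edge => (⟨e.1, e.2.1, e.2.2.1⟩ : φ.G.Edge)) ?_
    rintro ⟨k, l, b, hb⟩ ⟨k', l', b', hb'⟩ e
    obtain rfl : k = k' := congrArg (fun o => o.1) e
    have e3 := eq_of_heq (Sigma.mk.inj e).2
    obtain rfl : l = l' := congrArg (fun o => o.1) e3
    obtain rfl := eq_of_heq (Sigma.mk.inj e3).2
    rfl
  type := (φ.initialIncl hB).comp φ.type
  p i := ⟨φ.p i, Or.inl ⟨i, rfl⟩⟩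
  type_p := φ.type_p
  q j := ⟨q j, hqB j⟩
  type_q := hq
  acyclic := acyclic_of_hom (φ.initialIncl hB) φ.acyclic
  left_monogamous := by
    apply bijective_source
    · intro i j h
      exact φ.p_injective (congrArg Subtype.val h)
    · rintro ⟨k, l, ⟨b, hb⟩, j⟩ ⟨k', l', ⟨b', hb'⟩, j'⟩ e
      have e2 := φ.portWire_injective (a₁ := ⟨k, l, b, j⟩) (a₂ := ⟨k', l', b', j'⟩)
        (congrArg Subtype.val e)
      obtain rfl : k = k' := congrArg (fun o => o.1) e2
      have e3 := eq_of_heq (Sigma.mk.inj e2).2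
      obtain rfl : l = l' := congrArg (fun o => o.1) e3
      have e4 := eq_of_heq (Sigma.mk.inj e3).2
      obtain ⟨rfl, e6⟩ := Sigma.mk.inj e4
      rw [eq_of_heq e6]
    · intro i k l b j h
      exact φ.p_ne_out i b.1 j (congrArg Subtype.val h)
    · rintro ⟨a, ⟨i, rfl⟩ | ⟨⟨k, l, b⟩, he, j, rfl⟩⟩
      · exact Or.inl ⟨i, rfl⟩
      · exact Or.inr ⟨k, l, ⟨b, he⟩, j, rfl⟩

/-- Boxes outside `B` cannot influence wires generated by `B`, so normalization discards them. -/
theorem cls_initialPart {B : Set φ.G.Edge} (hB : φ.IsInitial B) (υ : FreeMarkov S)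
    (q : Fin υ.len → φ.G.Wire) (hq : ∀ j, φ.type.wire (q j) = υ.ty j)
    (hqB : ∀ j, q j ∈ φ.generated B) :
    (φ.initialPart hB υ q hq hqB).cls = (φ.withOutputs υ q hq).cls :=
  cls_eq_of_box_injective
    { φ.initialIncl hB with
      type_wire := fun _ => rfl
      type_box := fun _ => rfl
      wire_p := fun _ => rfl
      wire_q := fun _ => rfl } fun _ _ => Subtype.val_injective

/-- The family of boxes with a single member. -/
inductive OneBox (k l : ℕ) : ℕ → ℕ → Type u
  | mk : OneBox k l k l

/-- The position of an input of the single box. -/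
def OneBox.inp {k l : ℕ} : {k' l' : ℕ} → OneBox.{u} k l k' l' → Fin k' → Fin k
  | _, _, .mk, i => i

/-- The position of an output of the single box. -/
def OneBox.out {k l : ℕ} : {k' l' : ℕ} → OneBox.{u} k l k' l' → Fin l' → Fin l
  | _, _, .mk, j => j

/-- Maps from the family of boxes with a single member. -/
def OneBox.desc {k l : ℕ} {P : ℕ → ℕ → Type u} (x : P k l) :
    {k' l' : ℕ} → OneBox.{u} k l k' l' → P k' l'
  | _, _, .mk => x

/-- The types of the inputs of a box. -/
def inpType (e : φ.G.Edge) : FreeMarkov S := ⟨e.1, fun i => φ.type.wire (φ.G.inp e.2.2 i)⟩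

/-- The types of the outputs of a box. -/
def outType (e : φ.G.Edge) : FreeMarkov S := ⟨e.2.1, fun i => φ.type.wire (φ.G.out e.2.2 i)⟩

/-- The input wires of a box. -/
def inpWire (e : φ.G.Edge) : Fin (φ.inpType e).len → φ.G.Wire := φ.G.inp e.2.2

/-- The output wires of a box. -/
def outWire (e : φ.G.Edge) : Fin (φ.outType e).len → φ.G.Wire := φ.G.out e.2.2

theorem type_inpWire (e : φ.G.Edge) (i : Fin (φ.inpType e).len) :
    φ.type.wire (φ.inpWire e i) = (φ.inpType e).ty i := rfl

theorem type_outWire (e : φ.G.Edge) (i : Fin (φ.outType e).len) :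
    φ.type.wire (φ.outWire e i) = (φ.outType e).ty i := rfl

/-- The hypergraph with a single box and distinct wires. -/
def oneBoxGraph (k l : ℕ) : BoxHypergraph.{u} where
  Wire := ULift.{u} (Fin k) ⊕ ULift.{u} (Fin l)
  Box := OneBox k l
  inp b i := Sum.inl ⟨b.inp i⟩
  out b j := Sum.inr ⟨b.out j⟩

/-- The map from a single box with distinct wires to a hypergraph. -/
def oneBoxHom {G : BoxHypergraph.{u}} (e : G.Edge) : HypHom (oneBoxGraph e.1 e.2.1) G where
  wire := Sum.elim (fun i => G.inp e.2.2 i.down) (fun j => G.out e.2.2 j.down)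
  box := OneBox.desc e.2.2
  inp_box := by
    rintro _ _ ⟨⟩ i
    rfl
  out_box := by
    rintro _ _ ⟨⟩ j
    rfl

/-- The string diagram of a single box. -/
def boxDiagram (e : φ.G.Edge) : Diagram S (φ.inpType e) (φ.outType e) where
  G := oneBoxGraph e.1 e.2.1
  finite_wire := inferInstanceAs (Finite (ULift.{u} (Fin e.1) ⊕ ULift.{u} (Fin e.2.1)))
  finite_edge := Finite.of_injective (β := Fin 1) (fun _ => 0) (by
    rintro ⟨_, _, ⟨⟩⟩ ⟨_, _, ⟨⟩⟩ _
    rfl)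
  type := (oneBoxHom e).comp φ.type
  p i := Sum.inl ⟨i⟩
  type_p _ := rfl
  q j := Sum.inr ⟨j⟩
  type_q _ := rfl
  acyclic := by
    have h : ∀ a b, (oneBoxGraph e.1 e.2.1).Step a b → a.isLeft ∧ b.isRight := by
      rintro a b ⟨_, _, ⟨⟩, ⟨i, rfl⟩, j, rfl⟩
      exact ⟨rfl, rfl⟩
    have h' : ∀ a b, Relation.TransGen (oneBoxGraph e.1 e.2.1).Step a b →
        a.isLeft ∧ b.isRight := by
      intro a b hab
      induction hab with
      | single hs => exact h _ _ hs
      | tail _ hs ih => exact ⟨ih.1, (h _ _ hs).2⟩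
    intro a ha
    have := h' a a ha
    cases a <;> simp at this
  left_monogamous := by
    apply bijective_source
    · intro i j h
      exact congrArg ULift.down (Sum.inl_injective h)
    · rintro ⟨_, _, ⟨⟩, j⟩ ⟨_, _, ⟨⟩, j'⟩ h
      obtain rfl : j = j' := congrArg ULift.down (Sum.inr_injective h)
      rfl
    · rintro i _ _ ⟨⟩ j h
      exact absurd h (by simp [oneBoxGraph])
    · rintro (a | a)
      · exact Or.inl ⟨a.down, rfl⟩
      · exact Or.inr ⟨_, _, .mk, a.down, rfl⟩

theorem type_idxElim {υ υ' : FreeMarkov S} {q : Fin υ.len → φ.G.Wire} {q' : Fin υ'.len → φ.G.Wire}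
    (hq : ∀ j, φ.type.wire (q j) = υ.ty j) (hq' : ∀ j, φ.type.wire (q' j) = υ'.ty j) :
    ∀ j, φ.type.wire (idxElim q q' j) = (υ.tensor υ').ty j :=
  idx_cases (fun j => by rw [idxElim_idxL, tensor_ty_idxL, hq])
    (fun j => by rw [idxElim_idxR, tensor_ty_idxR, hq'])

/-- The outputs of a box and the wires of an initial part are obtained by applying the box to
the initial part. -/
theorem cls_add_box {B : Set φ.G.Edge} (hB : φ.IsInitial B) (e : φ.G.Edge) (he : e ∉ B)
    (heB : ∀ i, φ.inpWire e i ∈ φ.generated B) (q : Fin υ.len → φ.G.Wire)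
    (hq : ∀ j, φ.type.wire (q j) = υ.ty j) (hqB : ∀ j, q j ∈ φ.generated B) :
    (φ.withOutputs ((φ.outType e).tensor υ) (idxElim (φ.outWire e) q)
      (φ.type_idxElim (φ.type_outWire e) hq)).cls =
    (φ.withOutputs ((φ.inpType e).tensor υ) (idxElim (φ.inpWire e) q)
      (φ.type_idxElim (φ.type_inpWire e) hq)).cls ≫
      FreeMarkov.tensorHom (φ.boxDiagram e).cls (𝟙 υ) := by
  have hid : (𝟙 υ : υ ⟶ υ) = (idDiagram υ).cls := toHom_eq_cls _ (wiring_normalized _ _ _ _)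
  have hw : ∀ j, idxElim (φ.inpWire e) q j ∈ φ.generated B :=
    idx_cases (fun j => by rw [idxElim_idxL]; exact heB j)
      (fun j => by rw [idxElim_idxR]; exact hqB j)
  -- Cutting `φ` down to the initial part removes `e`. Gluing on the whole of `φ` could duplicate
  -- `e`, and the comparison with `φ` would not be injective on boxes.
  rw [hid, ← cls_tensor, ← cls_initialPart φ hB _ _ _ hw, ← cls_comp]
  let θ : Diagram S ((φ.inpType e).tensor υ) ((φ.outType e).tensor υ) :=
    tensor (φ.boxDiagram e) (idDiagram υ)
  let θ' : Diagram S σ ((φ.inpType e).tensor υ) :=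
    φ.initialPart hB ((φ.inpType e).tensor υ) (idxElim (φ.inpWire e) q)
      (φ.type_idxElim (φ.type_inpWire e) hq) hw
  let g : HypHom (sumGraph (oneBoxGraph e.1 e.2.1) (idDiagram υ).G) φ.G :=
    { wire := Sum.elim (oneBoxHom e).wire (fun a => q a.down)
      box := fun b => Sum.elim (oneBoxHom e).box (fun b => b.elim) b
      inp_box := by
        rintro k l (b | b) i
        · exact (oneBoxHom e).inp_box b i
        · exact b.elim
      out_box := by
        rintro k l (b | b) i
        · exact (oneBoxHom e).out_box b i
        · exact b.elim }
  have h : ∀ i, (φ.initialIncl hB).wire (θ'.q i) = g.wire (θ.p i) :=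
    idx_cases
      (fun j => (idxElim_idxL _ _ j).trans
        (congrArg g.wire (appendSum_left (φ.boxDiagram e).p (idDiagram υ).p j)).symm)
      (fun j => (idxElim_idxR _ _ j).trans
        (congrArg g.wire (appendSum_right (φ.boxDiagram e).p (idDiagram υ).p j)).symm)
  refine (cls_eq_of_box_injective (φ := comp θ' θ)
    (ψ := φ.withOutputs ((φ.outType e).tensor υ) (idxElim (φ.outWire e) q)
      (φ.type_idxElim (φ.type_outWire e) hq))
    { compDesc (φ := θ') (ψ := θ) (φ.initialIncl hB) g h with
      type_wire := ?_
      type_box := ?_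
      wire_p := fun _ => rfl
      wire_q := fun i => (compDesc_inr (φ := θ') (ψ := θ) (φ.initialIncl hB) g h (θ.q i)).trans
        (idx_cases (motive := fun i => g.wire (θ.q i) = idxElim (φ.outWire e) q i)
          (fun j => (congrArg g.wire (appendSum_left _ _ j)).trans (idxElim_idxL _ _ j).symm)
          (fun j => (congrArg g.wire (appendSum_right _ _ j)).trans (idxElim_idxR _ _ j).symm)
          i) } ?_).symm
  · rintro (a | ⟨a | a, -⟩)
    · rfl
    · rfl
    · exact hq a.down
  · rintro k l (b | b | b)
    · rfl
    · rfl
    · exact b.elim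
  -- The only possible collision is between the new box and a box of the initial part, and `he`
  -- excludes it.
  · rintro k l (b | b | b) (b' | b' | b') hb
    · exact congrArg Sum.inl (Subtype.ext hb)
    · cases b'
      have hb' : b.1 = e.2.2 := hb
      have h' := b.2
      rw [hb'] at h'
      exact absurd h' he
    · exact b'.elim
    · cases b
      have hb' : e.2.2 = b'.1 := hb
      have h' := b'.2
      rw [← hb'] at h'
      exact absurd h' he
    · cases b
      cases b'
      rfl
    · exact b'.elim
    · exact b.elim
    · exact b.elim
    · exact b.elim

end Diagram

end CausalModels

end

noncomputable section

namespace CausalModels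

/-! ### Simultaneous generation of the wires of a string diagram -/

namespace Diagram

open FreeMarkov IsStrictMarkov

variable {S : BoxHypergraph.{u}} {C : Type w} [Category.{v} C] (F : FreeMarkov S ⥤ C)
  {σ τ υ : FreeMarkov S} (φ : Diagram S σ τ)

/-- The value of a functor on the type of a wire. -/
abbrev wireObj (a : φ.G.Wire) : C := F.obj (single (φ.type.wire a))

variable {F φ} in
theorem comp_proj_eq_of_eq {Q : C} {B : Set φ.G.Edge}
    {π : ∀ a, a ∈ φ.generated B → (Q ⟶ wireObj F φ a)} {w : Fin υ.len → φ.G.Wire}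
    (hw : ∀ j, φ.type.wire (w j) = υ.ty j) {hB : ∀ j, w j ∈ φ.generated B} {d : Q ⟶ F.obj υ}
    (h : ∀ j, d ≫ proj F υ j (hw j).symm = π (w j) (hB j)) {j : Fin υ.len} {a : φ.G.Wire}
    (ha : w j = a) (h' : υ.ty j = φ.type.wire a) (haB : a ∈ φ.generated B) :
    d ≫ proj F υ j h' = π a haB := by
  subst ha
  exact h j

variable [MonoidalCategory C] [MarkovCategory C]

/-- The morphism `g` generates all wires in `generated B` simultaneously: the values of the wires are
deterministic functions `π` of the output of `g`. -/
structure Generates {B : Set φ.G.Edge} {T : C} (g : F.obj σ ⟶ T)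
    (π : ∀ a, a ∈ φ.generated B → (T ⟶ wireObj F φ a)) : Prop where
  det : ∀ a h, Det (π a h)
  map_cls : ∀ (υ : FreeMarkov S) (w : Fin υ.len → φ.G.Wire) (hw : ∀ j, φ.type.wire (w j) = υ.ty j)
    (hB : ∀ j, w j ∈ φ.generated B) (d : T ⟶ F.obj υ), Det d →
    (∀ j, d ≫ proj F υ j (hw j).symm = π (w j) (hB j)) →
    F.map (φ.withOutputs υ w hw).cls = g ≫ d

variable {F φ}

/-- Deterministic morphisms to the image of an object are determined by their components. -/
theorem obj_hom_ext [StrictMonoidal C] (hF : IsStrictMarkov F) {Q : C} {d d' : Q ⟶ F.obj υ}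
    (hd : Det d) (hd' : Det d')
    (h : ∀ j, ∃ (s : S.Wire) (hs : υ.ty j = s), d ≫ proj F υ j hs = d' ≫ proj F υ j hs) : d = d' :=
  (hF.isDetProd_obj υ).hom_ext Q d d' hd hd' fun j _ => by
    obtain ⟨_, rfl, h⟩ := h j
    exact h

/-- Deterministic morphisms to the image of an object can be given by their components. -/
theorem exists_obj_lift [StrictMonoidal C] (hF : IsStrictMarkov F) {Q : C}
    (w : Fin υ.len → φ.G.Wire) (hw : ∀ j, φ.type.wire (w j) = υ.ty j)
    (e : ∀ j, Q ⟶ wireObj F φ (w j)) (he : ∀ j, Det (e j)) :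
    ∃ d : Q ⟶ F.obj υ, Det d ∧ ∀ j, d ≫ proj F υ j (hw j).symm = e j := by
  have h : ∀ j, wireObj F φ (w j) = F.obj (single (υ.ty j)) := fun j =>
    congrArg (fun s => F.obj (single s)) (hw j)
  obtain ⟨d, hd, hd'⟩ := (hF.isDetProd_obj υ).exists_lift Q
    (fun j _ => e j ≫ eqToHom (h j)) fun j _ => inferInstance
  refine ⟨d, hd, fun j => ?_⟩
  rw [← proj_eqToHom F j rfl (hw j).symm (h j).symm, ← Category.assoc, hd' j trivial,
    Category.assoc, eqToHom_trans, eqToHom_refl, Category.comp_id]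

theorem generated_empty {a : φ.G.Wire} (h : a ∈ φ.generated ∅) : ∃ i, φ.p i = a := by
  rcases h with h | ⟨_, h, _⟩
  · exact h
  · exact h.elim

theorem cls_withOutputs_inputs (r : Fin υ.len → Fin σ.len) (w : Fin υ.len → φ.G.Wire)
    (h : ∀ j, φ.p (r j) = w j) (hw : ∀ j, φ.type.wire (w j) = υ.ty j)
    (hr : ∀ j, σ.ty (r j) = υ.ty j) :
    (φ.withOutputs υ w hw).cls = FreeMarkov.wire σ υ r hr := by
  rw [FreeMarkov.wire, toHom_eq_cls]
  exact (cls_eq_of_box_injective (φ := wiring σ υ r hr) (ψ := φ.withOutputs υ w hw)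
    { wire := fun a => φ.p a.down
      box := fun b => b.elim
      inp_box := fun b => b.elim
      out_box := fun b => b.elim
      type_wire := fun a => φ.type_p a.down
      type_box := fun b => b.elim
      wire_p := fun _ => rfl
      wire_q := h } fun k l b => b.elim).symm

theorem exists_generates_empty [StrictMonoidal C] (hF : IsStrictMarkov F) :
    ∃ π, Generates F φ (B := ∅) (𝟙 (F.obj σ)) π := by
  -- Agreement is demanded for every input index attached to `a`, so that the chosen morphism does
  -- not depend on the index; injectivity of `p` makes this possible.
  have h : ∀ a (_ : a ∈ φ.generated ∅), ∃ m : F.obj σ ⟶ wireObj F φ a, Det m ∧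
      ∀ i (hi : φ.p i = a), m = proj F σ i ((φ.type_p i).symm.trans (congrArg _ hi)) := by
    intro a ha
    obtain ⟨i, rfl⟩ := generated_empty ha
    refine ⟨_, hF.det_proj i (φ.type_p i).symm, fun j hj => ?_⟩
    obtain rfl := φ.p_injective hj
    rfl
  choose π hπ hπ' using h
  refine ⟨π, hπ, fun υ w hw hB d hd hdw => ?_⟩
  choose r hr using fun j => generated_empty (hB j)
  have hr' : ∀ j, σ.ty (r j) = υ.ty j := fun j => by rw [← φ.type_p, hr, hw]
  rw [cls_withOutputs_inputs r w hr hw hr', Category.id_comp]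
  refine obj_hom_ext hF (hF.det_map_wire _ _) hd fun j => ⟨_, (hw j).symm, ?_⟩
  rw [map_wire_proj, hdw, hπ' (w j) (hB j) (r j) (hr j)]

theorem generated_insert {B : Set φ.G.Edge} {e : φ.G.Edge} {a : φ.G.Wire} :
    a ∈ φ.generated (insert e B) ↔ a ∈ φ.generated B ∨ ∃ j, φ.outWire e j = a := by
  constructor
  · rintro (h | ⟨e', rfl | h, j⟩)
    · exact Or.inl (Or.inl h)
    · exact Or.inr j
    · exact Or.inl (Or.inr ⟨e', h, j⟩)
  · rintro ((h | ⟨e', h, j⟩) | j)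
    · exact Or.inl h
    · exact Or.inr ⟨e', Or.inr h, j⟩
    · exact Or.inr ⟨e, Or.inl rfl, j⟩

theorem outWire_injective (e : φ.G.Edge) : Function.Injective (φ.outWire e) := fun i j h => by
  have := φ.portWire_injective (a₁ := ⟨e.1, e.2.1, e.2.2, i⟩) (a₂ := ⟨e.1, e.2.1, e.2.2, j⟩) h
  have := eq_of_heq (Sigma.mk.inj (eq_of_heq (Sigma.mk.inj this).2)).2
  exact eq_of_heq (Sigma.mk.inj this).2

/-- Every wire has exactly one source, so the outputs of a new box are new. This makes the case
distinctions between old and new wires unambiguous. -/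
theorem outWire_notMem {B : Set φ.G.Edge} {e : φ.G.Edge} (he : e ∉ B)
    (j : Fin (φ.outType e).len) : φ.outWire e j ∉ φ.generated B := by
  rintro (⟨i, h⟩ | ⟨e', he', i, h⟩)
  · exact φ.p_ne_out i e.2.2 j h
  · have := φ.portWire_injective (a₁ := ⟨e'.1, e'.2.1, e'.2.2, i⟩)
      (a₂ := ⟨e.1, e.2.1, e.2.2, j⟩) h
    refine he ?_
    convert he' using 1
    exact (congrArg (fun o : φ.G.OutPort => (⟨o.1, o.2.1, o.2.2.1⟩ : φ.G.Edge)) this).symm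

/-- The types of the wires in `generated B`. -/
theorem exists_enumeration (B : Set φ.G.Edge) :
    ∃ (υ : FreeMarkov S) (w : Fin υ.len → φ.G.Wire), (∀ j, φ.type.wire (w j) = υ.ty j) ∧
      (∀ j, w j ∈ φ.generated B) ∧ ∀ a ∈ φ.generated B, ∃ j, w j = a := by
  have := φ.finite_wire
  obtain ⟨n, ⟨f⟩⟩ := Finite.exists_equiv_fin (φ.generated B)
  exact ⟨⟨n, fun j => φ.type.wire (f.symm j).1⟩, fun j => (f.symm j).1, fun _ => rfl,
    fun j => (f.symm j).2, fun a ha => ⟨f ⟨a, ha⟩, by simp⟩⟩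

/-- A box can be applied to wires that have been generated. -/
theorem Generates.add_box [StrictMonoidal C] (hF : IsStrictMarkov F) {B : Set φ.G.Edge}
    (hB : φ.IsInitial B) {e : φ.G.Edge} (he : e ∉ B)
    (heB : ∀ i, φ.inpWire e i ∈ φ.generated B) {T : C} {g : F.obj σ ⟶ T}
    {π : ∀ a, a ∈ φ.generated B → (T ⟶ wireObj F φ a)} (hg : Generates F φ g π)
    (d : T ⟶ F.obj (φ.inpType e)) (hd : Det d)
    (hdi : ∀ i, d ≫ proj F _ i (φ.type_inpWire e i).symm = π _ (heB i)) :
    ∃ π', Generates F φ (B := insert e B) (g ≫ pair (𝟙 T) (d ≫ F.map (φ.boxDiagram e).cls)) π' ∧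
      (∀ a h h', π' a h' = fstM _ _ ≫ π a h) ∧
      ∀ j h', π' (φ.outWire e j) h' = sndM _ _ ≫ proj F _ j (φ.type_outWire e j).symm := by
  have h : ∀ a (_ : a ∈ φ.generated (insert e B)),
      ∃ m : T ⊗ F.obj (φ.outType e) ⟶ wireObj F φ a, Det m ∧
        (∀ h, m = fstM _ _ ≫ π a h) ∧ ∀ j (hj : φ.outWire e j = a),
          m = sndM _ _ ≫ proj F _ j ((φ.type_outWire e j).symm.trans (congrArg _ hj)) := by
    intro a ha
    have := hg.det
    have := fun σ i s h => hF.det_proj (σ := σ) i (s := s) h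
    rcases generated_insert.1 ha with ha | ⟨j, rfl⟩
    · refine ⟨fstM _ _ ≫ π a ha, inferInstance, fun _ => rfl, ?_⟩
      rintro j rfl
      exact absurd ha (outWire_notMem he j)
    · refine ⟨sndM _ _ ≫ proj F _ j (φ.type_outWire e j).symm, inferInstance, fun h => absurd h (outWire_notMem he j),
        fun j' hj => ?_⟩
      obtain rfl := outWire_injective e hj
      rfl
  choose π' hπ' hl hr using h
  refine ⟨π', ⟨hπ', fun υ w hw hwB m hm hmw => ?_⟩, fun a h h' => hl a h' h,
    fun j h' => hr _ h' j rfl⟩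
  -- List all old wires once: any family of wires of the enlarged part is a reindexing of the
  -- outputs of `e` followed by this list.
  obtain ⟨χ, x, hx, hxB, hx'⟩ := exists_enumeration (φ := φ) B
  obtain ⟨c, hc, hcx⟩ := exists_obj_lift hF x hx (fun j => π _ (hxB j)) fun j => hg.det _ _
  have hwr : ∀ j, ∃ i, idxElim (φ.outWire e) x i = w j := fun j => by
    rcases generated_insert.1 (hwB j) with h | ⟨i, h⟩
    · obtain ⟨i, h⟩ := hx' _ h
      exact ⟨idxR _ _ i, (idxElim_idxR _ _ _).trans h⟩
    · exact ⟨idxL _ _ i, (idxElim_idxL _ _ _).trans h⟩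
  choose r hr' using hwr
  have hty := φ.type_idxElim (φ.type_outWire e) hx
  have hrty : ∀ j, ((φ.outType e).tensor χ).ty (r j) = υ.ty j := fun j => by
    rw [← hty, hr', hw]
  have hcls : (φ.withOutputs υ w hw).cls =
      (φ.withOutputs _ (idxElim (φ.outWire e) x) hty).cls ≫ FreeMarkov.wire _ _ r hrty := by
    rw [cls_comp_wire]
    obtain rfl : (fun j => idxElim (φ.outWire e) x (r j)) = w := funext hr'
    rfl
  have hwB' : ∀ j, idxElim (φ.inpWire e) x j ∈ φ.generated B :=
    idx_cases (fun j => by rw [idxElim_idxL]; exact heB j)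
      (fun j => by rw [idxElim_idxR]; exact hxB j)
  -- The inputs of `e` are prepended to `x` although they already occur there; repetitions are
  -- harmless as `d` and `c` are deterministic functions of the same `T`.
  have hin := hg.map_cls _ (idxElim (φ.inpWire e) x) (φ.type_idxElim (φ.type_inpWire e) hx) hwB'
    (pair d c ≫ hF.δ _ _) inferInstance
    (idx_cases
      (fun j => by
        rw [Category.assoc, δ_proj_idxL, pair_fst_assoc]
        exact comp_proj_eq_of_eq (B := B) (φ.type_inpWire e) hdi (idxElim_idxL _ _ j).symm _ _)
      (fun j => by
        rw [Category.assoc, δ_proj_idxR, pair_snd_assoc]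
        exact comp_proj_eq_of_eq (B := B) hx hcx (idxElim_idxR _ _ j).symm _ _))
  have hcomp : ∀ i a (_ : idxElim (φ.outWire e) x i = a) (h : a ∈ φ.generated (insert e B))
      (h' : ((φ.outType e).tensor χ).ty i = φ.type.wire a),
      (pair (sndM _ _) (fstM _ _ ≫ c) ≫ hF.δ _ _) ≫ proj F _ i h' = π' a h := by
    refine idx_cases (fun j a hi h h' => ?_) (fun j a hi h h' => ?_)
    · obtain rfl : φ.outWire e j = a := (idxElim_idxL _ _ j).symm.trans hi
      rw [Category.assoc, δ_proj_idxL, pair_fst_assoc]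
      exact (hr _ h j rfl).symm
    · obtain rfl : x j = a := (idxElim_idxR _ _ j).symm.trans hi
      rw [Category.assoc, δ_proj_idxR, pair_snd_assoc, Category.assoc, hcx, hl _ h (hxB j)]
  -- The given `m` is deterministic and hence determined by its components, so it can be replaced by
  -- an explicit composite.
  have hm' : m = pair (sndM _ _) (fstM _ _ ≫ c) ≫ hF.δ _ _ ≫
      F.map (FreeMarkov.wire _ _ r hrty) := by
    have := hF.det_map_wire r hrty
    refine obj_hom_ext hF hm inferInstance fun j => ⟨_, (hw j).symm, ?_⟩
    rw [hmw, Category.assoc, Category.assoc, map_wire_proj, ← Category.assoc]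
    exact (hcomp _ _ (hr' j) _ _).symm
  rw [hcls, φ.cls_add_box hB e he heB x hx hxB, F.map_comp, F.map_comp, hin, hF.map_tensor',
    F.map_id, hm']
  have h1 : ∀ {Q : C} (f : F.obj (φ.inpType e) ⊗ F.obj χ ⟶ Q),
      hF.δ _ _ ≫ hF.μ _ _ ≫ f = f := fun f => by rw [← Category.assoc, δ_μ, Category.id_comp]
  have h2 : pair (𝟙 T) (d ≫ F.map (φ.boxDiagram e).cls) ≫ pair (sndM _ _) (fstM _ _ ≫ c) =
      pair (d ≫ F.map (φ.boxDiagram e).cls) c := (pair_eq_graph' _ _).symm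
  simp only [Category.assoc, h1]
  rw [← Category.assoc (pair (𝟙 T) _), h2, ← Category.assoc (pair d c), pair_tensorHom,
    Category.comp_id]

end Diagram

end CausalModels

end

noncomputable section

namespace CausalModels

/-! ### Factorization into products. -/

section DetProd

variable {C : Type w} [Category.{v} C] [MonoidalCategory C] [MarkovCategory C] {ι : Type*}
  {V : ι → C} {s t : Set ι} {P Q U : C}

theorem IsDetProd.exists_factor {π : ∀ i, i ∈ s → (P ⟶ V i)} (hP : IsDetProd V s P π) (x : Q ⟶ P)
    [hx : Det x] (y : Q ⟶ U) [hy : Det y]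
    (h : ∀ i h, ∃ m : U ⟶ V i, Det m ∧ y ≫ m = x ≫ π i h) : ∃ c : U ⟶ P, Det c ∧ y ≫ c = x := by
  choose m hm hm' using h
  obtain ⟨c, hc, hc'⟩ := hP.exists_lift U m hm
  refine ⟨c, hc, hP.hom_ext _ _ _ inferInstance hx fun i hi => ?_⟩
  rw [Category.assoc, hc', hm']

theorem IsDetProd.of_set_eq {π : ∀ i, i ∈ s → (P ⟶ V i)} (hP : IsDetProd V s P π) (e : t = s) :
    IsDetProd V t P (fun i h => π i (e ▸ h)) := by
  subst e
  exact hP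

end DetProd

/-! ### Separated generation of the wires of a string diagram -/

namespace Diagram

open FreeMarkov IsStrictMarkov

variable {S : BoxHypergraph.{u}} {C : Type w} [Category.{v} C] [MonoidalCategory C]
  [MarkovCategory C] {F : FreeMarkov S ⥤ C} {σ τ : FreeMarkov S} {φ : Diagram S σ τ}

/-- The morphism `g` generates all wires in `generated B`, in such a way that the wires in `X` are
functions of `u`, the wires outside of `X` and `Z` are functions of `v`, the wires in `Z` form `z`,
and `u` and `v` are conditionally independent given `z`. -/
structure Splits (X Z : Set φ.G.Wire) {B : Set φ.G.Edge} {T U V W : C} (g : F.obj σ ⟶ T)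
    (π : ∀ a, a ∈ φ.generated B → (T ⟶ wireObj F φ a)) (u : T ⟶ U) (v : T ⟶ V) (z : T ⟶ W)
    (ζ : ∀ a, a ∈ φ.generated B ∩ Z → (W ⟶ wireObj F φ a)) : Prop where
  generates : Generates F φ g π
  det_u : Det u
  det_v : Det v
  det_z : Det z
  left : ∀ a h, a ∈ X → ∃ m : U ⟶ wireObj F φ a, Det m ∧ u ≫ m = π a h
  right : ∀ a h, a ∉ X → a ∉ Z → ∃ m : V ⟶ wireObj F φ a, Det m ∧ v ≫ m = π a h
  isDetProd : IsDetProd (wireObj F φ) (φ.generated B ∩ Z) W ζ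
  comp_ζ : ∀ a h, z ≫ ζ a h = π a h.1
  condIndep : CondIndep (g ≫ pair u (pair v z))

theorem exists_splits_empty [StrictMonoidal C] (hF : IsStrictMarkov F) {X : Set φ.G.Wire}
    (Z : Set φ.G.Wire) (hp : ∀ i, φ.p i ∉ X) :
    ∃ (T U V W : C) (g : F.obj σ ⟶ T) (π : ∀ a, a ∈ φ.generated ∅ → (T ⟶ wireObj F φ a)) (u : T ⟶ U)
      (v : T ⟶ V) (z : T ⟶ W) (ζ : _), Splits X Z g π u v z ζ := by
  have := φ.finite_wire
  obtain ⟨π, hπ⟩ := exists_generates_empty hF (φ := φ)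
  obtain ⟨W, ζ, hW⟩ := exists_isDetProd (wireObj F φ) (φ.generated ∅ ∩ Z).toFinite
  obtain ⟨z, hz, hz'⟩ := hW.exists_lift _ (fun a h => π a h.1) fun a h => hπ.det a h.1
  -- No global input lies in `X`, so `u` may be trivial and `v` may hold all inputs; independence
  -- from a trivial output is automatic.
  refine ⟨_, 𝟙_ C, _, W, 𝟙 _, π, ε[_], 𝟙 _, z, ζ, hπ, inferInstance, inferInstance, hz,
    fun a h hX => ?_, fun a h _ _ => ⟨π a h, hπ.det a h, Category.id_comp _⟩, hW, hz',
    (condIndep_iff _).2 ⟨pair (𝟙 _) z, ε[W], ?_⟩⟩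
  · obtain ⟨i, rfl⟩ := generated_empty h
    exact absurd hX (hp i)
  · rw [Category.id_comp, comp_pair, Category.comp_id]
    exact congrArg (pair · _) (Subsingleton.elim _ _)

theorem exists_outMap [StrictMonoidal C] (hF : IsStrictMarkov F) (e : φ.G.Edge)
    {R : Set φ.G.Wire} (hR : ∀ a ∈ R, ∃ j, φ.outWire e j = a) {P : C} {ρ : ∀ a, a ∈ R → (P ⟶ wireObj F φ a)}
    (hP : IsDetProd (wireObj F φ) R P ρ) :
    ∃ r : F.obj (φ.outType e) ⟶ P, Det r ∧ ∀ j h,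
      r ≫ ρ (φ.outWire e j) h = proj F _ j (φ.type_outWire e j).symm := by
  choose k hk using hR
  obtain ⟨r, hr, hr'⟩ := hP.exists_lift (F.obj (φ.outType e)) (fun a h => proj F _ (k a h)
    ((φ.type_outWire e (k a h)).symm.trans (congrArg _ (hk a h)))) fun a h => hF.det_proj _ _
  refine ⟨r, hr, fun j h => ?_⟩
  rw [hr']
  exact proj_congr F (outWire_injective e (hk _ h)) _ _

variable {X Z : Set φ.G.Wire} {B : Set φ.G.Edge} {T U V W : C} {g : F.obj σ ⟶ T}
  {π : ∀ a, a ∈ φ.generated B → (T ⟶ wireObj F φ a)} {u : T ⟶ U} {v : T ⟶ V} {z : T ⟶ W}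
  {ζ : ∀ a, a ∈ φ.generated B ∩ Z → (W ⟶ wireObj F φ a)}

theorem generated_insert_inter (B : Set φ.G.Edge) (e : φ.G.Edge) (Z : Set φ.G.Wire) :
    φ.generated (insert e B) ∩ Z = (φ.generated B ∩ Z) ∪ {a | (∃ j, φ.outWire e j = a) ∧ a ∈ Z} := by
  ext a
  rw [Set.mem_inter_iff, generated_insert]
  exact or_and_right

/-- The product of the wires in `Z` is extended by the outputs of a box in `Z`. -/
theorem Splits.exists_extension [StrictMonoidal C] (hF : IsStrictMarkov F)
    (hs : Splits X Z g π u v z ζ) {e : φ.G.Edge} (he : e ∉ B)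
    {π' : ∀ a, a ∈ φ.generated (insert e B) → (T ⊗ F.obj (φ.outType e) ⟶ wireObj F φ a)}
    (hl : ∀ a h h', π' a h' = fstM _ _ ≫ π a h)
    (hr : ∀ j h', π' (φ.outWire e j) h' = sndM _ _ ≫ proj F _ j (φ.type_outWire e j).symm) :
    ∃ (P : C) (r : F.obj (φ.outType e) ⟶ P) (ζ' : _), Det r ∧
      IsDetProd (wireObj F φ) (φ.generated (insert e B) ∩ Z) (W ⊗ P) ζ' ∧
      ∀ a h, pair (fstM _ _ ≫ z) (sndM _ _ ≫ r) ≫ ζ' a h = π' a h.1 := by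
  have := φ.finite_wire
  -- `P` is the product of the outputs of `e` that lie in `Z`, and `r` below selects them among all
  -- outputs of `e`.
  obtain ⟨P, ρ, hP⟩ := exists_isDetProd (wireObj F φ)
    {a | (∃ j, φ.outWire e j = a) ∧ a ∈ Z}.toFinite
  obtain ⟨r, hr', hrρ⟩ := exists_outMap hF e (fun a h => h.1) hP
  have hdisj : Disjoint (φ.generated B ∩ Z) {a | (∃ j, φ.outWire e j = a) ∧ a ∈ Z} := by
    rw [Set.disjoint_left]
    rintro _ ⟨h, -⟩ ⟨⟨j, rfl⟩, -⟩
    exact outWire_notMem he j h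
  have hP' := (hs.isDetProd.union hdisj hP).of_set_eq (generated_insert_inter B e Z)
  refine ⟨P, r, _, hr', hP', fun a h => ?_⟩
  by_cases ha : a ∈ φ.generated B
  · have ha' : a ∈ φ.generated B ∩ Z := ⟨ha, h.2⟩
    have h1 : unionProj ζ ρ a (generated_insert_inter B e Z ▸ h) = fstM _ _ ≫ ζ a ha' :=
      unionProj_left a ha' _
    refine (congrArg _ h1).trans ((pair_fst_assoc _ _ _).trans ?_)
    exact (Category.assoc _ _ _).trans
      ((congrArg _ (hs.comp_ζ a ha')).trans (hl a ha h.1).symm)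
  · obtain ⟨j, rfl⟩ := (generated_insert.1 h.1).resolve_left ha
    have hj : φ.outWire e j ∈ {a | (∃ j, φ.outWire e j = a) ∧ a ∈ Z} := ⟨⟨j, rfl⟩, h.2⟩
    have h1 : unionProj ζ ρ (φ.outWire e j) (generated_insert_inter B e Z ▸ h) =
        sndM _ _ ≫ ρ _ hj :=
      unionProj_right _ (fun h => ha h.1) hj _
    refine (congrArg _ h1).trans ((pair_snd_assoc _ _ _).trans ?_)
    exact (Category.assoc _ _ _).trans
      ((congrArg _ (hrρ j hj)).trans (hr j h.1).symm)

/-- A wire that is a function of `u` and `z`. -/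
theorem Splits.exists_comp_pair_left (hs : Splits X Z g π u v z ζ) (a : φ.G.Wire)
    (h : a ∈ φ.generated B) (ha : a ∈ X ∪ Z) :
    ∃ m : U ⊗ W ⟶ wireObj F φ a, Det m ∧ pair u z ≫ m = π a h := by
  rcases ha with ha | ha
  · obtain ⟨m, hm, hm'⟩ := hs.left a h ha
    exact ⟨fstM _ _ ≫ m, inferInstance, by rw [pair_fst_assoc, hm']⟩
  · have := hs.isDetProd.det a ⟨h, ha⟩
    exact ⟨sndM _ _ ≫ ζ a ⟨h, ha⟩, inferInstance,
      (pair_snd_assoc _ _ _).trans (hs.comp_ζ a ⟨h, ha⟩)⟩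

/-- A wire that is a function of `v` and `z`. -/
theorem Splits.exists_comp_pair_right (hs : Splits X Z g π u v z ζ) (a : φ.G.Wire)
    (h : a ∈ φ.generated B) (ha : a ∉ X) :
    ∃ m : V ⊗ W ⟶ wireObj F φ a, Det m ∧ pair v z ≫ m = π a h := by
  by_cases ha' : a ∈ Z
  · have := hs.isDetProd.det a ⟨h, ha'⟩
    exact ⟨sndM _ _ ≫ ζ a ⟨h, ha'⟩, inferInstance,
      (pair_snd_assoc _ _ _).trans (hs.comp_ζ a ⟨h, ha'⟩)⟩
  · obtain ⟨m, hm, hm'⟩ := hs.right a h ha ha'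
    exact ⟨fstM _ _ ≫ m, inferInstance, by rw [pair_fst_assoc, hm']⟩

/-- The inputs of a box are a deterministic function of the wires they are a function of. -/
theorem exists_inpMap [StrictMonoidal C] (hF : IsStrictMarkov F) {e : φ.G.Edge} (heB : ∀ i, φ.inpWire e i ∈ φ.generated B) {Q : C} (y : T ⟶ Q)
    (h : ∀ i, ∃ m : Q ⟶ wireObj F φ (φ.inpWire e i), Det m ∧ y ≫ m = π _ (heB i)) :
    ∃ s : Q ⟶ F.obj (φ.inpType e), Det s ∧
      ∀ i, (y ≫ s) ≫ proj F _ i (φ.type_inpWire e i).symm = π _ (heB i) := by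
  choose m hm hm' using h
  obtain ⟨s, hs, hs'⟩ := exists_obj_lift hF (φ.inpWire e) (φ.type_inpWire e) m hm
  exact ⟨s, hs, fun i => by rw [Category.assoc, hs', hm']⟩

variable {e : φ.G.Edge}

/-- The box reads only `u` and `z`. All its outputs are appended to `u`, and those in `Z` also to
`z`, so `extend_left` applies. -/
theorem Splits.add_left [StrictMonoidal C] (hC : HasConditionals C) (hF : IsStrictMarkov F)
    (hs : Splits X Z g π u v z ζ) (hB : φ.IsInitial B) (he : e ∉ B)
    (heB : ∀ i, φ.inpWire e i ∈ φ.generated B) (hi : ∀ i, φ.inpWire e i ∈ X ∪ Z)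
    (ho : ∀ j, φ.outWire e j ∈ X ∪ Z) :
    ∃ (T U V W : C) (g : F.obj σ ⟶ T)
      (π : ∀ a, a ∈ φ.generated (insert e B) → (T ⟶ wireObj F φ a)) (u : T ⟶ U)
      (v : T ⟶ V) (z : T ⟶ W) (ζ : _), Splits X Z g π u v z ζ := by
  have := hs.det_u
  have := hs.det_v
  have := hs.det_z
  have := fun σ i s h => hF.det_proj (σ := σ) i (s := s) h
  obtain ⟨s, _, hsi⟩ := exists_inpMap hF heB (pair u z)
    fun i => hs.exists_comp_pair_left _ (heB i) (hi i)
  obtain ⟨π', hπ', hl, hr⟩ := hs.generates.add_box hF hB he heB (pair u z ≫ s) inferInstance hsi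
  obtain ⟨P, r, ζ', _, hP, hζ'⟩ := hs.exists_extension hF he hl hr
  refine ⟨_, _, _, _, _, π', pair (fstM _ _ ≫ u) (sndM _ _), fstM _ _ ≫ v,
    pair (fstM _ _ ≫ z) (sndM _ _ ≫ r), ζ', hπ', inferInstance, inferInstance, inferInstance,
    fun a h hX => ?_, fun a h hX hZ => ?_, hP, hζ', ?_⟩
  · rcases generated_insert.1 h with ha | ⟨j, rfl⟩
    · obtain ⟨m, hm, hm'⟩ := hs.left a ha hX
      exact ⟨fstM _ _ ≫ m, inferInstance, by rw [pair_fst_assoc, Category.assoc, hm', hl]⟩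
    · have := hF.det_proj j (φ.type_outWire e j).symm
      exact ⟨sndM _ _ ≫ proj F _ j (φ.type_outWire e j).symm, inferInstance,
        by rw [pair_snd_assoc, hr]⟩
  · rcases generated_insert.1 h with ha | ⟨j, rfl⟩
    · obtain ⟨m, hm, hm'⟩ := hs.right a ha hX hZ
      exact ⟨m, hm, by rw [Category.assoc, hm', hl]⟩
    · exact absurd (ho j) (fun h => h.elim hX hZ)
  · have h := hs.condIndep.extend_left hC (s ≫ F.map (φ.boxDiagram e).cls) r
    -- Since `u`, `v` and `z` are deterministic, extracting them before or after running the box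
    -- gives the same morphism.
    convert h using 1
    simp only [Category.assoc, det_comp_graph_assoc]
    simp only [comp_pair_assoc, comp_pair, pair_fst, pair_snd, pair_fst_assoc, pair_snd_assoc]

/-- The mirror image of `add_left`, with all outputs appended to `v`. It needs no conditionals,
because in `CondIndep` the wires `v` and `z` are generated jointly. -/
theorem Splits.add_right [StrictMonoidal C] (hF : IsStrictMarkov F)
    (hs : Splits X Z g π u v z ζ) (hB : φ.IsInitial B) (he : e ∉ B)
    (heB : ∀ i, φ.inpWire e i ∈ φ.generated B) (hi : ∀ i, φ.inpWire e i ∉ X)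
    (ho : ∀ j, φ.outWire e j ∉ X) :
    ∃ (T U V W : C) (g : F.obj σ ⟶ T)
      (π : ∀ a, a ∈ φ.generated (insert e B) → (T ⟶ wireObj F φ a)) (u : T ⟶ U)
      (v : T ⟶ V) (z : T ⟶ W) (ζ : _), Splits X Z g π u v z ζ := by
  have := hs.det_u
  have := hs.det_v
  have := hs.det_z
  obtain ⟨s, _, hsi⟩ := exists_inpMap hF heB (pair v z)
    fun i => hs.exists_comp_pair_right _ (heB i) (hi i)
  obtain ⟨π', hπ', hl, hr⟩ := hs.generates.add_box hF hB he heB (pair v z ≫ s) inferInstance hsi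
  obtain ⟨P, r, ζ', _, hP, hζ'⟩ := hs.exists_extension hF he hl hr
  refine ⟨_, _, _, _, _, π', fstM _ _ ≫ u, pair (fstM _ _ ≫ v) (sndM _ _),
    pair (fstM _ _ ≫ z) (sndM _ _ ≫ r), ζ', hπ', inferInstance, inferInstance, inferInstance,
    fun a h hX => ?_, fun a h hX hZ => ?_, hP, hζ', ?_⟩
  · rcases generated_insert.1 h with ha | ⟨j, rfl⟩
    · obtain ⟨m, hm, hm'⟩ := hs.left a ha hX
      exact ⟨m, hm, by rw [Category.assoc, hm', hl]⟩
    · exact absurd hX (ho j)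
  · rcases generated_insert.1 h with ha | ⟨j, rfl⟩
    · obtain ⟨m, hm, hm'⟩ := hs.right a ha hX hZ
      exact ⟨fstM _ _ ≫ m, inferInstance, by rw [pair_fst_assoc, Category.assoc, hm', hl]⟩
    · have := hF.det_proj j (φ.type_outWire e j).symm
      exact ⟨sndM _ _ ≫ proj F _ j (φ.type_outWire e j).symm, inferInstance,
        by rw [pair_snd_assoc, hr]⟩
  · have h := hs.condIndep.extend_right (s ≫ F.map (φ.boxDiagram e).cls) r
    convert h using 1
    simp only [Category.assoc, det_comp_graph_assoc]
    simp only [comp_pair, pair_fst, pair_snd, pair_fst_assoc, pair_snd_assoc]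

/-- If not all wires have been generated, then there is a box that can be applied. -/
theorem exists_next (h : ∃ a, a ∉ φ.generated B) :
    ∃ e ∉ B, ∀ i, φ.inpWire e i ∈ φ.generated B := by
  have := φ.finite_wire
  have hirr : Std.Irrefl (Relation.TransGen φ.G.Step) := ⟨φ.acyclic⟩
  have hwf : WellFounded (Relation.TransGen φ.G.Step) :=
    Finite.wellFounded_of_trans_of_irrefl _
  -- An earliest missing wire is an output of some box, and by minimality all inputs of that box are
  -- present.
  obtain ⟨a, ha, hmin⟩ := hwf.has_min {a | a ∉ φ.generated B} h
  rcases φ.wire_cases a with ⟨i, rfl⟩ | ⟨k, l, b, j, rfl⟩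
  · exact absurd (Or.inl ⟨i, rfl⟩) ha
  · refine ⟨⟨k, l, b⟩, fun he => ha (Or.inr ⟨_, he, j, rfl⟩), fun i => ?_⟩
    by_contra hi
    exact hmin _ hi (.single ⟨k, l, b, ⟨i, rfl⟩, j, rfl⟩)

theorem isInitial_insert (hB : φ.IsInitial B) (heB : ∀ i, φ.inpWire e i ∈ φ.generated B) :
    φ.IsInitial (insert e B) := by
  rintro e' (rfl | h) i
  · exact generated_insert.2 (Or.inl (heB i))
  · exact generated_insert.2 (Or.inl (hB e' h i))

/-- All wires can be generated. -/
theorem exists_splits [StrictMonoidal C] (hC : HasConditionals C) (hF : IsStrictMarkov F)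
    {X Z : Set φ.G.Wire} (hp : ∀ i, φ.p i ∉ X)
    (hbox : ∀ {k l : ℕ} (b : φ.G.Box k l),
      (∀ a, φ.G.Incident b a → a ∈ X ∪ Z) ∨ ∀ a, φ.G.Incident b a → a ∉ X) :
    ∃ B : Set φ.G.Edge, (∀ a, a ∈ φ.generated B) ∧
      ∃ (T U V W : C) (g : F.obj σ ⟶ T)
      (π : ∀ a, a ∈ φ.generated B → (T ⟶ wireObj F φ a)) (u : T ⟶ U)
      (v : T ⟶ V) (z : T ⟶ W) (ζ : _), Splits X Z g π u v z ζ := by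
  have := φ.finite_edge
  let A : Set (Set φ.G.Edge) := {B | φ.IsInitial B ∧ ∃ (T U V W : C) (g : F.obj σ ⟶ T)
      (π : ∀ a, a ∈ φ.generated B → (T ⟶ wireObj F φ a)) (u : T ⟶ U)
      (v : T ⟶ V) (z : T ⟶ W) (ζ : _), Splits X Z g π u v z ζ}
  -- Maximality replaces a topological ordering of the boxes. A maximal `B` need not contain every
  -- box, but it generates every wire.
  obtain ⟨B, ⟨hB, hS⟩, hmax⟩ := A.toFinite.exists_maximal
    ⟨∅, fun e he => he.elim, exists_splits_empty hF Z hp⟩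
  refine ⟨B, ?_, hS⟩
  by_contra! h
  obtain ⟨e, he, heB⟩ := exists_next h
  obtain ⟨T, U, V, W, g, π, u, v, z, ζ, hs⟩ := hS
  refine he (hmax (y := insert e B) ⟨isInitial_insert hB heB, ?_⟩ (Set.subset_insert e B)
    (Set.mem_insert e B))
  rcases hbox e.2.2 with h | h
  · exact hs.add_left hC hF hB he heB (fun i => h _ (Or.inl ⟨i, rfl⟩))
      fun j => h _ (Or.inr ⟨j, rfl⟩)
  · exact hs.add_right hF hB he heB (fun i => h _ (Or.inl ⟨i, rfl⟩))
      fun j => h _ (Or.inr ⟨j, rfl⟩)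

end Diagram

end CausalModels

end

noncomputable section

namespace CausalModels

/-! ### Soundness of d-separation -/

namespace BoxHypergraph

theorem mem_cutList {G : BoxHypergraph.{u}} {Z : Set G.Wire} {L : List G.Wire}
    {a : {a : G.Wire // a ∉ Z}} (h : a.1 ∈ L) : a ∈ G.cutList Z L :=
  List.mem_filterMap.2 ⟨a.1, h, dif_pos a.2⟩

/-- A box connects the wires that remain after a cut. -/
theorem UndirectedPath.tail_cut {G : BoxHypergraph.{u}} {Z : Set G.Wire} {a b c : (G.cut Z).Wire}
    (h : (G.cut Z).UndirectedPath a b) {k l : ℕ} (e : G.Box k l) (hb : G.Incident e b.1)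
    (hc : G.Incident e c.1) : (G.cut Z).UndirectedPath a c := by
  have key : ∀ d : (G.cut Z).Wire, G.Incident e d.1 →
      (G.cut Z).Incident (⟨⟨k, l, e⟩, rfl, rfl⟩ : (G.cut Z).Box _ _) d := by
    rintro d (⟨i, hi⟩ | ⟨j, hj⟩)
    · exact Or.inl (List.mem_iff_get.1 (mem_cutList ((List.mem_ofFn' _ _).2 ⟨i, hi⟩)))
    · exact Or.inr (List.mem_iff_get.1 (mem_cutList ((List.mem_ofFn' _ _).2 ⟨j, hj⟩)))
  exact Relation.ReflTransGen.tail h ⟨_, _, _, key b hb, key c hc⟩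

end BoxHypergraph

namespace Diagram

open FreeMarkov IsStrictMarkov

variable {S : BoxHypergraph.{u}} {σ τ : FreeMarkov S} (φ : Diagram S σ τ)

/-- The wires outside of `Z` that are connected to a wire in `X` after cutting `Z`. -/
def connectedTo (X Z : Set φ.G.Wire) : Set φ.G.Wire :=
  {a | ∃ (h : a ∉ Z) (x : (φ.G.cut Z).Wire), x.1 ∈ X ∧ (φ.G.cut Z).UndirectedPath x ⟨a, h⟩}

/-- If one wire of `b` is connected to `X`, the path extends through `b` to each of its wires
outside `Z`. This is exactly the hypothesis on boxes in `exists_splits`. -/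
theorem connectedTo_box (X Z : Set φ.G.Wire) {k l : ℕ} (b : φ.G.Box k l) :
    (∀ a, φ.G.Incident b a → a ∈ φ.connectedTo X Z ∪ Z) ∨
      ∀ a, φ.G.Incident b a → a ∉ φ.connectedTo X Z := by
  by_cases h : ∃ a, φ.G.Incident b a ∧ a ∈ φ.connectedTo X Z
  · obtain ⟨a, ha, haZ, x, hx, hxa⟩ := h
    refine Or.inl fun c hc => ?_
    by_cases hcZ : c ∈ Z
    · exact Or.inr hcZ
    · exact Or.inl ⟨hcZ, x, hx, hxa.tail_cut b ha hc⟩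
  · exact Or.inr fun a ha h' => h ⟨a, ha, h'⟩

/-- The position of an output of the marginal among all outputs. -/
def keptIdx (W : Set φ.G.Wire) : Fin (φ.keptType W).len → Fin τ.len := (φ.keptOutputs W).get

theorem keptIdx_ty (W : Set φ.G.Wire) (k : Fin (φ.keptType W).len) :
    τ.ty (φ.keptIdx W k) = (φ.keptType W).ty k := rfl

theorem exists_keptIdx_eq {W : Set φ.G.Wire} {i : Fin τ.len} (h : φ.q i ∈ W) :
    ∃ k, φ.keptIdx W k = i :=
  List.mem_iff_get.1 (List.mem_filter.2 ⟨List.mem_finRange i, by simpa using h⟩)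

theorem cls_marginal (W : Set φ.G.Wire) : (φ.marginal W).cls =
    φ.cls ≫ FreeMarkov.wire τ (φ.keptType W) (φ.keptIdx W) (φ.keptIdx_ty W) := by
  rw [marginal, cls_norm, cls_comp_wire]
  rfl

theorem marginalWire_injective (W : Set φ.G.Wire) : Function.Injective (φ.marginalWire W) :=
  Subtype.val_injective

variable {C : Type w} [Category.{v} C] [MonoidalCategory C] [MarkovCategory C]
  {F : FreeMarkov S ⥤ C} {φ}

/-- The global outputs are a deterministic function of the generated wires. -/
theorem Generates.exists_outputs [StrictMonoidal C] (hF : IsStrictMarkov F) {B : Set φ.G.Edge}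
    {T : C} {g : F.obj σ ⟶ T} {π : ∀ a, a ∈ φ.generated B → (T ⟶ wireObj F φ a)}
    (hg : Generates F φ g π) (hB : ∀ j, φ.q j ∈ φ.generated B) :
    ∃ ω : T ⟶ F.obj τ, Det ω ∧ (∀ j, ω ≫ proj F τ j (φ.type_q j).symm = π _ (hB j)) ∧
      F.map φ.cls = g ≫ ω := by
  obtain ⟨ω, hω, hω'⟩ := exists_obj_lift hF φ.q φ.type_q (fun j => π _ (hB j))
    fun j => hg.det _ _
  exact ⟨ω, hω, hω', hg.map_cls τ φ.q φ.type_q hB ω hω hω'⟩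

open Classical in
/-- The marginals on sets of outputs that are kept are functions of the marginal. -/
theorem exists_discardCompl_factor [StrictMonoidal C] (hF : IsStrictMarkov F) (W : Set φ.G.Wire)
    (J : Set (Fin τ.len)) (hJ : ∀ j ∈ J, φ.q j ∈ W)
    (e : F.obj τ = tensorFin (fun j => F.obj (single (τ.ty j)))) :
    ∃ D : F.obj (φ.keptType W) ⟶ tensorOn (fun j => F.obj (single (τ.ty j))) J, Det D ∧
      eqToHom e ≫ discardCompl (fun j => F.obj (single (τ.ty j))) J (List.finRange τ.len) =
        F.map (FreeMarkov.wire τ (φ.keptType W) (φ.keptIdx W) (φ.keptIdx_ty W)) ≫ D ∧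
      ∀ j h, ∃ (k : _) (hk : φ.keptIdx W k = j), D ≫ tproj _ _ j h =
        proj F _ k ((φ.keptIdx_ty W k).symm.trans (congrArg τ.ty hk)) := by
  have hP := isDetProd_tensorOver (fun j => F.obj (single (τ.ty j)))
    ((List.nodup_finRange τ.len).filter (fun j => decide (j ∈ J)))
  have hk : ∀ j, j ∈ (List.finRange τ.len).filter (fun j => decide (j ∈ J)) →
      ∃ k, φ.keptIdx W k = j := fun j h =>
    exists_keptIdx_eq φ (hJ j (by simpa using (List.mem_filter.1 h).2))
  choose κ hκ using hk
  obtain ⟨D, hD, hD'⟩ := hP.exists_lift (F.obj (φ.keptType W)) (fun j h =>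
    proj F _ (κ j h) ((φ.keptIdx_ty W _).symm.trans (congrArg τ.ty (hκ j h))))
    fun j h => hF.det_proj _ _
  refine ⟨D, hD, ?_, fun j h => ⟨κ j h, hκ j h, hD' j h⟩⟩
  have := det_discardCompl (V := fun j => F.obj (single (τ.ty j))) J (List.finRange τ.len)
  have := hF.det_map_wire (φ.keptIdx W) (φ.keptIdx_ty W)
  -- Both sides are deterministic, so it suffices to compare components, and each of these is a
  -- projection of the image of `τ`.
  refine hP.hom_ext _ _ _ inferInstance inferInstance fun j h => ?_
  rw [Category.assoc, Category.assoc, hD' j h, map_wire_proj, discardCompl_tproj]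
  exact (hF.eqToHom_tproj_finRange τ.ty e j).trans (proj_congr F (hκ j h).symm _ _)

/-- Conditional independence of functions of separated wires. -/
theorem Splits.condIndep_pair {X Z : Set φ.G.Wire} {B : Set φ.G.Edge} {T U V W : C}
    {g : F.obj σ ⟶ T} {π : ∀ a, a ∈ φ.generated B → (T ⟶ wireObj F φ a)} {u : T ⟶ U} {v : T ⟶ V}
    {z : T ⟶ W} {ζ : ∀ a, a ∈ φ.generated B ∩ Z → (W ⟶ wireObj F φ a)}
    (hs : Splits X Z g π u v z ζ) (hB : ∀ a, a ∈ φ.generated B) {ι : Type*} {A : ι → C}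
    {I J K : Set ι} {P Q R : C} {ρ : ∀ i, i ∈ I → (P ⟶ A i)} {ρ' : ∀ i, i ∈ J → (Q ⟶ A i)}
    {ρ'' : ∀ i, i ∈ K → (R ⟶ A i)} (hP : IsDetProd A I P ρ) (hQ : IsDetProd A J Q ρ')
    (hR : IsDetProd A K R ρ'') (x : T ⟶ P) (y : T ⟶ Q) (t : T ⟶ R) [hx : Det x] [hy : Det y]
    [ht : Det t]
    (hx' : ∀ i h, ∃ a ∈ X, ∃ e : wireObj F φ a = A i, x ≫ ρ i h = π a (hB a) ≫ eqToHom e)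
    (hy' : ∀ i h, ∃ a ∉ X, a ∉ Z ∧ ∃ e : wireObj F φ a = A i,
      y ≫ ρ' i h = π a (hB a) ≫ eqToHom e)
    (κ : ∀ i, i ∈ K → φ.G.Wire) (hκ : ∀ i h, κ i h ∈ Z) (e : ∀ i h, wireObj F φ (κ i h) = A i)
    (ht' : ∀ i h, t ≫ ρ'' i h = π (κ i h) (hB _) ≫ eqToHom (e i h))
    (hκ' : ∀ a ∈ Z, ∃ i h, κ i h = a) : CondIndep (g ≫ pair x (pair y t)) := by
  have := hs.det_u
  have := hs.det_v
  have := hs.det_z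
  have hBZ : ∀ {a}, a ∈ Z → a ∈ φ.generated B ∩ Z := fun h => ⟨hB _, h⟩
  -- Every component of `x` is a wire in `X`, hence a function of `u`; likewise `y` factors through
  -- `v`, and `t` through `z`.
  obtain ⟨a, ha, rfl⟩ := hP.exists_factor x u fun i h => by
    obtain ⟨a, ha, e, h'⟩ := hx' i h
    obtain ⟨m, hm, hm'⟩ := hs.left a (hB a) ha
    exact ⟨m ≫ eqToHom e, inferInstance, by rw [h', ← hm', Category.assoc]⟩
  obtain ⟨b, hb, rfl⟩ := hQ.exists_factor y v fun i h => by
    obtain ⟨a, ha, ha', e, h'⟩ := hy' i h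
    obtain ⟨m, hm, hm'⟩ := hs.right a (hB a) ha ha'
    exact ⟨m ≫ eqToHom e, inferInstance, by rw [h', ← hm', Category.assoc]⟩
  have hζ := hs.isDetProd.det
  obtain ⟨c, hc, hc'⟩ := hR.exists_lift W
    (fun i h => ζ (κ i h) (hBZ (hκ i h)) ≫ eqToHom (e i h)) fun i h => inferInstance
  have hzc : z ≫ c = t := by
    refine hR.hom_ext _ _ _ inferInstance ht fun i h => ?_
    rw [Category.assoc, hc', ht', ← Category.assoc]
    exact congrArg (· ≫ eqToHom (e i h)) (hs.comp_ζ _ _)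
  -- Every wire in `Z` is listed by some index in `K`, so `z` can be read off from `t`. This
  -- provides the retraction `d` of `c` required by `CondIndep.map`.
  choose ν hν hν' using hκ'
  have hρ := hR.det
  have e' : ∀ a (h : a ∈ Z), A (ν a h) = wireObj F φ a := fun a h =>
    (e _ (hν a h)).symm.trans (congrArg (wireObj F φ) (hν' a h))
  obtain ⟨d, hd, hd'⟩ := hs.isDetProd.exists_lift R
    (fun a h => ρ'' (ν a h.2) (hν a h.2) ≫ eqToHom (e' a h.2)) fun a h => inferInstance
  have hcd : c ≫ d = 𝟙 W := by
    refine hs.isDetProd.hom_ext _ _ _ inferInstance inferInstance fun a h => ?_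
    have hcongr : ∀ a' (_ : a' = a) (h' : a' ∈ φ.generated B ∩ Z)
        (ea : wireObj F φ a' = wireObj F φ a), ζ a' h' ≫ eqToHom ea = ζ a h := by
      rintro _ rfl _ _
      rw [eqToHom_refl, Category.comp_id]
    rw [Category.assoc, hd', ← Category.assoc, hc', Category.assoc, eqToHom_trans,
      Category.id_comp]
    exact hcongr _ (hν' a h.2) _ _
  rw [← hzc, ← pair_tensorHom, ← pair_tensorHom, ← Category.assoc]
  exact hs.condIndep.map a b c d hcd

end Diagram

end CausalModels

end

/-! ### The corollary. -/

open CausalModels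
theorem mainTheorem2 {C : Type w} [Category.{v} C] [MonoidalCategory C] [MarkovCategory C]
    [StrictMonoidal C] (hC : HasConditionals C)
    {S : BoxHypergraph.{u}} {σ τ : FreeMarkov S} (φ : Diagram S σ τ) (hφ : φ.IsCausalModel)
    (W' : Fin σ.len → C) (V' : Fin τ.len → C) (f : tensorFin W' ⟶ tensorFin V')
    (hf : Compatible φ hφ.normalized W' V' f)
    (X Y Z : Set φ.G.Wire)
    (hX : X ⊆ φ.outWires) (hY : Y ⊆ φ.outWires) (hZ : Z ⊆ φ.outWires)
    (hXY : Disjoint X Y) (hXZ : Disjoint X Z) (hYZ : Disjoint Y Z)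
    (hin : φ.inWires ⊆ Y ∪ Z) (hsep : φ.DSeparates Z X Y) :
    CondIndep (marginal₃ f {j | φ.q j ∈ X} {j | φ.q j ∈ Y} {j | φ.q j ∈ Z}) := by
  classical
  obtain ⟨F, hF, hW, hV, rfl⟩ := hf
  obtain rfl : V' = fun j => F.obj (FreeMarkov.single (τ.ty j)) :=
    funext fun j => by rw [hV, φ.type_q]
  let ψ := φ.marginal (X ∪ Y ∪ Z)
  let Zs : Set ψ.G.Wire := {c | φ.marginalWire _ c ∈ Z}
  let Xs : Set ψ.G.Wire := ψ.connectedTo {c | φ.marginalWire _ c ∈ X} Zs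
  -- This is where d-separation enters.
  have hY' : ∀ a : ψ.G.Wire, φ.marginalWire _ a ∈ Y → a ∉ Xs := by
    rintro a ha ⟨h, x, hx, hxa⟩
    exact hsep x ⟨a, h⟩ hx ha hxa
  have hX' : ∀ a : ψ.G.Wire, φ.marginalWire _ a ∈ X → a ∈ Xs := fun a ha =>
    ⟨fun h => Set.disjoint_left.1 hXZ ha h, ⟨a, fun h => Set.disjoint_left.1 hXZ ha h⟩, ha,
      Relation.ReflTransGen.refl⟩
  have hp : ∀ i, ψ.p i ∉ Xs := fun i => by
    rcases hin ⟨i, rfl⟩ with h | h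
    · exact hY' (ψ.p i) h
    · rintro ⟨h', -⟩
      exact h' h
  obtain ⟨B, hB, T, U, V, W, g, π, u, v, z, ζ, hs⟩ :=
    Diagram.exists_splits hC hF hp (ψ.connectedTo_box {c | φ.marginalWire _ c ∈ X} Zs)
  obtain ⟨ω, hω, hωq, hψ⟩ := hs.generates.exists_outputs hF fun j => hB _
  have e : F.obj τ = tensorFin (fun j => F.obj (FreeMarkov.single (τ.ty j))) := hF.obj_eq τ
  obtain ⟨D, hD, hD', hDq⟩ := φ.exists_discardCompl_factor hF (X ∪ Y ∪ Z) {j | φ.q j ∈ X}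
    (fun j h => Or.inl (Or.inl h)) e
  obtain ⟨D₂, hD₂, hD₂', hDq₂⟩ := φ.exists_discardCompl_factor hF (X ∪ Y ∪ Z) {j | φ.q j ∈ Y}
    (fun j h => Or.inl (Or.inr h)) e
  obtain ⟨D₃, hD₃, hD₃', hDq₃⟩ := φ.exists_discardCompl_factor hF (X ∪ Y ∪ Z) {j | φ.q j ∈ Z}
    (fun j h => Or.inr h) e
  -- Each component of a marginal is the generated value of the output wire of `ψ` at the
  -- corresponding position, up to transport.
  have key : ∀ (J : Set (Fin τ.len)) (D : F.obj (φ.keptType (X ∪ Y ∪ Z)) ⟶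
      tensorOn (fun j => F.obj (FreeMarkov.single (τ.ty j))) J),
      (∀ j h, ∃ (k : _) (hk : φ.keptIdx _ k = j), D ≫ tproj _ _ j h =
        IsStrictMarkov.proj F _ k ((φ.keptIdx_ty _ k).symm.trans (congrArg τ.ty hk))) →
      ∀ j h, ∃ k, φ.keptIdx _ k = j ∧ ∃ e : Diagram.wireObj F ψ (ψ.q k) =
        F.obj (FreeMarkov.single (τ.ty j)),
        (ω ≫ D) ≫ tproj _ _ j h = π (ψ.q k) (hB _) ≫ eqToHom e := by
    intro J D h j hj
    obtain ⟨k, rfl, hk⟩ := h j hj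
    have e : ψ.type.wire (ψ.q k) = τ.ty (φ.keptIdx _ k) := ψ.type_q k
    refine ⟨k, rfl, congrArg (fun s => F.obj (FreeMarkov.single s)) e, ?_⟩
    rw [Category.assoc, hk, ← hωq, Category.assoc]
    exact congrArg (ω ≫ ·) (IsStrictMarkov.proj_eqToHom F k (ψ.type_q k).symm e _).symm
  have hq : ∀ {j k}, φ.keptIdx (X ∪ Y ∪ Z) k = j → φ.marginalWire _ (ψ.q k) = φ.q j := by
    rintro _ k rfl
    rfl
  have hmem : ∀ {J : Set (Fin τ.len)} {j},
      j ∈ (List.finRange τ.len).filter (fun j => decide (j ∈ J)) → j ∈ J := fun h => by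
    simpa using (List.mem_filter.1 h).2
  choose κ hκ hκe hκ' using key _ D₃ hDq₃
  have hP := fun J : Set (Fin τ.len) => isDetProd_tensorOver
    (fun j => F.obj (FreeMarkov.single (τ.ty j)))
    ((List.nodup_finRange τ.len).filter (fun j => decide (j ∈ J)))
  have hind := hs.condIndep_pair hB (hP {j | φ.q j ∈ X}) (hP {j | φ.q j ∈ Y}) (hP {j | φ.q j ∈ Z})
    (ω ≫ D) (ω ≫ D₂) (ω ≫ D₃)
    (fun j h => by
      obtain ⟨k, hk, h'⟩ := key _ D hDq j h
      exact ⟨ψ.q k, hX' _ (by rw [hq hk]; exact hmem h), h'⟩)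
    (fun j h => by
      obtain ⟨k, hk, h'⟩ := key _ D₂ hDq₂ j h
      have hj : φ.marginalWire _ (ψ.q k) ∈ Y := by rw [hq hk]; exact hmem h
      exact ⟨ψ.q k, hY' _ hj, Set.disjoint_left.1 hYZ hj, h'⟩)
    (fun j h => ψ.q (κ j h))
    (fun j h => by
      change φ.marginalWire _ (ψ.q (κ j h)) ∈ Z
      rw [hq (hκ j h)]
      exact hmem h)
    hκe hκ'
    -- As 𝒵 consists of output wires, every wire of `ψ` in 𝒵 appears among the outputs of the
    -- marginal.
    (fun a ha => by
      obtain ⟨j, hj⟩ := hZ ha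
      have hj' : j ∈ (List.finRange τ.len).filter (fun j => decide (j ∈ {j | φ.q j ∈ Z})) :=
        List.mem_filter.2 ⟨List.mem_finRange j, decide_eq_true (show φ.q j ∈ Z from hj ▸ ha)⟩
      exact ⟨j, hj', φ.marginalWire_injective _ ((hq (hκ j hj')).trans hj)⟩)
  have hw := hF.det_map_wire (φ.keptIdx (X ∪ Y ∪ Z)) (φ.keptIdx_ty _)
  have hω' : F.map (φ.toHom hφ.normalized) ≫ F.map (FreeMarkov.wire τ (φ.keptType (X ∪ Y ∪ Z))
      (φ.keptIdx _) (φ.keptIdx_ty _)) = g ≫ ω := by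
    rw [Diagram.toHom_eq_cls, ← F.map_comp, ← φ.cls_marginal, hψ]
  -- The three marginals factor through one wiring, the one that keeps the outputs in 𝒳 ∪ 𝒴 ∪ 𝒵. It
  -- is deterministic, so it can be pulled out of the pairing.
  have hpair : eqToHom e ≫
      pair (discardCompl (fun j => F.obj (FreeMarkov.single (τ.ty j))) {j | φ.q j ∈ X} _)
        (pair (discardCompl (fun j => F.obj (FreeMarkov.single (τ.ty j))) {j | φ.q j ∈ Y} _)
          (discardCompl (fun j => F.obj (FreeMarkov.single (τ.ty j))) {j | φ.q j ∈ Z} _)) =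
      F.map (FreeMarkov.wire τ (φ.keptType (X ∪ Y ∪ Z)) (φ.keptIdx _) (φ.keptIdx_ty _)) ≫
        pair D (pair D₂ D₃) := by
    rw [comp_pair, comp_pair, hD', hD₂', hD₃', comp_pair, comp_pair]
  have hσ : W' = fun i => F.obj (FreeMarkov.single (σ.ty i)) :=
    funext fun i => by rw [hW i, φ.type_p i]
  -- The transport on the input side is absorbed into the first stage of the conditional
  -- independence.
  have hfinal := hind.precomp (eqToHom ((congrArg tensorFin hσ).trans (hF.obj_eq σ).symm))
  convert hfinal using 1
  change (_ ≫ _ ≫ eqToHom e) ≫ pair _ (pair _ _) = _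
  rw [Category.assoc, Category.assoc, hpair, ← comp_pair, ← comp_pair, ← Category.assoc g, ← hω',
    Category.assoc]
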